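/- **Conventions.** Let $\mathsf{Gr}$ be the category of real Grassmann algebras $\Lambda_n=\bigwedge\mathbb R^n$ ($n\ge 0$) and $\mathbb Z/2$-graded unital algebra morphisms; $\Lambda=\Lambda_{\bar 0}\oplus\Lambda_{\bar 1}$ and $\epsilon:\Lambda\to\mathbb R$ is the augmentation. Let $\overline{\mathbb R}$ be the ring object $\Lambda\mapsto\Lambda_{\bar 0}$. An $\overline{\mathbb R}$-module is a functor $X$ on $\mathsf{Gr}$ with a $\Lambda_{\bar 0}$-module structure on every $X(\Lambda)$ for which every $X(\varphi)$ is additive and $\varphi|_{\Lambda_{\bar 0}}$-semilinear; morphisms are the natural transformations that are $\Lambda_{\bar 0}$-linear for every $\Lambda$. For a real super vector space $V=V_{\bar 0}\oplus V_{\bar 1}$, the bar-construction is the $\overline{\mathbb R}$-module $\overline V(\Lambda)=(\Lambda\otimes V)_{\bar 0}=(\Lambda_{\bar 0}\otimes V_{\bar 0})\oplus(\Lambda_{\bar 1}\otimes V_{\bar 1})$. An $\overline{\mathbb R}$-module is *superrepresentable* if it is isomorphic to $\overline V$ for some super vector space $V$. $\Pi$ denotes parity change. Model spaces are super vector spaces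 $V$ with $V_{\bar 0},V_{\bar 1}$ real Hausdorff locally convex spaces (for example finite-dimensional or Fréchet); $\overline V(\Lambda)$ carries the product topology. A *superdomain* $\overline V|_U$, $U\subseteq V_{\bar 0}$ open, is the functor $\Lambda\mapsto\{x\in\overline V(\Lambda):\epsilon(x)\in U\}$. A *supersmooth* map between functors of this kind is a natural transformation which for every $\Lambda$ is $C^\infty$ (in the sense of Michal–Bastiani) with $\Lambda_{\bar 0}$-linear derivatives. A *supermanifold* $\mathcal M$ is a functor $\mathsf{Gr}\to\mathsf{Top}$ with an atlas of superdomains: natural open embeddings that are jointly surjective for every $\Lambda$ and have supersmooth changes of charts. The superpoint $\mathcal P(\Lambda_n)\cong\overline{\mathbb R^{0|n}}$ is the supermanifold $\Lambda'\mapsto\mathrm{Hom}_{\mathsf{Gr}}(\Lambda_n,\Lambda')$. A *real super vector bundle* $\mathcal E\to\mathcal M$ consists of $\Lambda_{\bar 0}$-modules $\mathcal E(\Lambda)_m$, $m\in\mathcal M(\Lambda)$, functorial (semilinearly) in $\Lambda$, and an atlas of trivializations: charts $f_\alpha:\mathcal U_\alpha\to\mathcal M$ $(\alpha\in A)$ by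 superdomains that cover $\mathcal M$ and whose union with the atlas of $\mathcal M$ is an atlas, topological super vector spaces $V_\alpha$, all isomorphic to one another, and $\Lambda_{\bar 0}$-linear isomorphisms, natural in $\Lambda$, of $\mathcal E(\Lambda)_m$ with $\overline{V_\alpha}(\Lambda)$ for $m\in f_\alpha(\mathcal U_\alpha(\Lambda))$, such that all transition maps $(u,e)\mapsto g_{\alpha\beta}(u)e$ are supersmooth on the overlaps. *Sections* over an open subfunctor $\mathcal N\subseteq\mathcal M$ are natural families of elements of $\mathcal E(\Lambda)_m$, $m\in\mathcal N(\Lambda)$, that are supersmooth in all trivializations. Define $$\hat\Gamma(\mathcal N,\mathcal E)(\Lambda)=\Gamma(\mathcal P(\Lambda)\times\mathcal N,\ \pi_{\mathcal N}^*\mathcal E),\qquad \hat\Gamma(\mathcal N,\mathcal E)(\varphi)(\sigma)=\sigma\circ(\mathcal P(\varphi)\times\mathrm{id}_{\mathcal N}).$$ It is an $\overline{\mathbb R}$-module: $a\in\Lambda_{\bar 0}$ acts by $(a\sigma)(\eta,m)=\eta(a)\,\sigma(\eta,m)$ for $\eta\in\mathcal P(\Lambda)(\Lambda')=\mathrm{Hom}(\Lambda,\Lambda')$.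 For a superdomain $\mathcal U$ and a topological super vector space $V$, let $SC^\infty(\mathcal U,\overline V)$ be the real vector space of supersmooth maps $\mathcal U\to\overline V$, and let $SC^\infty(\mathcal U,V\oplus\Pi V)$ be the super vector space with even part $SC^\infty(\mathcal U,\overline V)$ and odd part $SC^\infty(\mathcal U,\overline{\Pi V})$. **Theorem.** Let $\mathcal E\to\mathcal M$ be a real super vector bundle with trivializations over charts $f_\alpha:\mathcal U_\alpha\to\mathcal M$ with fibres $\overline{V_\alpha}$, $\alpha\in A$, and let $\mathcal M_\alpha=f_\alpha(\mathcal U_\alpha)\subseteq\mathcal M$. Then: 1. $\hat\Gamma(\mathcal M,\mathcal E)$ is a superrepresentable $\overline{\mathbb R}$-module. 2. For every $\alpha$, pulling back sections along the trivialization over $\mathcal U_\alpha$ is an isomorphism of $\overline{\mathbb R}$-modules $\hat\Gamma(\mathcal M_\alpha,\mathcal E)\to\hat\Gamma(\mathcal U_\alpha,\mathcal U_\alpha\times\overline{V_\alpha})$, and $$\hat\Gamma(\mathcal U_\alpha,\mathcal U_\alpha\times\overline{V_\alpha})\cong\overline{SC^\infty(\mathcal U_\alpha,V_\alpha\oplus\Pi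 V_\alpha)}$$ as $\overline{\mathbb R}$-modules. 3. With the restriction maps, $\hat\Gamma(\mathcal M,\mathcal E)$ is the limit, in the category of $\overline{\mathbb R}$-modules, of the diagram formed by all $\hat\Gamma(\mathcal M_\alpha,\mathcal E)\to\hat\Gamma(\mathcal M_\alpha\cap\mathcal M_\beta,\mathcal E)\leftarrow\hat\Gamma(\mathcal M_\beta,\mathcal E)$, $\alpha,\beta\in A$. -/

import Mathlib

open CategoryTheory TensorProduct Topology

universe u v w w'

/-! ### Smooth maps between locally convex spaces -/

/-- `w` is the derivative of `f` at `x` in the direction `v`. -/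
def HasDirDeriv {E : Type u} {F : Type v} [AddCommGroup E] [Module ℝ E] [AddCommGroup F]
    [Module ℝ F] [TopologicalSpace F] (f : E → F) (x v : E) (w : F) : Prop :=
  Filter.Tendsto (fun t : ℝ => t⁻¹ • (f (x + t • v) - f x)) (𝓝[≠] 0) (𝓝 w)

/-- `f` is of class `C^k` (in the sense of Michal and Bastiani) on the open set `S`: it is
continuous, all directional derivatives `df (x, v)` exist, and `df` is of class `C^(k-1)`. -/
def CkOn : ∀ (_ : ℕ) {E : Type u} {F : Type v} [AddCommGroup E] [Module ℝ E] [TopologicalSpace E]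
    [AddCommGroup F] [Module ℝ F] [TopologicalSpace F], (E → F) → Set E → Prop
  | 0, _, _, _, _, _, _, _, _, f, S => ContinuousOn f S
  | k + 1, E, F, _, _, _, _, _, _, f, S => ContinuousOn f S ∧ ∃ df : E × E → F,
      (∀ x ∈ S, ∀ v, HasDirDeriv f x v (df (x, v))) ∧ CkOn k df (S ×ˢ Set.univ)

/-- Supersmoothness of a map between locally convex modules over a ring `A` (an even Grassmann
algebra): `f` is smooth on the open set `S` and all its derivatives `df (x, ·)` are `A`-linear
(additivity being automatic). -/
def SupersmoothOn (A : Type w) [Semiring A] {E : Type u} {F : Type v} [AddCommGroup E] [Module ℝ E]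
    [TopologicalSpace E] [AddCommGroup F] [Module ℝ F] [TopologicalSpace F] [Module A E]
    [Module A F] (f : E → F) (S : Set E) : Prop :=
  (∀ k, CkOn k f S) ∧ ∃ df : E × E → F, ContinuousOn df (S ×ˢ Set.univ) ∧
    (∀ x ∈ S, ∀ v, HasDirDeriv f x v (df (x, v))) ∧
    ∀ x ∈ S, ∀ (a : A) (v : E), df (x, a • v) = a • df (x, v)

section Calculus

set_option linter.unusedSectionVars false

variable {E : Type u} {F : Type v} {G : Type w} {H : Type w'}
  [AddCommGroup E] [Module ℝ E] [TopologicalSpace E] [IsTopologicalAddGroup E]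
  [ContinuousSMul ℝ E]
  [AddCommGroup F] [Module ℝ F] [TopologicalSpace F] [IsTopologicalAddGroup F]
  [ContinuousSMul ℝ F]
  [AddCommGroup G] [Module ℝ G] [TopologicalSpace G] [IsTopologicalAddGroup G]
  [ContinuousSMul ℝ G]
  [AddCommGroup H] [Module ℝ H] [TopologicalSpace H] [IsTopologicalAddGroup H]
  [ContinuousSMul ℝ H]

theorem CkOn.continuousOn {k : ℕ} {f : E → F} {S : Set E} (h : CkOn k f S) :
    ContinuousOn f S := by
  cases k with
  | zero => exact h
  | succ k => exact h.1

theorem CkOn.of_succ {k : ℕ}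
    {f : E → F} {S : Set E} (h : CkOn (k + 1) f S) :
    CkOn k f S := by
  induction k generalizing E with
  | zero => exact h.1
  | succ k ih =>
    obtain ⟨hc, df, hd, hk⟩ := h
    exact ⟨hc, df, hd, ih hk⟩

theorem HasDirDeriv.clm_comp {f : E → F} {x v : E} {w : F} (L : F →L[ℝ] G)
    (h : HasDirDeriv f x v w) : HasDirDeriv (fun y => L (f y)) x v (L w) := by
  have := (L.continuous.tendsto w).comp h
  refine this.congr fun t => ?_
  simp

theorem HasDirDeriv.comp_clm {f : F → G} (L : E →L[ℝ] F) {x v : E} {w : G}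
    (h : HasDirDeriv f (L x) (L v) w) : HasDirDeriv (fun y => f (L y)) x v w := by
  refine Filter.Tendsto.congr (fun t => ?_) h
  simp

theorem HasDirDeriv.prodMk {f : E → F} {g : E → G} {x v : E} {w : F} {z : G}
    (h : HasDirDeriv f x v w) (h' : HasDirDeriv g x v z) :
    HasDirDeriv (fun y => (f y, g y)) x v (w, z) := by
  have := Filter.Tendsto.prodMk_nhds h h'
  refine this.congr fun t => ?_
  simp

theorem hasDirDeriv_clm (L : E →L[ℝ] F) (x v : E) : HasDirDeriv (fun y => L y) x v (L v) := by
  refine Filter.Tendsto.congr' ?_ tendsto_const_nhds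
  filter_upwards [self_mem_nhdsWithin] with t ht
  have ht : t ≠ 0 := ht
  simp [smul_smul, ht]

theorem hasDirDeriv_const (c : F) (x v : E) : HasDirDeriv (fun _ => c) x v 0 := by
  simpa [HasDirDeriv] using tendsto_const_nhds

theorem HasDirDeriv.bilin {f : E → F} {g : E → G} (B : F →ₗ[ℝ] G →ₗ[ℝ] H)
    (hB : Continuous fun p : F × G => B p.1 p.2) {x v : E} {w : F} {z : G}
    (h : HasDirDeriv f x v w) (h' : HasDirDeriv g x v z) :
    HasDirDeriv (fun y => B (f y) (g y)) x v (B w (g x) + B (f x) z) := by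
  have hg : Filter.Tendsto (fun t : ℝ => g (x + t • v)) (𝓝[≠] 0) (𝓝 (g x)) := by
    have h0 : Filter.Tendsto (fun t : ℝ => t) (𝓝[≠] 0) (𝓝 0) :=
      Filter.tendsto_id.mono_left nhdsWithin_le_nhds
    have h1 := (h0.smul h').add_const (g x)
    rw [zero_smul, zero_add] at h1
    refine h1.congr' ?_
    filter_upwards [self_mem_nhdsWithin] with t ht
    have ht : t ≠ 0 := ht
    simp [smul_smul, ht]
  have h1 := (hB.tendsto (w, g x)).comp (Filter.Tendsto.prodMk_nhds h hg)
  have h2 := (hB.tendsto (f x, z)).comp (Filter.Tendsto.prodMk_nhds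
    (tendsto_const_nhds (x := f x)) h')
  refine (h1.add h2).congr fun t => ?_
  simp only [Function.comp_apply, map_smul, map_sub, LinearMap.smul_apply, LinearMap.sub_apply]
  rw [← smul_add]
  congr 1
  abel

/-- Mean value argument: difference quotients along converging directions converge. -/
theorem tendsto_diffQuot [LocallyConvexSpace ℝ F] {f : E → F} {df : E × E → F} {S : Set E}
    (hS : IsOpen S) (hd : ∀ x ∈ S, ∀ v, HasDirDeriv f x v (df (x, v)))
    (hc : ContinuousOn df (S ×ˢ Set.univ)) {x v : E} (hx : x ∈ S) {c : ℝ → E}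
    (hw : Filter.Tendsto c (𝓝[≠] 0) (𝓝 v)) :
    Filter.Tendsto (fun t : ℝ => t⁻¹ • (f (x + t • c t) - f x)) (𝓝[≠] 0) (𝓝 (df (x, v))) := by
  intro O hO
  obtain ⟨D, ⟨hDn, hDc⟩, hDO⟩ := (LocallyConvexSpace.convex_basis (𝕜 := ℝ) (df (x, v))).mem_iff.1 hO
  have hp : df (x, v) ∈ interior D := mem_interior_iff_mem_nhds.2 hDn
  have hN : {p : E × E | p.1 ∈ S ∧ df p ∈ interior D} ∈ 𝓝 (x, v) := by
    have h1 := hc (x, v) ⟨hx, trivial⟩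
    have h2 : S ×ˢ (Set.univ : Set E) ∈ 𝓝 (x, v) :=
      (hS.prod isOpen_univ).mem_nhds ⟨hx, trivial⟩
    rw [ContinuousWithinAt, nhdsWithin_eq_nhds.2 h2] at h1
    filter_upwards [h2, h1 (isOpen_interior.mem_nhds hp)] with p h3 h4
    exact ⟨h3.1, h4⟩
  have hcont : Continuous fun q : ℝ × E => (x + q.1 • q.2, q.2) := by fun_prop
  have hM := hcont.continuousAt.preimage_mem_nhds (x := ((0 : ℝ), v)) (by simpa using hN)
  rw [nhds_prod_eq] at hM
  obtain ⟨I, hI, B, hB, hIB⟩ := Filter.mem_prod_iff.1 hM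
  obtain ⟨δ, hδ, hδI⟩ := Metric.mem_nhds_iff.1 hI
  have hb : Metric.ball (0 : ℝ) δ ∈ 𝓝[≠] (0 : ℝ) :=
    nhdsWithin_le_nhds (Metric.ball_mem_nhds 0 hδ)
  rw [Filter.mem_map]
  filter_upwards [hb, hw hB, self_mem_nhdsWithin] with t ht htB ht0
  have ht0 : t ≠ 0 := ht0
  refine hDO (interior_subset ?_)
  by_contra hq
  obtain ⟨l, hl⟩ := geometric_hahn_banach_open_point hDc.interior isOpen_interior hq
  have key : ∀ s ∈ Set.Icc (0 : ℝ) 1, x + (s * t) • c t ∈ S ∧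
      df (x + (s * t) • c t, c t) ∈ interior D := by
    intro s hs
    have h1 : (s * t, c t) ∈ I ×ˢ B := by
      refine ⟨hδI ?_, htB⟩
      rw [mem_ball_zero_iff] at ht ⊢
      rw [norm_mul, Real.norm_of_nonneg hs.1]
      nlinarith [norm_nonneg t, hs.2]
    exact hIB h1
  have hder : ∀ s ∈ Set.Icc (0 : ℝ) 1, HasDerivAt (fun s : ℝ => l (f (x + (s * t) • c t)))
      (t * l (df (x + (s * t) • c t, c t))) s := by
    intro s hs
    have h1 := (hd _ (key s hs).1 (c t)).clm_comp l
    have h2 : HasDerivAt (fun r : ℝ => l (f (x + r • c t)))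
        (l (df (x + (s * t) • c t, c t))) (s * t) := by
      rw [hasDerivAt_iff_tendsto_slope_zero]
      refine h1.congr fun r => ?_
      simp [add_smul, add_assoc]
    have h3 : HasDerivAt (fun s : ℝ => s * t) t s := by
      simpa using (hasDerivAt_id s).mul_const t
    have h4 := h2.comp s h3
    rw [mul_comm] at h4
    exact h4
  obtain ⟨s, hs, hs'⟩ := exists_hasDerivAt_eq_slope _ _ (zero_lt_one' ℝ)
    (fun s hs => (hder s hs).continuousAt.continuousWithinAt)
    (fun s hs => hder s ⟨hs.1.le, hs.2.le⟩)
  have h5 := hl _ (key s ⟨hs.1.le, hs.2.le⟩).2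
  simp only [one_mul, zero_mul, zero_smul, add_zero, sub_zero, div_one] at hs'
  rw [map_smul, map_sub, ← hs', smul_eq_mul, inv_mul_cancel_left₀ ht0] at h5
  exact lt_irrefl _ h5

theorem HasDirDeriv.comp [LocallyConvexSpace ℝ G] {f : F → G} {g : E → F} {df : F × F → G}
    {T : Set F} (hT : IsOpen T) (hf : ∀ x ∈ T, ∀ v, HasDirDeriv f x v (df (x, v)))
    (hc : ContinuousOn df (T ×ˢ Set.univ)) {x v : E} {z : F} (hx : g x ∈ T)
    (hg : HasDirDeriv g x v z) : HasDirDeriv (fun y => f (g y)) x v (df (g x, z)) := by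
  refine (tendsto_diffQuot hT hf hc hx hg).congr' ?_
  filter_upwards [self_mem_nhdsWithin] with t ht
  have ht : t ≠ 0 := ht
  simp [smul_smul, ht]

theorem CkOn.comp_clm {k : ℕ}
    {f : F → G} {T : Set F} (h : CkOn k f T) (L : E →L[ℝ] F) {S : Set E}
    (hST : Set.MapsTo L S T) : CkOn k (fun x => f (L x)) S := by
  induction k generalizing E F with
  | zero => exact ContinuousOn.comp h L.continuous.continuousOn hST
  | succ k ih =>
    obtain ⟨hc, df, hd, hk⟩ := h
    refine ⟨hc.comp L.continuous.continuousOn hST, fun p => df (L.prodMap L p),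
      fun x hx v => (hd _ (hST hx) (L v)).comp_clm L, ih hk (L.prodMap L) ?_⟩
    rintro ⟨a, b⟩ ⟨ha, -⟩
    exact ⟨hST ha, trivial⟩

theorem CkOn.clm_comp {k : ℕ}
    {f : E → F} {S : Set E} (h : CkOn k f S) (L : F →L[ℝ] G) :
    CkOn k (fun x => L (f x)) S := by
  induction k generalizing E with
  | zero => exact L.continuous.comp_continuousOn h
  | succ k ih =>
    obtain ⟨hc, df, hd, hk⟩ := h
    exact ⟨L.continuous.comp_continuousOn hc, fun p => L (df p),
      fun x hx v => (hd x hx v).clm_comp L, ih hk⟩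

theorem CkOn.prodMk {k : ℕ}
    {f : E → F} {g : E → G} {S : Set E} (h : CkOn k f S) (h' : CkOn k g S) :
    CkOn k (fun x => (f x, g x)) S := by
  induction k generalizing E with
  | zero => exact ContinuousOn.prodMk h h'
  | succ k ih =>
    obtain ⟨hc, df, hd, hk⟩ := h
    obtain ⟨hc', df', hd', hk'⟩ := h'
    exact ⟨hc.prodMk hc', fun p => (df p, df' p),
      fun x hx v => (hd x hx v).prodMk (hd' x hx v), ih hk hk'⟩

theorem ckOn_clm {k : ℕ}
    (L : E →L[ℝ] F) (S : Set E) : CkOn k (fun x => L x) S := by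
  induction k generalizing E with
  | zero => exact L.continuous.continuousOn
  | succ k ih =>
    exact ⟨L.continuous.continuousOn, fun p => (L.comp (ContinuousLinearMap.snd ℝ E E)) p,
      fun x _ v => hasDirDeriv_clm L x v, ih _ _⟩

theorem ckOn_const {k : ℕ}
    (c : F) (S : Set E) : CkOn k (fun _ => c) S := by
  induction k generalizing E c with
  | zero => exact continuousOn_const
  | succ k ih =>
    exact ⟨continuousOn_const, fun _ => 0, fun x _ v => hasDirDeriv_const c x v, ih _ _⟩

theorem CkOn.add {k : ℕ} {f g : E → F} {S : Set E} (h : CkOn k f S) (h' : CkOn k g S) :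
    CkOn k (fun x => f x + g x) S :=
  (h.prodMk h').clm_comp (ContinuousLinearMap.fst ℝ F F + ContinuousLinearMap.snd ℝ F F)

theorem CkOn.bilin {k : ℕ}
    {f : E → F} {g : E → G} {S : Set E}
    (B : F →ₗ[ℝ] G →ₗ[ℝ] H) (hB : Continuous fun p : F × G => B p.1 p.2)
    (h : CkOn k f S) (h' : CkOn k g S) : CkOn k (fun x => B (f x) (g x)) S := by
  induction k generalizing E with
  | zero => exact hB.comp_continuousOn (ContinuousOn.prodMk h h')
  | succ k ih =>
    have h0 := h.of_succ
    have h0' := h'.of_succ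
    obtain ⟨hc, df, hd, hk⟩ := h
    obtain ⟨hc', df', hd', hk'⟩ := h'
    have hm : Set.MapsTo (ContinuousLinearMap.fst ℝ E E) (S ×ˢ Set.univ) S := fun p hp => hp.1
    exact ⟨hB.comp_continuousOn (hc.prodMk hc'),
      fun p => B (df p) (g p.1) + B (f p.1) (df' p),
      fun x hx v => (hd x hx v).bilin B hB (hd' x hx v),
      (ih hk (h0'.comp_clm (ContinuousLinearMap.fst ℝ E E) hm)).add
        (ih (h0.comp_clm (ContinuousLinearMap.fst ℝ E E) hm) hk')⟩

theorem CkOn.comp {k : ℕ}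
    [LocallyConvexSpace ℝ G] {f : F → G} {g : E → F} {S : Set E} {T : Set F}
    (hT : IsOpen T) (hf : CkOn k f T) (hg : CkOn k g S) (hST : Set.MapsTo g S T) :
    CkOn k (fun x => f (g x)) S := by
  induction k generalizing E F with
  | zero => exact ContinuousOn.comp hf hg hST
  | succ k ih =>
    have hg0 := hg.of_succ
    obtain ⟨hc, df, hd, hk⟩ := hf
    obtain ⟨hc', dg, hd', hk'⟩ := hg
    refine ⟨hc.comp hc' hST, fun p => df (g p.1, dg p),
      fun x hx v => HasDirDeriv.comp hT hd hk.continuousOn (hST hx) (hd' x hx v), ?_⟩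
    refine ih (hT.prod isOpen_univ) hk (CkOn.prodMk (hg0.comp_clm
      (ContinuousLinearMap.fst ℝ E E) fun p hp => hp.1) hk') ?_
    rintro ⟨a, b⟩ ⟨ha, -⟩
    exact ⟨hST ha, trivial⟩

variable {A : Type*} [Ring A] [Module A E] [Module A F] [Module A G] [Module A H]

theorem SupersmoothOn.comp [LocallyConvexSpace ℝ G] {f : F → G} {g : E → F} {S : Set E}
    {T : Set F} (hT : IsOpen T) (hf : SupersmoothOn A f T) (hg : SupersmoothOn A g S)
    (hST : Set.MapsTo g S T) : SupersmoothOn A (fun x => f (g x)) S := by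
  obtain ⟨hf, df, hdc, hd, hdl⟩ := hf
  obtain ⟨hg, dg, hdc', hd', hdl'⟩ := hg
  refine ⟨fun k => (hf k).comp hT (hg k) hST, fun p => df (g p.1, dg p), ?_,
    fun x hx v => HasDirDeriv.comp hT hd hdc (hST hx) (hd' x hx v), fun x hx a v => ?_⟩
  · refine hdc.comp (ContinuousOn.prodMk ((hg 0).continuousOn.comp continuousOn_fst
      fun p hp => hp.1) hdc') fun p hp => ⟨hST hp.1, trivial⟩
  · simp only [hdl' x hx, hdl _ (hST hx)]

theorem supersmoothOn_clm (L : E →L[ℝ] F) (hL : ∀ (a : A) x, L (a • x) = a • L x) (S : Set E) :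
    SupersmoothOn A (fun x => L x) S :=
  ⟨fun _ => ckOn_clm L S, fun p => L p.2, (L.continuous.comp continuous_snd).continuousOn,
    fun x _ v => hasDirDeriv_clm L x v, fun _ _ a v => hL a v⟩

theorem supersmoothOn_const (c : F) (S : Set E) : SupersmoothOn A (fun _ => c) S :=
  ⟨fun _ => ckOn_const c S, fun _ => 0, continuousOn_const,
    fun x _ v => hasDirDeriv_const c x v, fun _ _ a v => by simp⟩

theorem SupersmoothOn.clm_comp {f : E → F} {S : Set E} (h : SupersmoothOn A f S)
    (L : F →L[ℝ] G) (hL : ∀ (a : A) x, L (a • x) = a • L x) :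
    SupersmoothOn A (fun x => L (f x)) S := by
  obtain ⟨hf, df, hdc, hd, hdl⟩ := h
  exact ⟨fun k => (hf k).clm_comp L, fun p => L (df p), L.continuous.comp_continuousOn hdc,
    fun x hx v => (hd x hx v).clm_comp L, fun x hx a v => by simp only [hdl x hx, hL]⟩

theorem SupersmoothOn.comp_clm {f : F → G} {T : Set F} (h : SupersmoothOn A f T)
    (L : E →L[ℝ] F) (hL : ∀ (a : A) x, L (a • x) = a • L x) {S : Set E}
    (hST : Set.MapsTo L S T) : SupersmoothOn A (fun x => f (L x)) S := by
  obtain ⟨hf, df, hdc, hd, hdl⟩ := h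
  refine ⟨fun k => (hf k).comp_clm L hST, fun p => df (L p.1, L p.2), ?_,
    fun x hx v => (hd _ (hST hx) (L v)).comp_clm L, fun x hx a v => by simp only [hL, hdl _ (hST hx)]⟩
  exact hdc.comp (Continuous.continuousOn (by fun_prop)) fun p hp => ⟨hST hp.1, trivial⟩

theorem SupersmoothOn.mono {f : E → F} {S T : Set E} (h : SupersmoothOn A f T) (hST : S ⊆ T) :
    SupersmoothOn A f S :=
  h.comp_clm (ContinuousLinearMap.id ℝ E) (fun _ _ => rfl) hST

theorem SupersmoothOn.prodMk {f : E → F} {g : E → G} {S : Set E} (h : SupersmoothOn A f S)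
    (h' : SupersmoothOn A g S) : SupersmoothOn A (fun x => (f x, g x)) S := by
  obtain ⟨hf, df, hdc, hd, hdl⟩ := h
  obtain ⟨hg, dg, hdc', hd', hdl'⟩ := h'
  exact ⟨fun k => (hf k).prodMk (hg k), fun p => (df p, dg p), hdc.prodMk hdc',
    fun x hx v => (hd x hx v).prodMk (hd' x hx v),
    fun x hx a v => by simp only [hdl x hx, hdl' x hx, Prod.smul_mk]⟩

theorem SupersmoothOn.add {f g : E → F} {S : Set E} (h : SupersmoothOn A f S)
    (h' : SupersmoothOn A g S) : SupersmoothOn A (fun x => f x + g x) S :=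
  (h.prodMk h').clm_comp (ContinuousLinearMap.fst ℝ F F + ContinuousLinearMap.snd ℝ F F)
    (by simp)

theorem SupersmoothOn.bilin {f : E → F} {g : E → G} {S : Set E}
    (B : F →ₗ[ℝ] G →ₗ[ℝ] H) (hB : Continuous fun p : F × G => B p.1 p.2)
    (hl : ∀ (a : A) x y, B (a • x) y = a • B x y) (hr : ∀ (a : A) x y, B x (a • y) = a • B x y)
    (h : SupersmoothOn A f S) (h' : SupersmoothOn A g S) :
    SupersmoothOn A (fun x => B (f x) (g x)) S := by
  obtain ⟨hf, df, hdc, hd, hdl⟩ := h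
  obtain ⟨hg, dg, hdc', hd', hdl'⟩ := h'
  refine ⟨fun k => (hf k).bilin B hB (hg k), fun p => B (df p) (g p.1) + B (f p.1) (dg p), ?_,
    fun x hx v => (hd x hx v).bilin B hB (hd' x hx v), fun x hx a v => ?_⟩
  · have hm : Set.MapsTo Prod.fst (S ×ˢ (Set.univ : Set E)) S := fun p hp => hp.1
    exact (hB.comp_continuousOn (hdc.prodMk ((hg 0).continuousOn.comp continuousOn_fst hm))).add
      (hB.comp_continuousOn (((hf 0).continuousOn.comp continuousOn_fst hm).prodMk hdc'))
  · simp only [hdl x hx, hdl' x hx, hl, hr, smul_add]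

end Calculus

/-! ### Grassmann algebras -/

/-- Objects of the category `Gr`: the Grassmann algebra on `rank` odd generators. -/
structure Gr : Type where
  rank : ℕ

/-- The Grassmann algebra itself. -/
abbrev Grass (Λ : Gr) : Type := ExteriorAlgebra ℝ (Fin Λ.rank → ℝ)

/-- Its homogeneous part of parity `i`. -/
def GrassPart (Λ : Gr) (i : ZMod 2) : Type :=
  ↥(CliffordAlgebra.evenOdd (0 : QuadraticForm ℝ (Fin Λ.rank → ℝ)) i)

noncomputable instance (Λ : Gr) (i : ZMod 2) : AddCommGroup (GrassPart Λ i) :=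
  inferInstanceAs (AddCommGroup ↥(CliffordAlgebra.evenOdd _ i))

noncomputable instance (Λ : Gr) (i : ZMod 2) : Module ℝ (GrassPart Λ i) :=
  inferInstanceAs (Module ℝ ↥(CliffordAlgebra.evenOdd _ i))

/-- The inclusion of a homogeneous part. -/
def GrassPart.val (Λ : Gr) (i : ZMod 2) : GrassPart Λ i →ₗ[ℝ] Grass Λ :=
  Submodule.subtype (CliffordAlgebra.evenOdd _ i)

/-- Its even part, as a ring. -/
def GrassEven (Λ : Gr) : Type :=
  ↥(CliffordAlgebra.even (0 : QuadraticForm ℝ (Fin Λ.rank → ℝ)))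

noncomputable instance (Λ : Gr) : Ring (GrassEven Λ) :=
  inferInstanceAs (Ring ↥(CliffordAlgebra.even _))

/-- The odd generators. -/
noncomputable def Gr.gen (Λ : Gr) (i : Fin Λ.rank) : GrassPart Λ 1 :=
  ⟨CliffordAlgebra.ι _ (Pi.single i 1), CliffordAlgebra.ι_mem_evenOdd_one _ _⟩

/-- The augmentation (body) map. -/
noncomputable def Gr.aug (Λ : Gr) : Grass Λ →ₐ[ℝ] ℝ := ExteriorAlgebra.algebraMapInv

/-- Morphisms of `ℤ/2`-graded algebras. -/
@[ext]
structure GrHom (Λ Λ' : Gr) : Type where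
  toAlgHom : Grass Λ →ₐ[ℝ] Grass Λ'
  mem_part : ∀ (i : ZMod 2) (x : Grass Λ), x ∈ CliffordAlgebra.evenOdd (0 : QuadraticForm ℝ _) i →
    toAlgHom x ∈ CliffordAlgebra.evenOdd (0 : QuadraticForm ℝ (Fin Λ'.rank → ℝ)) i

noncomputable instance : Category Gr where
  Hom := GrHom
  id Λ := ⟨AlgHom.id ℝ _, fun _ _ h => h⟩
  comp f g := ⟨g.toAlgHom.comp f.toAlgHom, fun i _ h => g.mem_part i _ (f.mem_part i _ h)⟩

@[ext]
theorem Gr.hom_ext {Λ Λ' : Gr} {f g : Λ ⟶ Λ'} (h : f.toAlgHom = g.toAlgHom) : f = g :=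
  GrHom.ext h

@[simp]
theorem Gr.id_toAlgHom (Λ : Gr) : GrHom.toAlgHom (𝟙 Λ) = AlgHom.id ℝ _ := rfl

@[simp]
theorem Gr.comp_toAlgHom {Λ Λ' Λ'' : Gr} (f : Λ ⟶ Λ') (g : Λ' ⟶ Λ'') :
    (f ≫ g).toAlgHom = g.toAlgHom.comp f.toAlgHom := rfl

/-- The map induced on the homogeneous parts. -/
def GrHom.part {Λ Λ' : Gr} (φ : Λ ⟶ Λ') (i : ZMod 2) : GrassPart Λ i →ₗ[ℝ] GrassPart Λ' i :=
  φ.toAlgHom.toLinearMap.restrict (φ.mem_part i)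

/-- The ring homomorphism induced on the even parts. -/
def GrHom.even {Λ Λ' : Gr} (φ : Λ ⟶ Λ') : GrassEven Λ →+* GrassEven Λ' :=
  ((φ.toAlgHom.comp (Subalgebra.val (CliffordAlgebra.even _))).codRestrict
    (CliffordAlgebra.even _) fun x => φ.mem_part 0 _ x.2).toRingHom

@[simp]
theorem GrHom.coe_part {Λ Λ' : Gr} (φ : Λ ⟶ Λ') (i : ZMod 2) (x : GrassPart Λ i) :
    (GrHom.part φ i x).1 = φ.toAlgHom x.1 := rfl

@[simp]
theorem GrHom.coe_even {Λ Λ' : Gr} (φ : Λ ⟶ Λ') (x : GrassEven Λ) :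
    (GrHom.even φ x).1 = φ.toAlgHom x.1 := rfl

theorem Gr.aug_odd (Λ : Gr) (x : Grass Λ)
    (hx : x ∈ CliffordAlgebra.evenOdd (0 : QuadraticForm ℝ (Fin Λ.rank → ℝ)) 1) :
    Λ.aug x = 0 := by
  have h1 : Λ.aug.comp CliffordAlgebra.involute = Λ.aug := by
    refine ExteriorAlgebra.hom_ext (LinearMap.ext fun v => ?_)
    have h0 : Λ.aug (ExteriorAlgebra.ι ℝ v) = 0 := by
      simp [Gr.aug, ExteriorAlgebra.algebraMapInv]
    have h2 : CliffordAlgebra.involute (ExteriorAlgebra.ι ℝ v) = -ExteriorAlgebra.ι ℝ v :=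
      CliffordAlgebra.involute_ι v
    simp [h0, h2]
  have h2 := DFunLike.congr_fun h1 x
  simp only [AlgHom.comp_apply] at h2
  rw [CliffordAlgebra.involute_eq_of_mem_odd hx, map_neg] at h2
  linarith

theorem Gr.aug_hom {Λ Λ' : Gr} (φ : Λ ⟶ Λ') (x : Grass Λ) : Λ'.aug (φ.toAlgHom x) = Λ.aug x := by
  have h : Λ'.aug.comp φ.toAlgHom = Λ.aug := by
    refine ExteriorAlgebra.hom_ext (LinearMap.ext fun v => ?_)
    have h1 := Λ'.aug_odd _ (φ.mem_part 1 _ (CliffordAlgebra.ι_mem_evenOdd_one _ v))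
    have h2 := Λ.aug_odd _ (CliffordAlgebra.ι_mem_evenOdd_one _ v)
    exact h1.trans h2.symm
  exact DFunLike.congr_fun h x

/-- The even part acts on the homogeneous parts by multiplication. -/
noncomputable instance (Λ : Gr) (i : ZMod 2) : Module (GrassEven Λ) (GrassPart Λ i) where
  smul a x := ⟨a.1 * x.1, by
    have h := SetLike.mul_mem_graded (A := CliffordAlgebra.evenOdd
      (0 : QuadraticForm ℝ (Fin Λ.rank → ℝ))) (i := 0) (j := i) a.2 x.2
    rwa [zero_add] at h⟩
  one_smul x := Subtype.ext (one_mul _)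
  mul_smul a b x := Subtype.ext (mul_assoc _ _ _)
  smul_zero a := Subtype.ext (mul_zero _)
  smul_add a x y := Subtype.ext (mul_add _ _ _)
  add_smul a b x := Subtype.ext (add_mul _ _ _)
  zero_smul x := Subtype.ext (zero_mul _)

@[simp]
theorem GrassPart.coe_smul {Λ : Gr} {i : ZMod 2} (a : GrassEven Λ) (x : GrassPart Λ i) :
    (a • x).1 = a.1 * x.1 := rfl

@[simp]
theorem GrassPart.coe_smul_real {Λ : Gr} {i : ZMod 2} (r : ℝ) (x : GrassPart Λ i) :
    (r • x).1 = r • x.1 := rfl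

@[simp]
theorem GrassPart.val_apply {Λ : Gr} {i : ZMod 2} (x : GrassPart Λ i) :
    GrassPart.val Λ i x = x.1 := rfl

instance (Λ : Gr) (i : ZMod 2) : SMulCommClass ℝ (GrassEven Λ) (GrassPart Λ i) where
  smul_comm r a x := Subtype.ext (by simp)

instance (Λ : Gr) : Module.Finite ℝ (Grass Λ) :=
  Module.Finite.of_basis (Module.Basis.ExteriorAlgebra (Pi.basisFun ℝ (Fin Λ.rank)))

/-! ### Super vector spaces and the functor `V ↦ V̄` -/

/-- Super (`ℤ/2`-graded) real vector spaces. -/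
structure SVect : Type (u + 1) where
  even : Type u
  odd : Type u
  [evenAdd : AddCommGroup even]
  [evenModule : Module ℝ even]
  [oddAdd : AddCommGroup odd]
  [oddModule : Module ℝ odd]

attribute [instance] SVect.evenAdd SVect.evenModule SVect.oddAdd SVect.oddModule

/-- Super vector spaces whose homogeneous parts are Hausdorff locally convex spaces. -/
structure TopSVect : Type (u + 1) extends SVect.{u} where
  [evenTop : TopologicalSpace even]
  [evenGroup : IsTopologicalAddGroup even]
  [evenSMul : ContinuousSMul ℝ even]
  [evenConvex : LocallyConvexSpace ℝ even]
  [evenT2 : T2Space even]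
  [oddTop : TopologicalSpace odd]
  [oddGroup : IsTopologicalAddGroup odd]
  [oddSMul : ContinuousSMul ℝ odd]
  [oddConvex : LocallyConvexSpace ℝ odd]
  [oddT2 : T2Space odd]

attribute [instance] TopSVect.evenTop TopSVect.evenGroup TopSVect.evenSMul TopSVect.evenConvex
  TopSVect.evenT2 TopSVect.oddTop TopSVect.oddGroup TopSVect.oddSMul TopSVect.oddConvex
  TopSVect.oddT2

/-- The parity change `ΠV`. -/
def TopSVect.parity (V : TopSVect.{u}) : TopSVect.{u} where
  even := V.odd
  odd := V.even

/-- The direct sum `V ⊕ W`. -/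
def TopSVect.prod (V : TopSVect.{u}) (W : TopSVect.{v}) : TopSVect.{max u v} where
  even := V.even × W.even
  odd := V.odd × W.odd

/-- The super vector space `ℝ^{0|k}`. -/
def TopSVect.oddSpace (k : ℕ) : TopSVect.{0} where
  even := PUnit
  odd := Fin k → ℝ

/-- Isomorphisms of topological super vector spaces. -/
structure TopSVect.Iso (V : TopSVect.{u}) (W : TopSVect.{v}) where
  even : V.even ≃L[ℝ] W.even
  odd : V.odd ≃L[ℝ] W.odd

/-- `V̄(Λ) = (Λ ⊗ V)_0 = (Λ_0 ⊗ V_0) ⊕ (Λ_1 ⊗ V_1)`. -/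
def SVect.Bar (V : SVect.{u}) (Λ : Gr) : Type u :=
  (GrassPart Λ 0 ⊗[ℝ] V.even) × (GrassPart Λ 1 ⊗[ℝ] V.odd)

noncomputable instance (V : SVect.{u}) (Λ : Gr) : AddCommGroup (V.Bar Λ) :=
  inferInstanceAs (AddCommGroup ((GrassPart Λ 0 ⊗[ℝ] V.even) × (GrassPart Λ 1 ⊗[ℝ] V.odd)))

noncomputable instance (V : SVect.{u}) (Λ : Gr) : Module ℝ (V.Bar Λ) :=
  inferInstanceAs (Module ℝ ((GrassPart Λ 0 ⊗[ℝ] V.even) × (GrassPart Λ 1 ⊗[ℝ] V.odd)))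

noncomputable instance (V : SVect.{u}) (Λ : Gr) : Module (GrassEven Λ) (V.Bar Λ) :=
  inferInstanceAs (Module (GrassEven Λ)
    ((GrassPart Λ 0 ⊗[ℝ] V.even) × (GrassPart Λ 1 ⊗[ℝ] V.odd)))

@[ext]
theorem SVect.bar_ext {V : SVect.{u}} {Λ : Gr} {x y : V.Bar Λ} (h : x.1 = y.1) (h' : x.2 = y.2) :
    x = y := Prod.ext h h'

theorem rTensor_part_smul {Λ Λ' : Gr} (φ : Λ ⟶ Λ') (i : ZMod 2) (V : Type u) [AddCommGroup V]
    [Module ℝ V] (a : GrassEven Λ) (x : GrassPart Λ i ⊗[ℝ] V) :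
    (GrHom.part φ i).rTensor V (a • x) = GrHom.even φ a • (GrHom.part φ i).rTensor V x := by
  induction x with
  | zero => simp
  | add x y hx hy => rw [smul_add, map_add, hx, hy, map_add, smul_add]
  | tmul _ _ =>
    simp only [TensorProduct.smul_tmul', LinearMap.rTensor_tmul]
    congr 1
    exact Subtype.ext (by simp)

/-- `V̄(φ) = φ ⊗ id_V`, semilinear over the morphism induced on even parts. -/
noncomputable def SVect.barMap (V : SVect.{u}) {Λ Λ' : Gr} (φ : Λ ⟶ Λ') :
    V.Bar Λ →ₛₗ[GrHom.even φ] V.Bar Λ' where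
  toFun x := ((GrHom.part φ 0).rTensor V.even x.1, (GrHom.part φ 1).rTensor V.odd x.2)
  map_add' x y := SVect.bar_ext (map_add _ _ _) (map_add _ _ _)
  map_smul' a x := SVect.bar_ext (rTensor_part_smul φ 0 _ a x.1) (rTensor_part_smul φ 1 _ a x.2)

theorem SVect.barMap_fst (V : SVect.{u}) {Λ Λ' : Gr} (φ : Λ ⟶ Λ') (x : V.Bar Λ) :
    (V.barMap φ x).1 = (GrHom.part φ 0).rTensor V.even x.1 := rfl

theorem SVect.barMap_snd (V : SVect.{u}) {Λ Λ' : Gr} (φ : Λ ⟶ Λ') (x : V.Bar Λ) :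
    (V.barMap φ x).2 = (GrHom.part φ 1).rTensor V.odd x.2 := rfl

theorem SVect.barMap_id (V : SVect.{u}) (Λ : Gr) (x : V.Bar Λ) : V.barMap (𝟙 Λ) x = x := by
  have h : ∀ i, GrHom.part (𝟙 Λ) i = LinearMap.id := fun i => rfl
  refine SVect.bar_ext ?_ ?_ <;> simp [SVect.barMap_fst, SVect.barMap_snd, h]

theorem SVect.barMap_comp (V : SVect.{u}) {Λ Λ' Λ'' : Gr} (φ : Λ ⟶ Λ') (ψ : Λ' ⟶ Λ'')
    (x : V.Bar Λ) : V.barMap (φ ≫ ψ) x = V.barMap ψ (V.barMap φ x) := by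
  have h : ∀ i, GrHom.part (φ ≫ ψ) i = GrHom.part ψ i ∘ₗ GrHom.part φ i := fun i => rfl
  refine SVect.bar_ext ?_ ?_ <;>
    simp [SVect.barMap_fst, SVect.barMap_snd, h, LinearMap.rTensor_comp]

/-! The topology of `V̄(Λ)`. -/

/-- The map `ℓ ⊗ id : A ⊗ V → V` given by a linear functional `ℓ`. -/
noncomputable def slice {A : Type w} [AddCommGroup A] [Module ℝ A] (V : Type u) [AddCommGroup V]
    [Module ℝ V] (l : Module.Dual ℝ A) : A ⊗[ℝ] V →ₗ[ℝ] V :=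
  (TensorProduct.lid ℝ V).toLinearMap ∘ₗ l.rTensor V

@[simp]
theorem slice_tmul {A : Type w} [AddCommGroup A] [Module ℝ A] (V : Type u) [AddCommGroup V]
    [Module ℝ V] (l : Module.Dual ℝ A) (a : A) (v : V) : slice V l (a ⊗ₜ v) = l a • v := by
  simp [slice]

/-- The topology on `Λ_i ⊗ V`, where `Λ_i` is finite-dimensional: the coarsest one for which all
maps `ℓ ⊗ id` into `V` are continuous; a basis of `Λ_i` identifies it with a product topology. -/
noncomputable instance tensorTopology (Λ : Gr) (i : ZMod 2) (V : Type u) [AddCommGroup V] [Module ℝ V]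
    [t : TopologicalSpace V] : TopologicalSpace (GrassPart Λ i ⊗[ℝ] V) :=
  ⨅ l : Module.Dual ℝ (GrassPart Λ i), t.induced (slice V l)

/-- The usual topology of the finite-dimensional space `Λ`. -/
noncomputable instance grassTopology (Λ : Gr) : TopologicalSpace (Grass Λ) :=
  ⨅ l : Module.Dual ℝ (Grass Λ), TopologicalSpace.induced l inferInstance

section
variable {V : Type u} [AddCommGroup V] [Module ℝ V] [TopologicalSpace V]

theorem continuous_slice {Λ : Gr} {i : ZMod 2} (l : Module.Dual ℝ (GrassPart Λ i)) :
    Continuous (slice V l) :=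
  continuous_iff_le_induced.2 (iInf_le _ l)

theorem continuous_to_tensor {X : Type*} [TopologicalSpace X] {Λ : Gr} {i : ZMod 2}
    {f : X → GrassPart Λ i ⊗[ℝ] V} (h : ∀ l, Continuous fun x => slice V l (f x)) :
    Continuous f :=
  continuous_iInf_rng.2 fun l => continuous_induced_rng.2 (h l)

instance [IsTopologicalAddGroup V] (Λ : Gr) (i : ZMod 2) :
    IsTopologicalAddGroup (GrassPart Λ i ⊗[ℝ] V) :=
  topologicalAddGroup_iInf fun l => topologicalAddGroup_induced (slice V l)

instance [ContinuousSMul ℝ V] (Λ : Gr) (i : ZMod 2) :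
    ContinuousSMul ℝ (GrassPart Λ i ⊗[ℝ] V) :=
  continuousSMul_iInf fun l => continuousSMul_induced (slice V l)

instance [LocallyConvexSpace ℝ V] (Λ : Gr) (i : ZMod 2) :
    LocallyConvexSpace ℝ (GrassPart Λ i ⊗[ℝ] V) :=
  LocallyConvexSpace.iInf fun l => LocallyConvexSpace.induced (slice V l)
end

noncomputable instance (V : TopSVect.{u}) (Λ : Gr) : TopologicalSpace (V.Bar Λ) :=
  inferInstanceAs (TopologicalSpace ((GrassPart Λ 0 ⊗[ℝ] V.even) × (GrassPart Λ 1 ⊗[ℝ] V.odd)))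

instance (V : TopSVect.{u}) (Λ : Gr) : IsTopologicalAddGroup (V.Bar Λ) :=
  inferInstanceAs (IsTopologicalAddGroup
    ((GrassPart Λ 0 ⊗[ℝ] V.even) × (GrassPart Λ 1 ⊗[ℝ] V.odd)))

instance (V : TopSVect.{u}) (Λ : Gr) : ContinuousSMul ℝ (V.Bar Λ) :=
  inferInstanceAs (ContinuousSMul ℝ ((GrassPart Λ 0 ⊗[ℝ] V.even) × (GrassPart Λ 1 ⊗[ℝ] V.odd)))

instance (V : TopSVect.{u}) (Λ : Gr) : LocallyConvexSpace ℝ (V.Bar Λ) :=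
  inferInstanceAs (LocallyConvexSpace ℝ
    ((GrassPart Λ 0 ⊗[ℝ] V.even) × (GrassPart Λ 1 ⊗[ℝ] V.odd)))

theorem continuous_grass_dual {Λ : Gr} (l : Module.Dual ℝ (Grass Λ)) : Continuous l :=
  continuous_iff_le_induced.2 (iInf_le _ l)

theorem continuous_to_grass {X : Type*} [TopologicalSpace X] {Λ : Gr} {f : X → Grass Λ}
    (h : ∀ l : Module.Dual ℝ (Grass Λ), Continuous fun x => l (f x)) : Continuous f :=
  continuous_iInf_rng.2 fun l => continuous_induced_rng.2 (h l)

instance (Λ : Gr) : IsTopologicalAddGroup (Grass Λ) :=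
  topologicalAddGroup_iInf fun l => topologicalAddGroup_induced l

instance (Λ : Gr) : ContinuousSMul ℝ (Grass Λ) :=
  continuousSMul_iInf fun l => continuousSMul_induced l

instance (Λ : Gr) : LocallyConvexSpace ℝ (Grass Λ) :=
  LocallyConvexSpace.iInf fun l => LocallyConvexSpace.induced l

/-- A linear family of continuous linear maps, indexed by `Λ`, is jointly continuous. -/
theorem continuous_grass_bilin {Λ : Gr} {X : Type u} {Y : Type v} [AddCommGroup X] [Module ℝ X]
    [TopologicalSpace X] [AddCommGroup Y] [Module ℝ Y] [TopologicalSpace Y]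
    [IsTopologicalAddGroup Y] [ContinuousSMul ℝ Y] (B : Grass Λ →ₗ[ℝ] X →ₗ[ℝ] Y)
    (hB : ∀ a, Continuous (B a)) : Continuous fun p : Grass Λ × X => B p.1 p.2 := by
  let b := Module.Basis.ExteriorAlgebra (Pi.basisFun ℝ (Fin Λ.rank))
  have h : ∀ p : Grass Λ × X, B p.1 p.2 = ∑ s, b.coord s p.1 • B (b s) p.2 := by
    intro p
    conv_lhs => rw [← b.sum_repr p.1]
    simp only [map_sum, map_smul, LinearMap.sum_apply, LinearMap.smul_apply,
      Module.Basis.coord_apply]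
  simp only [h]
  refine continuous_finsetSum _ fun s _ => ?_
  exact ((continuous_grass_dual _).comp continuous_fst).smul ((hB _).comp continuous_snd)

/-- The `GrassEven Λ`-linear continuous map `V̄(Λ) → W̄(Λ)` induced by an even linear map. -/
noncomputable def barHom {V : TopSVect.{u}} {W : TopSVect.{v}} (f : V.even →L[ℝ] W.even)
    (g : V.odd →L[ℝ] W.odd) (Λ : Gr) : V.Bar Λ →L[ℝ] W.Bar Λ where
  toLinearMap := (f.toLinearMap.lTensor _).prodMap (g.toLinearMap.lTensor _)
  cont := by
    refine Continuous.prodMap (continuous_to_tensor fun l => ?_) (continuous_to_tensor fun l => ?_)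
    · have h : ∀ x, slice W.even l (f.toLinearMap.lTensor _ x) = f (slice V.even l x) := by
        intro x
        induction x with
        | zero => simp
        | add x y hx hy => simp only [map_add, hx, hy]
        | tmul x y => simp
      exact (f.continuous.comp (continuous_slice l)).congr fun x => (h x).symm
    · have h : ∀ x, slice W.odd l (g.toLinearMap.lTensor _ x) = g (slice V.odd l x) := by
        intro x
        induction x with
        | zero => simp
        | add x y hx hy => simp only [map_add, hx, hy]
        | tmul x y => simp
      exact (g.continuous.comp (continuous_slice l)).congr fun x => (h x).symm

theorem barHom_apply {V : TopSVect.{u}} {W : TopSVect.{v}} (f : V.even →L[ℝ] W.even)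
    (g : V.odd →L[ℝ] W.odd) (Λ : Gr) (x : V.Bar Λ) :
    barHom f g Λ x = (f.toLinearMap.lTensor _ x.1, g.toLinearMap.lTensor _ x.2) := rfl

theorem lTensor_part_smul {Λ : Gr} {i : ZMod 2} {V : Type u} {W : Type v} [AddCommGroup V]
    [Module ℝ V] [AddCommGroup W] [Module ℝ W] (f : V →ₗ[ℝ] W) (a : GrassEven Λ)
    (x : GrassPart Λ i ⊗[ℝ] V) : f.lTensor _ (a • x) = a • f.lTensor _ x := by
  induction x with
  | zero => simp
  | add x y hx hy => simp only [smul_add, map_add, hx, hy]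
  | tmul x y => simp [TensorProduct.smul_tmul']

theorem barHom_smul {V : TopSVect.{u}} {W : TopSVect.{v}} (f : V.even →L[ℝ] W.even)
    (g : V.odd →L[ℝ] W.odd) (Λ : Gr) (a : GrassEven Λ) (x : V.Bar Λ) :
    barHom f g Λ (a • x) = a • barHom f g Λ x :=
  SVect.bar_ext (lTensor_part_smul _ a x.1) (lTensor_part_smul _ a x.2)

theorem barHom_natural {V : TopSVect.{u}} {W : TopSVect.{v}} (f : V.even →L[ℝ] W.even)
    (g : V.odd →L[ℝ] W.odd) {Λ Λ' : Gr} (φ : Λ ⟶ Λ') (x : V.Bar Λ) :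
    W.barMap φ (barHom f g Λ x) = barHom f g Λ' (V.barMap φ x) :=
  SVect.bar_ext
    ((DFunLike.congr_fun (LinearMap.rTensor_comp_lTensor _ (GrHom.part φ 0) f.toLinearMap) x.1).trans
      (DFunLike.congr_fun (LinearMap.lTensor_comp_rTensor _ (GrHom.part φ 0) f.toLinearMap) x.1).symm)
    ((DFunLike.congr_fun (LinearMap.rTensor_comp_lTensor _ (GrHom.part φ 1) g.toLinearMap) x.2).trans
      (DFunLike.congr_fun (LinearMap.lTensor_comp_rTensor _ (GrHom.part φ 1) g.toLinearMap) x.2).symm)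

/-! The projections and injections of a direct sum, and the induced maps on `Λ`-points. -/

def TopSVect.fstEven (V : TopSVect.{u}) (W : TopSVect.{v}) : (V.prod W).even →L[ℝ] V.even :=
  ContinuousLinearMap.fst ℝ V.even W.even

def TopSVect.fstOdd (V : TopSVect.{u}) (W : TopSVect.{v}) : (V.prod W).odd →L[ℝ] V.odd :=
  ContinuousLinearMap.fst ℝ V.odd W.odd

def TopSVect.sndEven (V : TopSVect.{u}) (W : TopSVect.{v}) : (V.prod W).even →L[ℝ] W.even :=
  ContinuousLinearMap.snd ℝ V.even W.even

def TopSVect.sndOdd (V : TopSVect.{u}) (W : TopSVect.{v}) : (V.prod W).odd →L[ℝ] W.odd :=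
  ContinuousLinearMap.snd ℝ V.odd W.odd

def TopSVect.inlEven (V : TopSVect.{u}) (W : TopSVect.{v}) : V.even →L[ℝ] (V.prod W).even :=
  ContinuousLinearMap.inl ℝ V.even W.even

def TopSVect.inlOdd (V : TopSVect.{u}) (W : TopSVect.{v}) : V.odd →L[ℝ] (V.prod W).odd :=
  ContinuousLinearMap.inl ℝ V.odd W.odd

def TopSVect.inrEven (V : TopSVect.{u}) (W : TopSVect.{v}) : W.even →L[ℝ] (V.prod W).even :=
  ContinuousLinearMap.inr ℝ V.even W.even

def TopSVect.inrOdd (V : TopSVect.{u}) (W : TopSVect.{v}) : W.odd →L[ℝ] (V.prod W).odd :=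
  ContinuousLinearMap.inr ℝ V.odd W.odd

noncomputable def barFst (V : TopSVect.{u}) (W : TopSVect.{v}) (Λ : Gr) :
    (V.prod W).Bar Λ →L[ℝ] V.Bar Λ := barHom (V.fstEven W) (V.fstOdd W) Λ

noncomputable def barSnd (V : TopSVect.{u}) (W : TopSVect.{v}) (Λ : Gr) :
    (V.prod W).Bar Λ →L[ℝ] W.Bar Λ := barHom (V.sndEven W) (V.sndOdd W) Λ

noncomputable def barPair (V : TopSVect.{u}) (W : TopSVect.{v}) (Λ : Gr) :
    V.Bar Λ × W.Bar Λ →L[ℝ] (V.prod W).Bar Λ :=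
  (barHom (V.inlEven W) (V.inlOdd W) Λ).coprod (barHom (V.inrEven W) (V.inrOdd W) Λ)

theorem barPair_smul (V : TopSVect.{u}) (W : TopSVect.{v}) (Λ : Gr) (a : GrassEven Λ)
    (x : V.Bar Λ × W.Bar Λ) : barPair V W Λ (a • x) = a • barPair V W Λ x := by
  simp only [barPair, ContinuousLinearMap.coprod_apply, Prod.smul_fst, Prod.smul_snd, barHom_smul,
    smul_add]

theorem tensor_inl_inr (A : Type w) (X : Type u) (Y : Type v) [AddCommGroup A] [Module ℝ A]
    [AddCommGroup X] [Module ℝ X] [AddCommGroup Y] [Module ℝ Y] (z : A ⊗[ℝ] (X × Y)) :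
    (LinearMap.inl ℝ X Y).lTensor A ((LinearMap.fst ℝ X Y).lTensor A z) +
      (LinearMap.inr ℝ X Y).lTensor A ((LinearMap.snd ℝ X Y).lTensor A z) = z := by
  induction z with
  | zero => simp
  | add x y hx hy =>
    conv_rhs => rw [← hx, ← hy]
    simp only [map_add]
    abel
  | tmul a p => simp [← TensorProduct.tmul_add]

theorem tensor_fst (A : Type w) (X : Type u) (Y : Type v) [AddCommGroup A] [Module ℝ A]
    [AddCommGroup X] [Module ℝ X] [AddCommGroup Y] [Module ℝ Y] (x : A ⊗[ℝ] X) (y : A ⊗[ℝ] Y) :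
    (LinearMap.fst ℝ X Y).lTensor A ((LinearMap.inl ℝ X Y).lTensor A x +
      (LinearMap.inr ℝ X Y).lTensor A y) = x := by
  rw [map_add, ← LinearMap.comp_apply, ← LinearMap.comp_apply, ← LinearMap.lTensor_comp,
    ← LinearMap.lTensor_comp, LinearMap.fst_comp_inl, LinearMap.fst_comp_inr]
  simp

theorem tensor_snd (A : Type w) (X : Type u) (Y : Type v) [AddCommGroup A] [Module ℝ A]
    [AddCommGroup X] [Module ℝ X] [AddCommGroup Y] [Module ℝ Y] (x : A ⊗[ℝ] X) (y : A ⊗[ℝ] Y) :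
    (LinearMap.snd ℝ X Y).lTensor A ((LinearMap.inl ℝ X Y).lTensor A x +
      (LinearMap.inr ℝ X Y).lTensor A y) = y := by
  rw [map_add, ← LinearMap.comp_apply, ← LinearMap.comp_apply, ← LinearMap.lTensor_comp,
    ← LinearMap.lTensor_comp, LinearMap.snd_comp_inl, LinearMap.snd_comp_inr]
  simp

theorem barFst_pair (V : TopSVect.{u}) (W : TopSVect.{v}) (Λ : Gr) (x : V.Bar Λ × W.Bar Λ) :
    barFst V W Λ (barPair V W Λ x) = x.1 :=
  Prod.ext (tensor_fst _ _ _ x.1.1 x.2.1) (tensor_fst _ _ _ x.1.2 x.2.2)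

theorem barSnd_pair (V : TopSVect.{u}) (W : TopSVect.{v}) (Λ : Gr) (x : V.Bar Λ × W.Bar Λ) :
    barSnd V W Λ (barPair V W Λ x) = x.2 :=
  Prod.ext (tensor_snd _ _ _ x.1.1 x.2.1) (tensor_snd _ _ _ x.1.2 x.2.2)

theorem barPair_fst_snd (V : TopSVect.{u}) (W : TopSVect.{v}) (Λ : Gr) (x : (V.prod W).Bar Λ) :
    barPair V W Λ (barFst V W Λ x, barSnd V W Λ x) = x :=
  Prod.ext (tensor_inl_inr _ _ _ x.1) (tensor_inl_inr _ _ _ x.2)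

/-- The body map `V̄(Λ) → V̄(ℝ) = V_0` induced by the augmentation `Λ → ℝ`. -/
noncomputable def TopSVect.body (V : TopSVect.{u}) (Λ : Gr) : V.Bar Λ → V.even :=
  fun x => slice V.even (Λ.aug.toLinearMap ∘ₗ GrassPart.val Λ 0) x.1

theorem TopSVect.continuous_body (V : TopSVect.{u}) (Λ : Gr) : Continuous (V.body Λ) :=
  (continuous_slice _).comp continuous_fst

theorem TopSVect.body_barMap (V : TopSVect.{u}) {Λ Λ' : Gr} (φ : Λ ⟶ Λ') (x : V.Bar Λ) :
    V.body Λ' (V.barMap φ x) = V.body Λ x := by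
  rw [TopSVect.body, TopSVect.body, SVect.barMap_fst]
  generalize x.1 = z
  induction z with
  | zero => simp
  | add x y hx hy => simp only [map_add, hx, hy]
  | tmul x y => simp [Gr.aug_hom]

theorem body_barHom {V : TopSVect.{u}} {W : TopSVect.{v}} (f : V.even →L[ℝ] W.even)
    (g : V.odd →L[ℝ] W.odd) (Λ : Gr) (x : V.Bar Λ) :
    W.body Λ (barHom f g Λ x) = f (V.body Λ x) := by
  have h : (barHom f g Λ x).1 = f.toLinearMap.lTensor _ x.1 := rfl
  rw [TopSVect.body, TopSVect.body, h]
  generalize x.1 = z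
  induction z with
  | zero => simp
  | add x y hx hy => simp only [map_add, hx, hy]
  | tmul x y => simp

/-! ### Superdomains, supermanifolds and their products -/

theorem SVect.barMap_real_smul (V : SVect.{u}) {Λ Λ' : Gr} (φ : Λ ⟶ Λ') (r : ℝ) (x : V.Bar Λ) :
    V.barMap φ (r • x) = r • V.barMap φ x :=
  SVect.bar_ext (map_smul _ r x.1) (map_smul _ r x.2)

theorem TopSVect.continuous_barMap (V : TopSVect.{u}) {Λ Λ' : Gr} (φ : Λ ⟶ Λ') :
    Continuous (V.barMap φ) := by
  have h : ∀ (i : ZMod 2) (X : Type u) [AddCommGroup X] [Module ℝ X] [TopologicalSpace X],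
      Continuous ((GrHom.part φ i).rTensor X) := by
    intro i X _ _ _
    refine continuous_to_tensor fun l => ?_
    have h : ∀ x, slice X l ((GrHom.part φ i).rTensor X x) = slice X (l ∘ₗ GrHom.part φ i) x := by
      intro x
      induction x with
      | zero => simp
      | add x y hx hy => simp only [map_add, hx, hy]
      | tmul x y => simp
    simp only [h]
    exact continuous_slice _
  exact Continuous.prodMap (h 0 V.even) (h 1 V.odd)

/-- A superdomain `V̄|_U`: the open subfunctor of `V̄` over an open set `U ⊆ V_0`. -/
structure SuperDomain : Type (u + 1) where
  V : TopSVect.{u}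
  U : Set V.even
  isOpen_U : IsOpen U

/-- The `Λ`-points of a superdomain. -/
def SuperDomain.pts (D : SuperDomain.{u}) (Λ : Gr) : Set (D.V.Bar Λ) := D.V.body Λ ⁻¹' D.U

theorem SuperDomain.isOpen_pts (D : SuperDomain.{u}) (Λ : Gr) : IsOpen (D.pts Λ) :=
  D.isOpen_U.preimage (D.V.continuous_body Λ)

/-- The functoriality of a superdomain in `Λ`. -/
noncomputable def SuperDomain.map (D : SuperDomain.{u}) {Λ Λ' : Gr} (φ : Λ ⟶ Λ') (x : D.pts Λ) :
    D.pts Λ' :=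
  ⟨D.V.barMap φ x, by
    change D.V.body Λ' (D.V.barMap φ x) ∈ D.U
    rw [D.V.body_barMap]
    exact x.2⟩

/-- The superdomain as a functor `Gr → Top`. -/
noncomputable def SuperDomain.functor (D : SuperDomain.{u}) : Gr ⥤ TopCat.{u} where
  obj Λ := TopCat.of (D.pts Λ)
  map φ := TopCat.ofHom ⟨D.map φ,
    ((D.V.continuous_barMap φ).comp continuous_subtype_val).subtype_mk _⟩
  map_id Λ := TopCat.hom_ext (ContinuousMap.ext fun x => Subtype.ext (D.V.barMap_id Λ x))
  map_comp φ ψ := TopCat.hom_ext (ContinuousMap.ext fun x =>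
    Subtype.ext (D.V.barMap_comp φ ψ x))

/-- A superchart of `F : Gr → Top`: an open embedding of a superdomain, natural in `Λ`. -/
structure SuperChart (F : Gr ⥤ TopCat.{u}) : Type (u + 1) where
  dom : SuperDomain.{u}
  emb : ∀ Λ, dom.pts Λ → F.obj Λ
  isOpenEmbedding : ∀ Λ, IsOpenEmbedding (emb Λ)
  natural : ∀ {Λ Λ' : Gr} (φ : Λ ⟶ Λ') (x : dom.pts Λ), F.map φ (emb Λ x) = emb Λ' (dom.map φ x)

/-- The part of the domain of a chart that is mapped into `S`. -/
def SuperChart.preimage {F : Gr ⥤ TopCat.{u}} (c : SuperChart F) {Λ : Gr} (S : Set (F.obj Λ)) :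
    Set (c.dom.V.Bar Λ) := {x | ∃ hx : x ∈ c.dom.pts Λ, c.emb Λ ⟨x, hx⟩ ∈ S}

theorem SuperChart.isOpen_preimage {F : Gr ⥤ TopCat.{u}} (c : SuperChart F) {Λ : Gr}
    {S : Set (F.obj Λ)} (hS : IsOpen S) : IsOpen (c.preimage S) := by
  have h := (c.dom.isOpen_pts Λ).isOpenMap_subtype_val _
    (hS.preimage (c.isOpenEmbedding Λ).continuous)
  convert h using 1
  ext x
  simp [SuperChart.preimage]

/-- The change of charts from `c` to `d` is supersmooth (on the overlap). -/
def SuperChart.Compat {F : Gr ⥤ TopCat.{u}} (c d : SuperChart F) : Prop :=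
  ∀ Λ, ∃ t : c.dom.V.Bar Λ → d.dom.V.Bar Λ,
    SupersmoothOn (GrassEven Λ) t (c.preimage (Set.range (d.emb Λ))) ∧
    ∀ (x : c.dom.pts Λ) (y : d.dom.pts Λ), c.emb Λ x = d.emb Λ y → t x = y

/-- A supermanifold, given by a functor `Gr → Top` and an atlas of supercharts (which need not be
maximal). The smooth structure on the `Λ`-points is the one defined by the charts. -/
structure SuperManifold : Type (u + 1) where
  F : Gr ⥤ TopCat.{u}
  atlas : Set (SuperChart F)
  cover : ∀ Λ (m : F.obj Λ), ∃ c ∈ atlas, m ∈ Set.range (c.emb Λ)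
  compat : ∀ c ∈ atlas, ∀ d ∈ atlas, c.Compat d

theorem SuperChart.Compat.refl {F : Gr ⥤ TopCat.{u}} (c : SuperChart F) : c.Compat c := fun Λ =>
  ⟨fun x => x, supersmoothOn_clm (ContinuousLinearMap.id ℝ _) (fun _ _ => rfl) _,
    fun _ _ h => congrArg Subtype.val ((c.isOpenEmbedding Λ).injective h)⟩

/-- A superdomain as a supermanifold with a single chart. -/
noncomputable def SuperDomain.chart (D : SuperDomain.{u}) : SuperChart D.functor where
  dom := D
  emb _ := fun x => x
  isOpenEmbedding _ := IsOpenEmbedding.id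
  natural _ _ := rfl

noncomputable def SuperDomain.toSuperManifold (D : SuperDomain.{u}) : SuperManifold.{u} where
  F := D.functor
  atlas := {D.chart}
  cover Λ m := ⟨D.chart, rfl, m, rfl⟩
  compat := by
    rintro _ rfl _ rfl
    exact SuperChart.Compat.refl _

/-- The product of superdomains. -/
def SuperDomain.prod (D : SuperDomain.{u}) (D' : SuperDomain.{v}) : SuperDomain.{max u v} where
  V := D.V.prod D'.V
  U := D.V.fstEven D'.V ⁻¹' D.U ∩ D.V.sndEven D'.V ⁻¹' D'.U
  isOpen_U := (D.isOpen_U.preimage (D.V.fstEven D'.V).continuous).inter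
    (D'.isOpen_U.preimage (D.V.sndEven D'.V).continuous)

theorem SuperDomain.mem_prod_pts (D : SuperDomain.{u}) (D' : SuperDomain.{v}) {Λ : Gr}
    (x : (D.prod D').V.Bar Λ) : x ∈ (D.prod D').pts Λ ↔
      barFst D.V D'.V Λ x ∈ D.pts Λ ∧ barSnd D.V D'.V Λ x ∈ D'.pts Λ := by
  have h1 : D.V.body Λ (barFst D.V D'.V Λ x) = D.V.fstEven D'.V ((D.V.prod D'.V).body Λ x) :=
    body_barHom _ _ Λ x
  have h2 : D'.V.body Λ (barSnd D.V D'.V Λ x) = D.V.sndEven D'.V ((D.V.prod D'.V).body Λ x) :=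
    body_barHom _ _ Λ x
  change _ ↔ D.V.body Λ (barFst D.V D'.V Λ x) ∈ D.U ∧ D'.V.body Λ (barSnd D.V D'.V Λ x) ∈ D'.U
  rw [h1, h2]
  rfl

/-- The points of a product of superdomains are the pairs of points. -/
noncomputable def SuperDomain.prodHomeo (D : SuperDomain.{u}) (D' : SuperDomain.{v}) (Λ : Gr) :
    (D.prod D').pts Λ ≃ₜ D.pts Λ × D'.pts Λ where
  toFun x := (⟨barFst D.V D'.V Λ x.1, ((D.mem_prod_pts D' _).1 x.2).1⟩,
    ⟨barSnd D.V D'.V Λ x.1, ((D.mem_prod_pts D' _).1 x.2).2⟩)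
  invFun p := ⟨barPair D.V D'.V Λ (p.1.1, p.2.1), (D.mem_prod_pts D' _).2
    ⟨by rw [barFst_pair]; exact p.1.2, by rw [barSnd_pair]; exact p.2.2⟩⟩
  left_inv x := Subtype.ext (barPair_fst_snd _ _ _ _)
  right_inv p := Prod.ext (Subtype.ext (barFst_pair D.V D'.V Λ (p.1.1, p.2.1)))
    (Subtype.ext (barSnd_pair D.V D'.V Λ (p.1.1, p.2.1)))
  continuous_toFun := by
    refine Continuous.prodMk ?_ ?_
    · exact ((barFst D.V D'.V Λ).continuous.comp continuous_subtype_val).subtype_mk _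
    · exact ((barSnd D.V D'.V Λ).continuous.comp continuous_subtype_val).subtype_mk _
  continuous_invFun := by
    refine ((barPair D.V D'.V Λ).continuous.comp ?_).subtype_mk _
    fun_prop

/-- The product of functors `Gr → Top`. -/
def prodFunctor (F : Gr ⥤ TopCat.{u}) (G : Gr ⥤ TopCat.{v}) : Gr ⥤ TopCat.{max u v} where
  obj Λ := TopCat.of (F.obj Λ × G.obj Λ)
  map φ := TopCat.ofHom ((F.map φ).hom.prodMap (G.map φ).hom)
  map_id Λ := by
    ext x <;> simp
  map_comp φ ψ := by
    ext x <;> simp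

/-- The product of supercharts. -/
noncomputable def SuperChart.prod {F : Gr ⥤ TopCat.{u}} {G : Gr ⥤ TopCat.{v}} (c : SuperChart F)
    (d : SuperChart G) : SuperChart (prodFunctor F G) where
  dom := c.dom.prod d.dom
  emb Λ := Prod.map (c.emb Λ) (d.emb Λ) ∘ c.dom.prodHomeo d.dom Λ
  isOpenEmbedding Λ := ((c.isOpenEmbedding Λ).prodMap (d.isOpenEmbedding Λ)).comp
    (c.dom.prodHomeo d.dom Λ).isOpenEmbedding
  natural φ x := by
    refine Prod.ext ((c.natural φ _).trans (congrArg (c.emb _) (Subtype.ext ?_)))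
      ((d.natural φ _).trans (congrArg (d.emb _) (Subtype.ext ?_)))
    · exact barHom_natural _ _ φ x.1
    · exact barHom_natural _ _ φ x.1

theorem SuperChart.Compat.prod {F : Gr ⥤ TopCat.{u}} {G : Gr ⥤ TopCat.{v}} {c c' : SuperChart F}
    {d d' : SuperChart G} (hc : c.Compat c') (hd : d.Compat d') :
    (c.prod d).Compat (c'.prod d') := by
  intro Λ
  obtain ⟨t, ht, ht'⟩ := hc Λ
  obtain ⟨s, hs, hs'⟩ := hd Λ
  refine ⟨fun x => barPair c'.dom.V d'.dom.V Λ (t (barFst c.dom.V d.dom.V Λ x),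
    s (barSnd c.dom.V d.dom.V Λ x)), ?_, fun x y h => ?_⟩
  · refine SupersmoothOn.clm_comp (SupersmoothOn.prodMk ?_ ?_) (barPair c'.dom.V d'.dom.V Λ)
      (barPair_smul _ _ _)
    · refine ht.comp_clm (barFst c.dom.V d.dom.V Λ) (barHom_smul _ _ _) ?_
      rintro x ⟨hx, ⟨y, hy⟩⟩
      exact ⟨((c.dom.mem_prod_pts d.dom x).1 hx).1, _, (congrArg Prod.fst hy)⟩
    · refine hs.comp_clm (barSnd c.dom.V d.dom.V Λ) (barHom_smul _ _ _) ?_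
      rintro x ⟨hx, ⟨y, hy⟩⟩
      exact ⟨((c.dom.mem_prod_pts d.dom x).1 hx).2, _, (congrArg Prod.snd hy)⟩
  · have h1 := ht' _ _ (congrArg Prod.fst h)
    have h2 := hs' _ _ (congrArg Prod.snd h)
    have h3 := barPair_fst_snd c'.dom.V d'.dom.V Λ y.1
    rw [← h3]
    exact congrArg _ (Prod.ext h1 h2)

/-- The product of supermanifolds. -/
noncomputable def SuperManifold.prod (M : SuperManifold.{u}) (N : SuperManifold.{v}) :
    SuperManifold.{max u v} where
  F := prodFunctor M.F N.F
  atlas := Set.image2 SuperChart.prod M.atlas N.atlas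
  cover Λ m := by
    obtain ⟨c, hc, x, hx⟩ := M.cover Λ m.1
    obtain ⟨d, hd, y, hy⟩ := N.cover Λ m.2
    refine ⟨c.prod d, ⟨c, hc, d, hd, rfl⟩, (c.dom.prodHomeo d.dom Λ).symm (x, y), ?_⟩
    exact (congrArg (Prod.map (c.emb Λ) (d.emb Λ))
      ((c.dom.prodHomeo d.dom Λ).apply_symm_apply (x, y))).trans (Prod.ext hx hy)
  compat := by
    rintro _ ⟨c, hc, d, hd, rfl⟩ _ ⟨c', hc', d', hd', rfl⟩
    exact (M.compat c hc c' hc').prod (N.compat d hd d' hd')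

/-- Open subfunctors. -/
@[ext]
structure OpenSub (F : Gr ⥤ TopCat.{u}) : Type u where
  carrier : ∀ Λ, Set (F.obj Λ)
  isOpen : ∀ Λ, IsOpen (carrier Λ)
  map_mem : ∀ {Λ Λ' : Gr} (φ : Λ ⟶ Λ') (m : F.obj Λ), m ∈ carrier Λ → F.map φ m ∈ carrier Λ'

/-- The whole functor as an open subfunctor of itself. -/
def OpenSub.top (F : Gr ⥤ TopCat.{u}) : OpenSub F where
  carrier _ := Set.univ
  isOpen _ := isOpen_univ
  map_mem _ _ _ := trivial

/-- The intersection of open subfunctors. -/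
def OpenSub.inter {F : Gr ⥤ TopCat.{u}} (N N' : OpenSub F) : OpenSub F where
  carrier Λ := N.carrier Λ ∩ N'.carrier Λ
  isOpen Λ := (N.isOpen Λ).inter (N'.isOpen Λ)
  map_mem φ m h := ⟨N.map_mem φ m h.1, N'.map_mem φ m h.2⟩

/-- The image of a superchart. -/
def SuperChart.image {F : Gr ⥤ TopCat.{u}} (c : SuperChart F) : OpenSub F where
  carrier Λ := Set.range (c.emb Λ)
  isOpen Λ := (c.isOpenEmbedding Λ).isOpen_range
  map_mem := by
    rintro Λ Λ' φ _ ⟨x, rfl⟩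
    exact ⟨_, (c.natural φ x).symm⟩

/-- The open subfunctor `F × N` of `F × G`. -/
def OpenSub.prodRight (F : Gr ⥤ TopCat.{v}) {G : Gr ⥤ TopCat.{u}} (N : OpenSub G) :
    OpenSub (prodFunctor F G) where
  carrier Λ := {p | p.2 ∈ N.carrier Λ}
  isOpen Λ := (N.isOpen Λ).preimage continuous_snd
  map_mem φ m h := N.map_mem φ m.2 h

/-! ### Superpoints -/

theorem grass_ι_mul {Λ : Gr} (v : Fin Λ.rank → ℝ) (x : Grass Λ) :
    ExteriorAlgebra.ι ℝ v * x = CliffordAlgebra.involute x * ExteriorAlgebra.ι ℝ v := by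
  induction x using ExteriorAlgebra.induction with
  | algebraMap r => simp [Algebra.commutes]
  | ι w =>
    have h : CliffordAlgebra.involute (ExteriorAlgebra.ι ℝ w) = -ExteriorAlgebra.ι ℝ w :=
      CliffordAlgebra.involute_ι w
    rw [h, neg_mul]
    exact eq_neg_of_add_eq_zero_left (ExteriorAlgebra.ι_add_mul_swap v w)
  | mul a b ha hb => rw [← mul_assoc, ha, mul_assoc, hb, map_mul, mul_assoc]
  | add a b ha hb => rw [mul_add, ha, hb, map_add, add_mul]

theorem grass_even_comm {Λ : Gr} (a : GrassEven Λ) (x : Grass Λ) : a.1 * x = x * a.1 := by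
  refine CliffordAlgebra.even_induction (Q := (0 : QuadraticForm ℝ (Fin Λ.rank → ℝ)))
    (motive := fun y _ => y * x = x * y) (fun r => Algebra.commutes r x)
    (fun y z _ _ hy hz => by rw [add_mul, hy, hz, mul_add]) (fun m₁ m₂ y _ hy => ?_) a.1 a.2
  have k : ∀ m z, CliffordAlgebra.ι (0 : QuadraticForm ℝ (Fin Λ.rank → ℝ)) m * z =
    CliffordAlgebra.involute z * CliffordAlgebra.ι _ m := fun m z => grass_ι_mul m z
  rw [mul_assoc, hy, mul_assoc (CliffordAlgebra.ι _ m₁) _ (x * y), ← mul_assoc _ x y, k m₂ x,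
    mul_assoc _ _ y, ← mul_assoc (CliffordAlgebra.ι _ m₁) (CliffordAlgebra.involute x), k m₁,
    CliffordAlgebra.involute_involute]
  simp only [mul_assoc]

theorem grass_odd_sq {Λ : Gr} (a : GrassPart Λ 1) : a.1 * a.1 = 0 := by
  have h : ∀ b : CliffordAlgebra (0 : QuadraticForm ℝ (Fin Λ.rank → ℝ)),
      b ∈ CliffordAlgebra.evenOdd _ 1 → a.1 * b = -(b * a.1) := by
    intro b hb'
    have hb : ∀ v, CliffordAlgebra.ι (0 : QuadraticForm ℝ (Fin Λ.rank → ℝ)) v * b =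
        -(b * CliffordAlgebra.ι _ v) := by
      intro v
      have h := grass_ι_mul v b
      rw [CliffordAlgebra.involute_eq_of_mem_odd hb', neg_mul] at h
      exact h
    refine CliffordAlgebra.odd_induction (0 : QuadraticForm ℝ (Fin Λ.rank → ℝ))
      (P := fun y _ => y * b = -(b * y)) hb
      (fun y z _ _ hy hz => by rw [add_mul, hy, hz, mul_add, neg_add]) (fun m₁ m₂ y _ hy => ?_)
      a.1 a.2
    rw [mul_assoc, hy, mul_neg, ← mul_assoc _ b y, mul_assoc (CliffordAlgebra.ι _ m₁) _ b, hb m₂,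
      mul_neg, ← mul_assoc (CliffordAlgebra.ι _ m₁), hb m₁]
    simp only [neg_mul, neg_neg, mul_assoc]
  have h1 := h a.1 a.2
  have h2 : (2 : ℝ) • (a.1 * a.1) = 0 := by
    rw [two_smul]
    nth_rw 1 [h1]
    exact neg_add_cancel _
  exact (smul_eq_zero.1 h2).resolve_left two_ne_zero

/-- The `i`-th coordinate of a point of `ℝ^{0|k}`. -/
noncomputable def oddCoord (k : ℕ) (Λ : Gr) (i : Fin k) (x : (TopSVect.oddSpace k).Bar Λ) :
    GrassPart Λ 1 :=
  TensorProduct.rid ℝ (GrassPart Λ 1)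
    ((LinearMap.proj i : (Fin k → ℝ) →ₗ[ℝ] ℝ).lTensor (GrassPart Λ 1) x.2)

/-- The algebra morphism that sends the generators to the coordinates of `x`. -/
noncomputable def pointAlgHom (k Λ : Gr) (x : (TopSVect.oddSpace k.rank).Bar Λ) :
    Grass k →ₐ[ℝ] Grass Λ :=
  ExteriorAlgebra.lift ℝ
    ⟨∑ i, (LinearMap.proj i : (Fin k.rank → ℝ) →ₗ[ℝ] ℝ).smulRight (oddCoord k.rank Λ i x).1, by
      intro v
      have h := grass_odd_sq (∑ i, v i • oddCoord k.rank Λ i x)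
      have h1 : (∑ i, v i • oddCoord k.rank Λ i x).1 = ∑ i, v i • (oddCoord k.rank Λ i x).1 :=
        map_sum (GrassPart.val Λ 1) _ _
      rw [h1] at h
      simpa using h⟩

theorem pointAlgHom_ι (k Λ : Gr) (x : (TopSVect.oddSpace k.rank).Bar Λ) (v : Fin k.rank → ℝ) :
    pointAlgHom k Λ x (CliffordAlgebra.ι _ v) = ∑ i, v i • (oddCoord k.rank Λ i x).1 := by
  refine (ExteriorAlgebra.lift_ι_apply ℝ _ _ v).trans ?_
  simp

/-- The morphism of Grassmann algebras that sends the generators to the coordinates of `x`. -/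
noncomputable def pointHom (k Λ : Gr) (x : (TopSVect.oddSpace k.rank).Bar Λ) : k ⟶ Λ where
  toAlgHom := pointAlgHom k Λ x
  mem_part := by
    have hι : ∀ v, pointAlgHom k Λ x (CliffordAlgebra.ι _ v) ∈
        CliffordAlgebra.evenOdd (0 : QuadraticForm ℝ (Fin Λ.rank → ℝ)) 1 := by
      intro v
      rw [pointAlgHom_ι]
      exact Submodule.sum_mem _ fun i _ => Submodule.smul_mem _ _ (oddCoord k.rank Λ i x).2
    have h2 : ∀ (j : ZMod 2) (v w) (y : Grass k), pointAlgHom k Λ x y ∈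
          CliffordAlgebra.evenOdd (0 : QuadraticForm ℝ (Fin Λ.rank → ℝ)) j →
        pointAlgHom k Λ x (CliffordAlgebra.ι _ v * CliffordAlgebra.ι _ w * y) ∈
          CliffordAlgebra.evenOdd (0 : QuadraticForm ℝ (Fin Λ.rank → ℝ)) j := by
      intro j v w y hy
      rw [map_mul, map_mul]
      have h := SetLike.mul_mem_graded (A := CliffordAlgebra.evenOdd
        (0 : QuadraticForm ℝ (Fin Λ.rank → ℝ))) (SetLike.mul_mem_graded (hι v) (hι w)) hy
      have h3 : (1 : ZMod 2) + 1 + j = j := by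
        rw [show (1 : ZMod 2) + 1 = 0 from rfl, zero_add]
      rwa [h3] at h
    intro j
    fin_cases j
    · exact CliffordAlgebra.even_induction _ (fun r => by
        rw [AlgHom.commutes]
        rw [Algebra.algebraMap_eq_smul_one]
        exact Submodule.smul_mem _ r (Submodule.one_le.1 (CliffordAlgebra.one_le_evenOdd_zero _)))
        (fun y z _ _ hy hz => by rw [map_add]; exact Submodule.add_mem _ hy hz)
        (fun v w y _ hy => h2 0 v w y hy)
    · exact CliffordAlgebra.odd_induction _ hι
        (fun y z _ _ hy hz => by rw [map_add]; exact Submodule.add_mem _ hy hz)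
        (fun v w y _ hy => h2 1 v w y hy)

theorem pointHom_gen (k Λ : Gr) (x : (TopSVect.oddSpace k.rank).Bar Λ) (i : Fin k.rank) :
    GrHom.part (pointHom k Λ x) 1 (k.gen i) = oddCoord k.rank Λ i x := by
  refine Subtype.ext ?_
  refine (pointAlgHom_ι k Λ x (Pi.single i 1)).trans ?_
  simp [Pi.single_apply]

/-- The coordinates of a `Λ`-point of the superpoint: the isomorphism
`Hom(Λ_k, Λ) ≅ Λ_1 ⊗ ℝ^k`. -/
noncomputable def pointCoord (k Λ : Gr) (f : k ⟶ Λ) : (TopSVect.oddSpace k.rank).Bar Λ :=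
  (0, ∑ i, GrHom.part f 1 (k.gen i) ⊗ₜ[ℝ] (Pi.single i 1 : Fin k.rank → ℝ))

theorem oddCoord_ext {k : ℕ} {Λ : Gr} {x y : (TopSVect.oddSpace k).Bar Λ}
    (h : ∀ i, oddCoord k Λ i x = oddCoord k Λ i y) : x = y := by
  have key : ∀ z : GrassPart Λ 1 ⊗[ℝ] (Fin k → ℝ), z = ∑ i, (TensorProduct.rid ℝ (GrassPart Λ 1)
      ((LinearMap.proj i : (Fin k → ℝ) →ₗ[ℝ] ℝ).lTensor (GrassPart Λ 1) z)) ⊗ₜ[ℝ]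
        (Pi.single i 1 : Fin k → ℝ) := by
    intro z
    induction z with
    | zero => simp
    | add a b ha hb =>
      conv_lhs => rw [ha, hb]
      simp only [map_add, TensorProduct.add_tmul, Finset.sum_add_distrib]
    | tmul a v =>
      simp only [LinearMap.lTensor_tmul, LinearMap.proj_apply, TensorProduct.rid_tmul,
        TensorProduct.smul_tmul, ← TensorProduct.tmul_sum]
      congr 1
      ext j
      simp [Pi.single_apply]
  refine SVect.bar_ext ?_ ?_
  · have h0 : ∀ z : GrassPart Λ 0 ⊗[ℝ] PUnit.{1}, z = 0 := by
      intro z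
      induction z with
      | zero => rfl
      | add a b ha hb => rw [ha, hb, add_zero]
      | tmul a v => rw [Subsingleton.elim v 0, TensorProduct.tmul_zero]
    exact (h0 x.1).trans (h0 y.1).symm
  · refine (key x.2).trans ((Finset.sum_congr rfl fun i _ => ?_).trans (key y.2).symm)
    exact congrArg (fun a => a ⊗ₜ[ℝ] (Pi.single i 1 : Fin k → ℝ)) (h i)

theorem oddCoord_pointCoord (k Λ : Gr) (f : k ⟶ Λ) (i : Fin k.rank) :
    oddCoord k.rank Λ i (pointCoord k Λ f) = GrHom.part f 1 (k.gen i) := by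
  have h : oddCoord k.rank Λ i (pointCoord k Λ f) = TensorProduct.rid ℝ (GrassPart Λ 1)
      ((LinearMap.proj i : (Fin k.rank → ℝ) →ₗ[ℝ] ℝ).lTensor (GrassPart Λ 1)
        (∑ i, GrHom.part f 1 (k.gen i) ⊗ₜ[ℝ] (Pi.single i 1 : Fin k.rank → ℝ))) := rfl
  rw [h]
  simp [Pi.single_apply]

theorem grHom_ext_gen {k Λ : Gr} {f g : k ⟶ Λ}
    (h : ∀ i, GrHom.part f 1 (k.gen i) = GrHom.part g 1 (k.gen i)) : f = g := by
  refine Gr.hom_ext (ExteriorAlgebra.hom_ext ((Pi.basisFun ℝ (Fin k.rank)).ext fun i => ?_))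
  simp only [Pi.basisFun_apply]
  exact congrArg Subtype.val (h i)

noncomputable def pointEquiv (k Λ : Gr) : (k ⟶ Λ) ≃ (TopSVect.oddSpace k.rank).Bar Λ where
  toFun := pointCoord k Λ
  invFun := pointHom k Λ
  left_inv f := grHom_ext_gen fun i => by rw [pointHom_gen, oddCoord_pointCoord]
  right_inv x := oddCoord_ext fun i => by rw [oddCoord_pointCoord, pointHom_gen]

/-- `Hom(Λ_k, Λ)` carries the topology of `Λ_1 ⊗ ℝ^k`. -/
noncomputable instance (k Λ : Gr) : TopologicalSpace (k ⟶ Λ) :=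
  TopologicalSpace.induced (pointCoord k Λ) inferInstance

theorem pointCoord_comp {k Λ Λ' : Gr} (f : k ⟶ Λ) (φ : Λ ⟶ Λ') :
    pointCoord k Λ' (f ≫ φ) = (TopSVect.oddSpace k.rank).barMap φ (pointCoord k Λ f) := by
  refine SVect.bar_ext ?_ ?_
  · exact (map_zero ((GrHom.part φ 0).rTensor PUnit)).symm
  · have h : ((TopSVect.oddSpace k.rank).barMap φ (pointCoord k Λ f)).2 =
      (GrHom.part φ 1).rTensor (Fin k.rank → ℝ)
        (∑ i, GrHom.part f 1 (k.gen i) ⊗ₜ[ℝ] (Pi.single i 1 : Fin k.rank → ℝ)) := rfl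
    rw [h, map_sum]
    rfl

noncomputable def pointHomeo (k Λ : Gr) : (k ⟶ Λ) ≃ₜ (TopSVect.oddSpace k.rank).Bar Λ :=
  (pointEquiv k Λ).toHomeomorphOfIsInducing ⟨rfl⟩

/-- The superpoint `P(Λ_k)` as a functor: `P(Λ_k)(Λ) = Hom(Λ_k, Λ)`. -/
noncomputable def pointFunctor (k : Gr) : Gr ⥤ TopCat.{0} where
  obj Λ := TopCat.of (k ⟶ Λ)
  map {Λ Λ'} φ := TopCat.ofHom ⟨fun f => f ≫ φ, by
    refine continuous_induced_rng.2 ?_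
    have h : pointCoord k Λ' ∘ (fun f : k ⟶ Λ => f ≫ φ) =
      (TopSVect.oddSpace k.rank).barMap φ ∘ pointCoord k Λ := funext fun f => pointCoord_comp f φ
    rw [h]
    exact ((TopSVect.oddSpace k.rank).continuous_barMap φ).comp continuous_induced_dom⟩
  map_id Λ := TopCat.hom_ext (ContinuousMap.ext fun f => Category.comp_id f)
  map_comp φ ψ := TopCat.hom_ext (ContinuousMap.ext fun f => (Category.assoc f φ ψ).symm)

/-- The superdomain `ℝ^{0|k}`. -/
def pointDomain (k : Gr) : SuperDomain.{0} where
  V := TopSVect.oddSpace k.rank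
  U := Set.univ
  isOpen_U := isOpen_univ

/-- The global chart of the superpoint. -/
noncomputable def pointChart (k : Gr) : SuperChart (pointFunctor k) where
  dom := pointDomain k
  emb Λ x := (pointHomeo k Λ).symm x.1
  isOpenEmbedding Λ := (pointHomeo k Λ).symm.isOpenEmbedding.comp
    ((pointDomain k).isOpen_pts Λ).isOpenEmbedding_subtypeVal
  natural {Λ Λ'} φ x := by
    refine (pointHomeo k Λ').injective ?_
    have h1 := pointCoord_comp ((pointHomeo k Λ).symm x.1) φ
    have h2 : pointCoord k Λ ((pointHomeo k Λ).symm x.1) = x.1 :=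
      (pointHomeo k Λ).apply_symm_apply x.1
    exact (h1.trans (congrArg _ h2)).trans
      ((pointHomeo k Λ').apply_symm_apply ((pointDomain k).map φ x).1).symm

/-- The superpoint `P(Λ_k)` as a supermanifold. -/
noncomputable def superPoint (k : Gr) : SuperManifold.{0} where
  F := pointFunctor k
  atlas := {pointChart k}
  cover Λ m := ⟨pointChart k, rfl, ⟨pointHomeo k Λ m, trivial⟩,
    (pointHomeo k Λ).symm_apply_apply m⟩
  compat := by
    rintro _ rfl _ rfl
    exact SuperChart.Compat.refl _

/-! ### Smooth dependence on the coordinates of a superpoint -/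

noncomputable instance (Λ : Gr) : Module (GrassEven Λ) (Grass Λ) :=
  inferInstanceAs (Module ↥(CliffordAlgebra.even (0 : QuadraticForm ℝ (Fin Λ.rank → ℝ)))
    (CliffordAlgebra (0 : QuadraticForm ℝ (Fin Λ.rank → ℝ))))

theorem grass_even_smul {Λ : Gr} (a : GrassEven Λ) (x : Grass Λ) : a • x = a.1 * x := rfl

instance (Λ : Gr) (i : ZMod 2) : SMulCommClass (GrassEven Λ) ℝ (GrassPart Λ i) :=
  SMulCommClass.symm _ _ _

/-- The projections of `Λ` onto its homogeneous parts. -/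
noncomputable def grassProj (Λ : Gr) (i : ZMod 2) : Grass Λ →ₗ[ℝ] GrassPart Λ i where
  toFun x := DirectSum.decompose
    (CliffordAlgebra.evenOdd (0 : QuadraticForm ℝ (Fin Λ.rank → ℝ))) x i
  map_add' x y := by rw [DirectSum.decompose_add]; rfl
  map_smul' r x := by rw [DirectSum.decompose_smul]; rfl

theorem grassProj_coe {Λ : Gr} {i : ZMod 2} (x : GrassPart Λ i) : grassProj Λ i x.1 = x := by
  refine Subtype.ext ?_
  exact DirectSum.decompose_of_mem_same
    (CliffordAlgebra.evenOdd (0 : QuadraticForm ℝ (Fin Λ.rank → ℝ))) x.2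

theorem grassProj_smul {Λ : Gr} {i : ZMod 2} (a : GrassEven Λ) (x : Grass Λ) :
    grassProj Λ i (a • x) = a • grassProj Λ i x :=
  Subtype.ext (DirectSum.coe_decompose_mul_of_left_mem_zero
    (CliffordAlgebra.evenOdd (0 : QuadraticForm ℝ (Fin Λ.rank → ℝ))) a.2)

/-- The projection of `Λ` onto its even part. -/
noncomputable def grassEvenProj (Λ : Gr) (x : Grass Λ) : GrassEven Λ := grassProj Λ 0 x

theorem grassEven_comm {Λ : Gr} (a b : GrassEven Λ) : a * b = b * a :=
  Subtype.ext (grass_even_comm a b.1)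

theorem bar_smul_real {V : TopSVect.{v}} {Λ : Gr} (r : ℝ) {a b : GrassEven Λ} (h : b.1 = r • a.1)
    (y : V.Bar Λ) : b • y = r • a • y := by
  have key : ∀ (i : ZMod 2) (X : Type v) [AddCommGroup X] [Module ℝ X]
      (z : GrassPart Λ i ⊗[ℝ] X), b • z = r • a • z := by
    intro i X _ _ z
    induction z with
    | zero => simp
    | add x y hx hy => simp only [smul_add, hx, hy]
    | tmul x y =>
      rw [TensorProduct.smul_tmul', TensorProduct.smul_tmul', TensorProduct.smul_tmul']
      congr 1
      exact Subtype.ext (by simp [h])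
  exact SVect.bar_ext (key 0 _ y.1) (key 1 _ y.2)

theorem bar_smul_comm {V : TopSVect.{v}} {Λ : Gr} (a : GrassEven Λ) (r : ℝ) (y : V.Bar Λ) :
    a • r • y = r • a • y :=
  SVect.bar_ext (smul_comm a r y.1) (smul_comm a r y.2)

theorem continuous_bar_smul {V : TopSVect.{v}} {Λ : Gr} (a : GrassEven Λ) :
    Continuous fun y : V.Bar Λ => a • y := by
  have key : ∀ (i : ZMod 2) (X : Type v) [AddCommGroup X] [Module ℝ X] [TopologicalSpace X],
      Continuous fun z : GrassPart Λ i ⊗[ℝ] X => a • z := by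
    intro i X _ _ _
    refine continuous_to_tensor fun l => ?_
    let l' : Module.Dual ℝ (GrassPart Λ i) :=
      { toFun := fun x => l (a • x)
        map_add' := fun x y => by rw [smul_add, map_add]
        map_smul' := fun r x => by rw [smul_comm a r x, map_smul]; rfl }
    have h : ∀ z, slice X l (a • z) = slice X l' z := by
      intro z
      induction z with
      | zero => simp
      | add x y hx hy => simp only [smul_add, map_add, hx, hy]
      | tmul x y => simp [TensorProduct.smul_tmul', l']
    simp only [h]
    exact continuous_slice _
  exact Continuous.prodMap (key 0 V.even) (key 1 V.odd)

/-- The action of the even part of a Grassmann element on `V̄(Λ)`, as a bilinear map. -/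
noncomputable def grassAct (V : TopSVect.{v}) (Λ : Gr) : Grass Λ →ₗ[ℝ] V.Bar Λ →ₗ[ℝ] V.Bar Λ :=
  LinearMap.mk₂ ℝ (fun z y => grassEvenProj Λ z • y)
    (fun z z' y => by
      have h : grassEvenProj Λ (z + z') = grassEvenProj Λ z + grassEvenProj Λ z' :=
        map_add (grassProj Λ 0) z z'
      rw [h, add_smul])
    (fun r z y => bar_smul_real r (congrArg Subtype.val (map_smul (grassProj Λ 0) r z)) y)
    (fun z y y' => smul_add _ _ _) (fun r z y => bar_smul_comm _ _ _)

theorem SupersmoothOn.grassAct {E : Type u} [AddCommGroup E] [Module ℝ E] [TopologicalSpace E]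
    [IsTopologicalAddGroup E] [ContinuousSMul ℝ E] {Λ : Gr} [Module (GrassEven Λ) E]
    {V : TopSVect.{v}} {f : E → Grass Λ} {g : E → V.Bar Λ} {S : Set E}
    (hf : SupersmoothOn (GrassEven Λ) f S) (hg : SupersmoothOn (GrassEven Λ) g S) :
    SupersmoothOn (GrassEven Λ) (fun x => grassEvenProj Λ (f x) • g x) S := by
  refine SupersmoothOn.bilin (_root_.grassAct V Λ)
    (continuous_grass_bilin _ fun a => continuous_bar_smul _) (fun a z y => ?_) (fun a z y => ?_)
    hf hg
  · have h : grassEvenProj Λ (a • z) = a * grassEvenProj Λ z := grassProj_smul (i := 0) a z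
    change grassEvenProj Λ (a • z) • y = a • grassEvenProj Λ z • y
    rw [h, mul_smul]
  · change grassEvenProj Λ z • a • y = a • grassEvenProj Λ z • y
    rw [← mul_smul, ← mul_smul, grassEven_comm]

theorem continuous_oddCoord (k : ℕ) (Λ : Gr) (i : Fin k) :
    Continuous fun x : (TopSVect.oddSpace k).Bar Λ => (oddCoord k Λ i x).1 := by
  refine continuous_to_grass fun l => ?_
  have h : ∀ z : GrassPart Λ 1 ⊗[ℝ] (Fin k → ℝ), l (TensorProduct.rid ℝ (GrassPart Λ 1)
      ((LinearMap.proj i : (Fin k → ℝ) →ₗ[ℝ] ℝ).lTensor (GrassPart Λ 1) z)).1 =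
      slice (Fin k → ℝ) (l ∘ₗ GrassPart.val Λ 1) z i := by
    intro z
    rw [← GrassPart.val_apply]
    induction z with
    | zero => simp only [map_zero, Pi.zero_apply]
    | add x y hx hy => simp only [map_add, hx, hy, Pi.add_apply]
    | tmul x y => simp [mul_comm]
  have h' : (fun x : (TopSVect.oddSpace k).Bar Λ => l (oddCoord k Λ i x).1) =
      fun x => slice (Fin k → ℝ) (l ∘ₗ GrassPart.val Λ 1) x.2 i := funext fun x => h x.2
  rw [h']
  exact (continuous_apply i).comp ((continuous_slice _).comp continuous_snd)

/-- The coordinates of `ℝ^{0|k}`, as continuous linear maps into `Λ`. -/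
noncomputable def oddCoordL (k : ℕ) (Λ : Gr) (i : Fin k) :
    (TopSVect.oddSpace k).Bar Λ →L[ℝ] Grass Λ where
  toFun x := (oddCoord k Λ i x).1
  map_add' x y := congrArg Subtype.val (map_add ((TensorProduct.rid ℝ (GrassPart Λ 1)).toLinearMap ∘ₗ
    (LinearMap.proj i : (Fin k → ℝ) →ₗ[ℝ] ℝ).lTensor (GrassPart Λ 1)) x.2 y.2)
  map_smul' r x := congrArg Subtype.val
    (map_smul ((TensorProduct.rid ℝ (GrassPart Λ 1)).toLinearMap ∘ₗ
      (LinearMap.proj i : (Fin k → ℝ) →ₗ[ℝ] ℝ).lTensor (GrassPart Λ 1)) r x.2)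
  cont := continuous_oddCoord k Λ i

theorem oddCoordL_smul (k : ℕ) (Λ : Gr) (i : Fin k) (a : GrassEven Λ)
    (x : (TopSVect.oddSpace k).Bar Λ) : oddCoordL k Λ i (a • x) = a • oddCoordL k Λ i x := by
  have key : ∀ z : GrassPart Λ 1 ⊗[ℝ] (Fin k → ℝ), TensorProduct.rid ℝ (GrassPart Λ 1)
      ((LinearMap.proj i : (Fin k → ℝ) →ₗ[ℝ] ℝ).lTensor (GrassPart Λ 1) (a • z)) =
      a • TensorProduct.rid ℝ (GrassPart Λ 1)
      ((LinearMap.proj i : (Fin k → ℝ) →ₗ[ℝ] ℝ).lTensor (GrassPart Λ 1) z) := by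
    intro z
    induction z with
    | zero => simp
    | add x y hx hy => simp only [smul_add, map_add, hx, hy]
    | tmul x y =>
      rw [TensorProduct.smul_tmul', LinearMap.lTensor_tmul, LinearMap.lTensor_tmul,
        TensorProduct.rid_tmul, TensorProduct.rid_tmul, smul_comm]
  exact congrArg Subtype.val (key x.2)

theorem supersmoothOn_pointHom (k Λ : Gr) (a : Grass k) (S : Set _) :
    SupersmoothOn (GrassEven Λ) (fun x => (pointHom k Λ x).toAlgHom a) S := by
  induction a using ExteriorAlgebra.induction with
  | algebraMap r =>
    simp only [AlgHom.commutes]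
    exact supersmoothOn_const _ _
  | ι v =>
    have h : (fun x => (pointHom k Λ x).toAlgHom (ExteriorAlgebra.ι ℝ v)) =
        fun x => (∑ i, v i • oddCoordL k.rank Λ i) x := by
      funext x
      refine (pointAlgHom_ι k Λ x v).trans ?_
      simp only [FunLike.coe_sum, Finset.sum_apply, FunLike.coe_smul, Pi.smul_apply]
      rfl
    rw [h]
    refine supersmoothOn_clm _ (fun a x => ?_) _
    simp only [FunLike.coe_sum, Finset.sum_apply, FunLike.coe_smul,
      Pi.smul_apply, oddCoordL_smul, Finset.smul_sum]
    refine Finset.sum_congr rfl fun i _ => ?_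
    rw [grass_even_smul, grass_even_smul, mul_smul_comm]
  | mul a b ha hb =>
    simp only [map_mul]
    refine SupersmoothOn.bilin (LinearMap.mul ℝ (Grass Λ)) (continuous_grass_bilin _ fun a => ?_)
      (fun a x y => mul_assoc _ _ _) (fun a x y => ?_) ha hb
    · exact continuous_to_grass fun l => continuous_grass_dual (l ∘ₗ LinearMap.mul ℝ (Grass Λ) a)
    · simp only [LinearMap.mul_apply', grass_even_smul]
      rw [← mul_assoc, ← grass_even_comm, mul_assoc]
  | add a b ha hb =>
    simp only [map_add]
    exact ha.add hb

/-- The linear map `z ↦ z_1 ⊗ e_i`. -/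
noncomputable def oddInj (k : ℕ) (Λ : Gr) (i : Fin k) :
    Grass Λ →L[ℝ] (TopSVect.oddSpace k).Bar Λ where
  toFun z := (0, grassProj Λ 1 z ⊗ₜ[ℝ] (Pi.single i 1 : Fin k → ℝ))
  map_add' x y := SVect.bar_ext (add_zero _).symm
    ((congrArg (fun z => z ⊗ₜ[ℝ] (Pi.single i 1 : Fin k → ℝ)) (map_add (grassProj Λ 1) x y)).trans
      (TensorProduct.add_tmul _ _ _))
  map_smul' r x := SVect.bar_ext (smul_zero _).symm
    ((congrArg (fun z => z ⊗ₜ[ℝ] (Pi.single i 1 : Fin k → ℝ)) (map_smul (grassProj Λ 1) r x)).trans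
      (TensorProduct.smul_tmul' _ _ _))
  cont := by
    have h : Continuous fun z : Grass Λ => grassProj Λ 1 z ⊗ₜ[ℝ] (Pi.single i 1 : Fin k → ℝ) := by
      refine continuous_to_tensor fun l => ?_
      simp only [slice_tmul]
      exact (continuous_grass_dual (l ∘ₗ grassProj Λ 1)).smul continuous_const
    exact Continuous.prodMk continuous_const h

theorem oddInj_smul (k : ℕ) (Λ : Gr) (i : Fin k) (a : GrassEven Λ) (z : Grass Λ) :
    oddInj k Λ i (a • z) = a • oddInj k Λ i z := by
  refine SVect.bar_ext (smul_zero a).symm ?_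
  change grassProj Λ 1 (a • z) ⊗ₜ[ℝ] (Pi.single i 1 : Fin k → ℝ) =
    a • (grassProj Λ 1 z ⊗ₜ[ℝ] (Pi.single i 1 : Fin k → ℝ))
  rw [grassProj_smul, TensorProduct.smul_tmul']

/-- The map `P(φ)` is supersmooth in coordinates. -/
theorem supersmoothOn_pointCoord {k k' : Gr} (φ : k ⟶ k') (Λ : Gr) (S : Set _) :
    SupersmoothOn (GrassEven Λ) (fun x => pointCoord k Λ (φ ≫ pointHom k' Λ x)) S := by
  have h : (fun x => pointCoord k Λ (φ ≫ pointHom k' Λ x)) = fun x => ∑ i,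
      oddInj k.rank Λ i ((pointHom k' Λ x).toAlgHom (φ.toAlgHom (k.gen i).1)) := by
    funext x
    refine oddCoord_ext fun j => ?_
    have h1 : ∀ i, oddInj k.rank Λ i ((pointHom k' Λ x).toAlgHom (φ.toAlgHom (k.gen i).1)) =
        (0, GrHom.part (φ ≫ pointHom k' Λ x) 1 (k.gen i) ⊗ₜ[ℝ]
          (Pi.single i 1 : Fin k.rank → ℝ)) := by
      intro i
      refine SVect.bar_ext rfl ?_
      exact congrArg (fun b => b ⊗ₜ[ℝ] (Pi.single i 1 : Fin k.rank → ℝ))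
        (grassProj_coe (GrHom.part (φ ≫ pointHom k' Λ x) 1 (k.gen i)))
    refine congrArg (oddCoord k.rank Λ j) (SVect.bar_ext ?_ ?_)
    · have h2 := map_sum (AddMonoidHom.fst (GrassPart Λ 0 ⊗[ℝ] PUnit.{1})
        (GrassPart Λ 1 ⊗[ℝ] (Fin k.rank → ℝ)))
        (fun i => oddInj k.rank Λ i ((pointHom k' Λ x).toAlgHom (φ.toAlgHom (k.gen i).1)))
        Finset.univ
      refine Eq.trans ?_ h2.symm
      exact (Finset.sum_eq_zero fun i _ => rfl).symm
    · have h2 := map_sum (AddMonoidHom.snd (GrassPart Λ 0 ⊗[ℝ] PUnit.{1})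
        (GrassPart Λ 1 ⊗[ℝ] (Fin k.rank → ℝ)))
        (fun i => oddInj k.rank Λ i ((pointHom k' Λ x).toAlgHom (φ.toAlgHom (k.gen i).1)))
        Finset.univ
      refine Eq.trans ?_ h2.symm
      have h3 : ∀ i, GrHom.part (φ ≫ pointHom k' Λ x) 1 (k.gen i) ⊗ₜ[ℝ]
          (Pi.single i 1 : Fin k.rank → ℝ) = (AddMonoidHom.snd (GrassPart Λ 0 ⊗[ℝ] PUnit.{1})
            (GrassPart Λ 1 ⊗[ℝ] (Fin k.rank → ℝ)))
            (oddInj k.rank Λ i ((pointHom k' Λ x).toAlgHom (φ.toAlgHom (k.gen i).1))) :=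
        fun i => (congrArg Prod.snd (h1 i)).symm
      have h4 : (pointCoord k Λ (φ ≫ pointHom k' Λ x)).2 =
        ∑ i, GrHom.part (φ ≫ pointHom k' Λ x) 1 (k.gen i) ⊗ₜ[ℝ]
          (Pi.single i 1 : Fin k.rank → ℝ) := rfl
      rw [h4]
      exact Fintype.sum_congr _ _ h3
  rw [h]
  have key : ∀ s : Finset (Fin k.rank), SupersmoothOn (GrassEven Λ) (fun x => ∑ i ∈ s,
      oddInj k.rank Λ i ((pointHom k' Λ x).toAlgHom (φ.toAlgHom (k.gen i).1))) S := by
    intro s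
    induction s using Finset.induction_on with
    | empty =>
      simp only [Finset.sum_empty]
      exact supersmoothOn_const _ _
    | insert i s hi ih =>
      simp only [Finset.sum_insert hi]
      exact ((supersmoothOn_pointHom k' Λ _ S).clm_comp (oddInj k.rank Λ i)
        (oddInj_smul _ _ _)).add ih
  exact key Finset.univ

/-! ### Super vector bundles -/

/-- A super vector bundle over `M`, given by an atlas of local trivializations. For every `Λ` there
is a family of `Λ_0`-modules over `M(Λ)`, functorial in `Λ`. The base is covered by supercharts
(which together with those of `M` form an atlas), and over each of them the family is identified,
naturally in `Λ`, with a trivial one with fibre `V̄_i`, where all `V_i` are isomorphic. The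
transition maps between trivializations are supersmooth. The topology and the smooth structure of
the total spaces are the ones defined by the trivializations. -/
structure SuperVectorBundle (M : SuperManifold.{u}) : Type (max (u + 1) (v + 1) (w + 1)) where
  fib : ∀ Λ, M.F.obj Λ → Type v
  [fibAdd : ∀ Λ m, AddCommGroup (fib Λ m)]
  [fibModule : ∀ Λ m, Module (GrassEven Λ) (fib Λ m)]
  map : ∀ {Λ Λ' : Gr} (φ : Λ ⟶ Λ') (m : M.F.obj Λ), fib Λ m →ₛₗ[GrHom.even φ] fib Λ' (M.F.map φ m)
  map_id : ∀ (Λ : Gr) (m : M.F.obj Λ) (e : fib Λ m), HEq (map (𝟙 Λ) m e) e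
  map_comp : ∀ {Λ Λ' Λ'' : Gr} (φ : Λ ⟶ Λ') (ψ : Λ' ⟶ Λ'') (m : M.F.obj Λ) (e : fib Λ m),
    HEq (map (φ ≫ ψ) m e) (map ψ (M.F.map φ m) (map φ m e))
  ι : Type w
  chart : ι → SuperChart M.F
  cover : ∀ Λ (m : M.F.obj Λ), ∃ i, m ∈ Set.range ((chart i).emb Λ)
  chart_compat : ∀ c ∈ M.atlas ∪ Set.range chart, ∀ d ∈ M.atlas ∪ Set.range chart, c.Compat d
  fiber : ι → TopSVect.{v}
  fiber_iso : ∀ i j, Nonempty ((fiber i).Iso (fiber j))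
  triv : ∀ (i : ι) (Λ : Gr) (m : M.F.obj Λ), m ∈ Set.range ((chart i).emb Λ) →
    fib Λ m ≃ₗ[GrassEven Λ] (fiber i).Bar Λ
  triv_natural : ∀ (i : ι) {Λ Λ' : Gr} (φ : Λ ⟶ Λ') (m : M.F.obj Λ)
    (hm : m ∈ Set.range ((chart i).emb Λ)) (hm' : M.F.map φ m ∈ Set.range ((chart i).emb Λ'))
    (e : fib Λ m), triv i Λ' (M.F.map φ m) hm' (map φ m e) = (fiber i).barMap φ (triv i Λ m hm e)
  transition : ∀ (i j : ι) (Λ : Gr),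
    ∃ g : (chart i).dom.V.Bar Λ × (fiber i).Bar Λ → (fiber j).Bar Λ,
      SupersmoothOn (GrassEven Λ) g
        ((chart i).preimage (Set.range ((chart j).emb Λ)) ×ˢ Set.univ) ∧
      ∀ (x : (chart i).dom.pts Λ) (hx : (chart i).emb Λ x ∈ Set.range ((chart j).emb Λ))
        (e : (fiber i).Bar Λ),
        g (x, e) = triv j Λ _ hx ((triv i Λ ((chart i).emb Λ x) (Set.mem_range_self x)).symm e)

attribute [instance] SuperVectorBundle.fibAdd SuperVectorBundle.fibModule

/-- The trivial bundle with fibre `W̄` over a superdomain. -/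
noncomputable def trivialBundle (D : SuperDomain.{u}) (W : TopSVect.{v}) :
    SuperVectorBundle.{u, v, 0} D.toSuperManifold where
  fib Λ _ := W.Bar Λ
  map φ _ := W.barMap φ
  map_id Λ _ e := heq_of_eq (W.barMap_id Λ e)
  map_comp φ ψ _ e := heq_of_eq (W.barMap_comp φ ψ e)
  ι := Unit
  chart _ := D.chart
  cover Λ m := ⟨(), m, rfl⟩
  chart_compat := by
    have h : ∀ c ∈ D.toSuperManifold.atlas ∪ Set.range (fun _ : Unit => D.chart), c = D.chart := by
      rintro c (hc | ⟨_, rfl⟩)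
      · exact hc
      · rfl
    intro c hc d hd
    rw [h c hc, h d hd]
    exact SuperChart.Compat.refl _
  fiber _ := W
  fiber_iso _ _ := ⟨⟨.refl ℝ _, .refl ℝ _⟩⟩
  triv _ Λ _ _ := LinearEquiv.refl _ _
  triv_natural _ _ _ _ _ _ _ _ := rfl
  transition _ _ Λ := ⟨fun p => ContinuousLinearMap.snd ℝ (D.V.Bar Λ) (W.Bar Λ) p,
    supersmoothOn_clm (A := GrassEven Λ) (ContinuousLinearMap.snd ℝ (D.V.Bar Λ) (W.Bar Λ))
      (fun _ _ => rfl) _, fun _ _ _ => rfl⟩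

/-- The pullback of a super vector bundle along the projection `N × M → M`. -/
noncomputable def SuperVectorBundle.pullbackSnd {M : SuperManifold.{u}}
    (E : SuperVectorBundle.{u, v, w} M) (N : SuperManifold.{w'}) :
    SuperVectorBundle.{max w' u, v, max w (w' + 1)} (N.prod M) where
  fib Λ p := E.fib Λ p.2
  map φ p := E.map φ p.2
  map_id Λ p e := E.map_id Λ p.2 e
  map_comp φ ψ p e := E.map_comp φ ψ p.2 e
  ι := E.ι × N.atlas
  chart i := i.2.1.prod (E.chart i.1)
  cover Λ p := by
    obtain ⟨c, hc, x, hx⟩ := N.cover Λ p.1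
    obtain ⟨i, y, hy⟩ := E.cover Λ p.2
    refine ⟨(i, ⟨c, hc⟩), (c.dom.prodHomeo (E.chart i).dom Λ).symm (x, y), ?_⟩
    exact (congrArg (Prod.map (c.emb Λ) ((E.chart i).emb Λ))
      ((c.dom.prodHomeo (E.chart i).dom Λ).apply_symm_apply (x, y))).trans (Prod.ext hx hy)
  chart_compat := by
    have h : ∀ c ∈ (N.prod M).atlas ∪ Set.range
        (fun i : E.ι × N.atlas => i.2.1.prod (E.chart i.1)),
        ∃ a ∈ N.atlas, ∃ b ∈ M.atlas ∪ Set.range E.chart, c = a.prod b := by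
      rintro c (⟨a, ha, b, hb, rfl⟩ | ⟨i, rfl⟩)
      · exact ⟨a, ha, b, Or.inl hb, rfl⟩
      · exact ⟨i.2.1, i.2.2, E.chart i.1, Or.inr ⟨i.1, rfl⟩, rfl⟩
    intro c hc d hd
    obtain ⟨a, ha, b, hb, rfl⟩ := h c hc
    obtain ⟨a', ha', b', hb', rfl⟩ := h d hd
    exact (N.compat a ha a' ha').prod (E.chart_compat b hb b' hb')
  fiber i := E.fiber i.1
  fiber_iso i j := E.fiber_iso i.1 j.1
  triv i Λ p hp := E.triv i.1 Λ p.2 (by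
    obtain ⟨x, hx⟩ := hp
    exact ⟨_, congrArg Prod.snd hx⟩)
  triv_natural i _ _ φ p _ _ e := E.triv_natural i.1 φ p.2 _ _ e
  transition i j Λ := by
    obtain ⟨g, hg, hg'⟩ := E.transition i.1 j.1 Λ
    refine ⟨fun p => g (barSnd i.2.1.dom.V (E.chart i.1).dom.V Λ p.1, p.2), ?_, fun x hx e => ?_⟩
    · refine hg.comp_clm ((barSnd i.2.1.dom.V (E.chart i.1).dom.V Λ).prodMap
        (ContinuousLinearMap.id ℝ _)) (fun a x => Prod.ext (barHom_smul _ _ _ a x.1) rfl) ?_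
      rintro ⟨x, e⟩ ⟨⟨hx, y, hy⟩, -⟩
      exact ⟨⟨((i.2.1.dom.mem_prod_pts (E.chart i.1).dom x).1 hx).2, _, congrArg Prod.snd hy⟩,
        trivial⟩
    · exact hg' ⟨_, ((i.2.1.dom.mem_prod_pts (E.chart i.1).dom x.1).1 x.2).2⟩
        (by
          obtain ⟨y, hy⟩ := hx
          exact ⟨_, congrArg Prod.snd hy⟩) e

/-- The (supersmooth) sections of a super vector bundle over an open subfunctor `N` of the base. -/
def SuperVectorBundle.sections {M : SuperManifold.{u}} (E : SuperVectorBundle.{u, v, w} M)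
    (N : OpenSub M.F) : AddSubgroup (∀ (Λ : Gr) (m : N.carrier Λ), E.fib Λ m.1) where
  carrier := {σ |
    (∀ {Λ Λ' : Gr} (φ : Λ ⟶ Λ') (m : N.carrier Λ),
      E.map φ m.1 (σ Λ m) = σ Λ' ⟨M.F.map φ m.1, N.map_mem φ m.1 m.2⟩) ∧
    ∀ (i : E.ι) (Λ : Gr), ∃ s : (E.chart i).dom.V.Bar Λ → (E.fiber i).Bar Λ,
      SupersmoothOn (GrassEven Λ) s ((E.chart i).preimage (N.carrier Λ)) ∧
      ∀ (x : (E.chart i).dom.pts Λ) (hx : (E.chart i).emb Λ x ∈ N.carrier Λ),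
        s x = E.triv i Λ ((E.chart i).emb Λ x) (Set.mem_range_self x) (σ Λ ⟨_, hx⟩)}
  zero_mem' := ⟨fun φ m => map_zero (E.map φ m.1), fun i Λ => ⟨fun _ => 0,
    supersmoothOn_const _ _, fun x _ => (map_zero (E.triv i Λ _ (Set.mem_range_self x))).symm⟩⟩
  add_mem' := by
    rintro σ τ ⟨hσ, hσ'⟩ ⟨hτ, hτ'⟩
    refine ⟨fun φ m => ?_, fun i Λ => ?_⟩
    · exact (map_add (E.map φ m.1) _ _).trans (congrArg₂ _ (hσ φ m) (hτ φ m))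
    · obtain ⟨s, hs, hs'⟩ := hσ' i Λ
      obtain ⟨t, ht, ht'⟩ := hτ' i Λ
      refine ⟨fun x => s x + t x, hs.add ht, fun x hx => ?_⟩
      exact (congrArg₂ _ (hs' x hx) (ht' x hx)).trans
        (map_add (E.triv i Λ _ (Set.mem_range_self x)) _ _).symm
  neg_mem' := by
    rintro σ ⟨hσ, hσ'⟩
    refine ⟨fun φ m => ?_, fun i Λ => ?_⟩
    · exact (map_neg (E.map φ m.1) _).trans (congrArg _ (hσ φ m))
    · obtain ⟨s, hs, hs'⟩ := hσ' i Λ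
      refine ⟨fun x => (-ContinuousLinearMap.id ℝ _ : _ →L[ℝ] _) (s x),
        hs.clm_comp _ fun a x => (smul_neg a x).symm, fun x hx => ?_⟩
      exact (congrArg (fun y => -y) (hs' x hx)).trans
        (map_neg (E.triv i Λ _ (Set.mem_range_self x)) _).symm

/-! ### Modules over `ℝ̄` -/

/-- Modules over the ring object `ℝ̄ : Λ ↦ Λ_0` in the category of functors on `Gr`. -/
structure RBarMod : Type (u + 1) where
  obj : Gr → Type u
  [add : ∀ Λ, AddCommGroup (obj Λ)]
  [mod : ∀ Λ, Module (GrassEven Λ) (obj Λ)]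
  map : ∀ {Λ Λ' : Gr} (φ : Λ ⟶ Λ'), obj Λ →ₛₗ[GrHom.even φ] obj Λ'
  map_id : ∀ (Λ : Gr) (x : obj Λ), map (𝟙 Λ) x = x
  map_comp : ∀ {Λ Λ' Λ'' : Gr} (φ : Λ ⟶ Λ') (ψ : Λ' ⟶ Λ'') (x : obj Λ),
    map (φ ≫ ψ) x = map ψ (map φ x)

attribute [instance] RBarMod.add RBarMod.mod

/-- Morphisms of `ℝ̄`-modules: natural transformations that are linear for every `Λ`. -/
@[ext]
structure RBarMod.Hom (X : RBarMod.{u}) (Y : RBarMod.{v}) where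
  app : ∀ Λ, X.obj Λ →ₗ[GrassEven Λ] Y.obj Λ
  natural : ∀ {Λ Λ' : Gr} (φ : Λ ⟶ Λ') (x : X.obj Λ), app Λ' (X.map φ x) = Y.map φ (app Λ x)

noncomputable instance : Category RBarMod.{u} where
  Hom X Y := RBarMod.Hom X Y
  id X := ⟨fun _ => LinearMap.id, fun _ _ => rfl⟩
  comp f g := ⟨fun Λ => g.app Λ ∘ₗ f.app Λ, fun φ x =>
    (congrArg _ (f.natural φ x)).trans (g.natural φ _)⟩

/-- The `ℝ̄`-module `V̄`. -/
noncomputable def SVect.bar (V : SVect.{u}) : RBarMod.{u} where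
  obj Λ := V.Bar Λ
  map φ := V.barMap φ
  map_id := V.barMap_id
  map_comp := V.barMap_comp

/-- An `ℝ̄`-module is superrepresentable if it is isomorphic to `V̄` for a super vector space
`V`. -/
def RBarMod.IsSuperrepresentable (X : RBarMod.{u}) : Prop :=
  ∃ V : SVect.{u}, Nonempty (V.bar ≅ X)

/-- The real vector space `SC^∞(D, W̄)` of supersmooth morphisms from a superdomain `D` to `W̄`. -/
def SCinf (D : SuperDomain.{u}) (W : TopSVect.{v}) : Submodule ℝ (∀ Λ, D.pts Λ → W.Bar Λ) where
  carrier := {f |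
    (∀ {Λ Λ' : Gr} (φ : Λ ⟶ Λ') (x : D.pts Λ), W.barMap φ (f Λ x) = f Λ' (D.map φ x)) ∧
    ∀ Λ, ∃ s : D.V.Bar Λ → W.Bar Λ, SupersmoothOn (GrassEven Λ) s (D.pts Λ) ∧
      ∀ x : D.pts Λ, s x = f Λ x}
  zero_mem' := ⟨fun φ _ => map_zero (W.barMap φ), fun _ => ⟨fun _ => 0,
    supersmoothOn_const _ _, fun _ => rfl⟩⟩
  add_mem' := by
    rintro f g ⟨hf, hf'⟩ ⟨hg, hg'⟩
    refine ⟨fun φ x => ?_, fun Λ => ?_⟩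
    · exact (map_add (W.barMap φ) _ _).trans (congrArg₂ _ (hf φ x) (hg φ x))
    · obtain ⟨s, hs, hs'⟩ := hf' Λ
      obtain ⟨t, ht, ht'⟩ := hg' Λ
      exact ⟨fun x => s x + t x, hs.add ht, fun x => congrArg₂ _ (hs' x) (ht' x)⟩
  smul_mem' := by
    rintro r f ⟨hf, hf'⟩
    refine ⟨fun φ x => ?_, fun Λ => ?_⟩
    · exact (W.barMap_real_smul φ r _).trans (congrArg _ (hf φ x))
    · obtain ⟨s, hs, hs'⟩ := hf' Λ
      exact ⟨fun x => (r • ContinuousLinearMap.id ℝ _ : _ →L[ℝ] _) (s x),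
        hs.clm_comp _ fun a x => (bar_smul_comm a r x).symm, fun x => congrArg _ (hs' x)⟩

/-- The super vector space `SC^∞(D, W ⊕ ΠW)`: its even elements are the supersmooth maps to `W̄`,
its odd elements the supersmooth maps to the bar-construction of `ΠW`. -/
noncomputable def SCinf.super (D : SuperDomain.{u}) (W : TopSVect.{v}) : SVect.{max u v} where
  even := SCinf D W
  odd := SCinf D W.parity

/-! ### The functor of sections -/

section HatSections

variable {M : SuperManifold.{u}} (E : SuperVectorBundle.{u, v, w} M) (N : OpenSub M.F)

/-- `Γ̂(N, E)(Λ)`: the sections of the pullback of `E` to `P(Λ) × N`. -/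
def HatObj (Λ : Gr) : Type (max u v) :=
  (E.pullbackSnd (superPoint Λ)).sections (OpenSub.prodRight (superPoint Λ).F N)

noncomputable instance (Λ : Gr) : AddCommGroup (HatObj E N Λ) :=
  inferInstanceAs (AddCommGroup
    ((E.pullbackSnd (superPoint Λ)).sections (OpenSub.prodRight (superPoint Λ).F N)))

/-- The value of a section at a point `(η, m)` of `P(Λ) × N`. -/
def HatObj.eval {E : SuperVectorBundle.{u, v, w} M} {N : OpenSub M.F} {Λ : Gr}
    (σ : HatObj E N Λ) {Λ' : Gr} (η : Λ ⟶ Λ') (m : M.F.obj Λ') (hm : m ∈ N.carrier Λ') :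
    E.fib Λ' m :=
  σ.1 Λ' ⟨(η, m), hm⟩

variable {E N}

@[ext]
theorem HatObj.ext {Λ : Gr} {σ τ : HatObj E N Λ}
    (h : ∀ {Λ' : Gr} (η : Λ ⟶ Λ') (m : M.F.obj Λ') (hm : m ∈ N.carrier Λ'),
      σ.eval η m hm = τ.eval η m hm) : σ = τ :=
  Subtype.ext (funext fun _ => funext fun p => h p.1.1 p.1.2 p.2)

theorem HatObj.natural {Λ : Gr} (σ : HatObj E N Λ) {Λ₁ Λ₂ : Gr} (φ : Λ₁ ⟶ Λ₂) (η : Λ ⟶ Λ₁)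
    (m : M.F.obj Λ₁) (hm : m ∈ N.carrier Λ₁) :
    E.map φ m (σ.eval η m hm) = σ.eval (η ≫ φ) (M.F.map φ m) (N.map_mem φ m hm) :=
  σ.2.1 φ ⟨(η, m), hm⟩

/-- The coordinate domain in which sections over `P(Λ) × N` are expressed in the chart `i`. -/
def hatDomain (E : SuperVectorBundle.{u, v, w} M) (N : OpenSub M.F) (Λ : Gr) (i : E.ι) (Λ' : Gr) :
    Set (((pointDomain Λ).V.prod (E.chart i).dom.V).Bar Λ') :=
  {x | barSnd (pointDomain Λ).V (E.chart i).dom.V Λ' x ∈ (E.chart i).preimage (N.carrier Λ')}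

theorem hatDomain_eq (Λ : Gr) (i : E.ι) (Λ' : Gr) : hatDomain E N Λ i Λ' =
    ((pointChart Λ).prod (E.chart i)).preimage
      ((OpenSub.prodRight (superPoint Λ).F N).carrier Λ') := by
  ext x
  constructor
  · rintro ⟨h, h'⟩
    exact ⟨((pointDomain Λ).mem_prod_pts (E.chart i).dom x).2 ⟨trivial, h⟩, h'⟩
  · rintro ⟨h, h'⟩
    exact ⟨(((pointDomain Λ).mem_prod_pts (E.chart i).dom x).1 h).2, h'⟩

/-- The condition on `s` to be the local expression, over the `Λ'`-points of `P(Λ)` and of the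
chart `i`, of the family of vectors `σ`. -/
def IsLocalExpr (E : SuperVectorBundle.{u, v, w} M) (N : OpenSub M.F) {Λ : Gr} (i : E.ι) {Λ' : Gr}
    (σ : ∀ (_ : Λ ⟶ Λ') (m : M.F.obj Λ'), m ∈ N.carrier Λ' → E.fib Λ' m)
    (s : ((pointDomain Λ).V.prod (E.chart i).dom.V).Bar Λ' → (E.fiber i).Bar Λ') : Prop :=
  SupersmoothOn (GrassEven Λ') s (hatDomain E N Λ i Λ') ∧
  ∀ (x : ((pointDomain Λ).V.prod (E.chart i).dom.V).Bar Λ')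
    (hx : barSnd (pointDomain Λ).V (E.chart i).dom.V Λ' x ∈ (E.chart i).dom.pts Λ')
    (hm : (E.chart i).emb Λ' ⟨_, hx⟩ ∈ N.carrier Λ'),
    s x = E.triv i Λ' _ (Set.mem_range_self _)
      (σ (pointHom Λ Λ' (barFst (pointDomain Λ).V (E.chart i).dom.V Λ' x)) _ hm)

theorem HatObj.localExpr {Λ : Gr} (σ : HatObj E N Λ) (i : E.ι) (Λ' : Gr) :
    ∃ s, IsLocalExpr E N i (fun η m hm => σ.eval (Λ' := Λ') η m hm) s := by
  obtain ⟨s, hs, hs'⟩ := σ.2.2 (i, ⟨pointChart Λ, rfl⟩) Λ'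
  refine ⟨s, ?_, fun x hx hm => ?_⟩
  · rw [hatDomain_eq]
    exact hs
  · exact hs' ⟨x, ((pointDomain Λ).mem_prod_pts (E.chart i).dom x).2 ⟨trivial, hx⟩⟩ hm

/-- A natural family of vectors with supersmooth local expressions is a section. -/
def HatObj.mk {Λ : Gr}
    (σ : ∀ {Λ' : Gr} (_ : Λ ⟶ Λ') (m : M.F.obj Λ'), m ∈ N.carrier Λ' → E.fib Λ' m)
    (hn : ∀ {Λ₁ Λ₂ : Gr} (φ : Λ₁ ⟶ Λ₂) (η : Λ ⟶ Λ₁) (m : M.F.obj Λ₁) (hm : m ∈ N.carrier Λ₁),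
      E.map φ m (σ η m hm) = σ (η ≫ φ) (M.F.map φ m) (N.map_mem φ m hm))
    (hs : ∀ (i : E.ι) (Λ' : Gr), ∃ s, IsLocalExpr E N i (σ (Λ' := Λ')) s) : HatObj E N Λ :=
  ⟨fun _ p => σ p.1.1 p.1.2 p.2, fun φ p => hn φ p.1.1 p.1.2 p.2, by
    rintro ⟨i, c, hc⟩ Λ'
    obtain rfl : c = pointChart Λ := hc
    obtain ⟨s, h, h'⟩ := hs i Λ'
    refine ⟨s, ?_, fun x hx =>
      h' x.1 (((pointDomain Λ).mem_prod_pts (E.chart i).dom x.1).1 x.2).2 hx⟩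
    rw [hatDomain_eq] at h
    exact h⟩

variable (E N)

/-- The even part of `Λ` acts on `Γ̂(N, E)(Λ)` by multiplication with functions on `P(Λ)`: the
element `a` is the function with the value `η(a)` at the point `η : Λ → Λ'` of `P(Λ)`. -/
noncomputable def HatObj.act {E : SuperVectorBundle.{u, v, w} M} {N : OpenSub M.F} {Λ : Gr}
    (a : GrassEven Λ) (σ : HatObj E N Λ) : HatObj E N Λ :=
  HatObj.mk (fun η m hm => GrHom.even η a • σ.eval η m hm)
    (fun φ η m hm => (map_smulₛₗ (E.map φ m) _ _).trans
      (congrArg (GrHom.even φ (GrHom.even η a) • ·) (σ.natural φ η m hm)))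
    (fun i Λ' => by
      obtain ⟨s, hs, hs'⟩ := σ.localExpr i Λ'
      refine ⟨fun x => grassEvenProj Λ' ((pointHom Λ Λ' (barFst (pointDomain Λ).V
        (E.chart i).dom.V Λ' x)).toAlgHom a.1) • s x, ?_, fun x hx hm => ?_⟩
      · exact SupersmoothOn.grassAct ((supersmoothOn_pointHom Λ Λ' a.1 Set.univ).comp_clm _
          (barHom_smul _ _ _) fun _ _ => trivial) hs
      · have h := congrArg₂ (fun (b : GrassEven Λ') y => b • y) (grassProj_coe (i := 0) (GrHom.even
          (pointHom Λ Λ' (barFst (pointDomain Λ).V (E.chart i).dom.V Λ' x)) a)) (hs' x hx hm)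
        exact h.trans (map_smul (E.triv i Λ' _ (Set.mem_range_self _)) _ _).symm)

noncomputable instance (Λ : Gr) : Module (GrassEven Λ) (HatObj E N Λ) where
  smul := HatObj.act
  one_smul σ := HatObj.ext fun η m hm =>
    (congrArg (· • σ.eval η m hm) (map_one (GrHom.even η))).trans (one_smul _ _)
  mul_smul a b σ := HatObj.ext fun η m hm =>
    (congrArg (· • σ.eval η m hm) (map_mul (GrHom.even η) a b)).trans (mul_smul _ _ _)
  smul_zero a := HatObj.ext fun {Λ'} η m _ =>
    show GrHom.even η a • (0 : E.fib Λ' m) = 0 from smul_zero _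
  smul_add a _ _ := HatObj.ext fun η _ _ => smul_add (GrHom.even η a) _ _
  add_smul a b σ := HatObj.ext fun η m hm =>
    (congrArg (· • σ.eval η m hm) (map_add (GrHom.even η) a b)).trans (add_smul _ _ _)
  zero_smul σ := HatObj.ext fun η m hm =>
    (congrArg (· • σ.eval η m hm) (map_zero (GrHom.even η))).trans (zero_smul _ _)

/-- `Γ̂(N, E)(φ)`: the pullback of sections along `P(φ) × id`, where `P(φ)` is the map `η ↦ η ∘ φ`
of superpoints. -/
noncomputable def HatObj.map {E : SuperVectorBundle.{u, v, w} M} {N : OpenSub M.F} {Λ Λ₁ : Gr}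
    (φ : Λ ⟶ Λ₁) (σ : HatObj E N Λ) : HatObj E N Λ₁ :=
  HatObj.mk (fun η m hm => σ.eval (φ ≫ η) m hm)
    (fun ψ η m hm => (σ.natural ψ (φ ≫ η) m hm).trans (by rw [Category.assoc]))
    (fun i Λ' => by
      obtain ⟨s, hs, hs'⟩ := σ.localExpr i Λ'
      let V := (E.chart i).dom.V
      let q : ((pointDomain Λ₁).V.prod V).Bar Λ' → ((pointDomain Λ).V.prod V).Bar Λ' := fun x =>
        barPair (pointDomain Λ).V V Λ' (pointCoord Λ Λ' (φ ≫ pointHom Λ₁ Λ'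
          (barFst (pointDomain Λ₁).V V Λ' x)), barSnd (pointDomain Λ₁).V V Λ' x)
      have q1 : ∀ x, barFst (pointDomain Λ).V V Λ' (q x) = pointCoord Λ Λ' (φ ≫ pointHom Λ₁ Λ'
          (barFst (pointDomain Λ₁).V V Λ' x)) := fun x => barFst_pair _ _ _ _
      have q2 : ∀ x, barSnd (pointDomain Λ).V V Λ' (q x) = barSnd (pointDomain Λ₁).V V Λ' x :=
        fun x => barSnd_pair _ _ _ _
      refine ⟨fun x => s (q x), ?_, fun x hx hm => ?_⟩
      · refine SupersmoothOn.comp ?_ hs (SupersmoothOn.clm_comp (SupersmoothOn.prodMk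
          ((supersmoothOn_pointCoord φ Λ' Set.univ).comp_clm _ (barHom_smul _ _ _)
            fun _ _ => trivial) (supersmoothOn_clm _ (barHom_smul _ _ _) _)) _
            (barPair_smul _ _ _)) ?_
        · exact ((E.chart i).isOpen_preimage (N.isOpen Λ')).preimage
            (barSnd (pointDomain Λ).V V Λ').continuous
        · intro x hx
          change barSnd (pointDomain Λ).V V Λ' (q x) ∈ (E.chart i).preimage (N.carrier Λ')
          rw [q2]
          exact hx
      · have h : ∀ (y : V.Bar Λ') (hy : y = barSnd (pointDomain Λ₁).V V Λ' x)
            (η : Λ ⟶ Λ') (_ : η = φ ≫ pointHom Λ₁ Λ' (barFst (pointDomain Λ₁).V V Λ' x))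
            (h1 : y ∈ (E.chart i).dom.pts Λ') (h2 : (E.chart i).emb Λ' ⟨y, h1⟩ ∈ N.carrier Λ'),
            E.triv i Λ' _ (Set.mem_range_self ⟨y, h1⟩) (σ.eval η _ h2) =
            E.triv i Λ' _ (Set.mem_range_self ⟨_, hx⟩) (σ.eval (φ ≫ pointHom Λ₁ Λ'
              (barFst (pointDomain Λ₁).V V Λ' x)) _ hm) := by
          rintro _ rfl _ rfl h1 h2
          rfl
        have h1 : barSnd (pointDomain Λ).V V Λ' (q x) ∈ (E.chart i).dom.pts Λ' := by
          rw [q2]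
          exact hx
        have h2 : (E.chart i).emb Λ' ⟨_, h1⟩ ∈ N.carrier Λ' := by
          have e : (⟨_, h1⟩ : (E.chart i).dom.pts Λ') = ⟨_, hx⟩ := Subtype.ext (q2 x)
          rw [e]
          exact hm
        refine (hs' (q x) h1 h2).trans (h _ (q2 x) _ ?_ h1 h2)
        rw [q1]
        exact (pointEquiv Λ Λ').symm_apply_apply _)

/-- The functor `Γ̂(N, E)` of sections over the open subfunctor `N` of the base, as an
`ℝ̄`-module. -/
noncomputable def hatSections : RBarMod.{max u v} where
  obj Λ := HatObj E N Λ
  map {Λ Λ'} φ :=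
    { toFun := HatObj.map φ
      map_add' := fun _ _ => rfl
      map_smul' := fun _ _ => rfl }
  map_id Λ σ := HatObj.ext fun η m hm => by
    change σ.eval (𝟙 Λ ≫ η) m hm = _
    rw [Category.id_comp]
  map_comp φ ψ σ := HatObj.ext fun η m hm => by
    change σ.eval ((φ ≫ ψ) ≫ η) m hm = σ.eval (φ ≫ ψ ≫ η) m hm
    rw [Category.assoc]

/-- The restriction of sections to a smaller open subfunctor. -/
noncomputable def hatRestrict (N N' : OpenSub M.F) (h : ∀ Λ, N'.carrier Λ ⊆ N.carrier Λ) :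
    hatSections E N ⟶ hatSections E N' where
  app Λ :=
    { toFun := fun σ : HatObj E N Λ =>
        (HatObj.mk (fun η m hm => σ.eval η m (h _ hm)) (fun φ η m hm => σ.natural φ η m (h _ hm))
          (fun i Λ' => by
            obtain ⟨s, hs, hs'⟩ := σ.localExpr i Λ'
            refine ⟨s, hs.mono ?_, fun x hx hm => hs' x hx (h _ hm)⟩
            rintro x ⟨h1, h2⟩
            exact ⟨h1, h _ h2⟩) : HatObj E N' Λ)
      map_add' := fun _ _ => rfl
      map_smul' := fun _ _ => rfl }
  natural _ _ := rfl

theorem triv_congr (i : E.ι) {Λ : Gr} {m m' : M.F.obj Λ} (e : m = m')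
    (h : m ∈ Set.range ((E.chart i).emb Λ)) (h' : m' ∈ Set.range ((E.chart i).emb Λ))
    (f : ∀ m : M.F.obj Λ, m ∈ Set.range ((E.chart i).emb Λ) → E.fib Λ m) :
    E.triv i Λ m h (f m h) = E.triv i Λ m' h' (f m' h') := by
  subst e
  rfl

/-- The pullback of sections along the trivialization of `E` over the chart `i`; its values are
sections of a trivial bundle over a superdomain. -/
noncomputable def chartPullback (i : E.ι) : hatSections E (E.chart i).image ⟶
    hatSections (trivialBundle (E.chart i).dom (E.fiber i))
      (OpenSub.top (E.chart i).dom.toSuperManifold.F) where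
  app Λ :=
    { toFun := fun σ : HatObj E (E.chart i).image Λ =>
        (HatObj.mk (fun {Λ'} η (x : (E.chart i).dom.pts Λ') _ => E.triv i Λ' _ (Set.mem_range_self x)
            (σ.eval η ((E.chart i).emb Λ' x) (Set.mem_range_self x)))
          (fun {Λ₁ Λ₂} φ η (x : (E.chart i).dom.pts Λ₁) _ => by
            have hx := Set.mem_range_self (f := (E.chart i).emb Λ₁) x
            have h1 := E.triv_natural i φ ((E.chart i).emb Λ₁ x) hx
              ((E.chart i).image.map_mem φ _ hx) (σ.eval η _ hx)
            refine h1.symm.trans ?_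
            rw [σ.natural φ η _ hx]
            exact triv_congr E i ((E.chart i).natural φ x) _ _ (fun m hm => σ.eval (η ≫ φ) m hm))
          (fun _ Λ' => by
            obtain ⟨s, hs, hs'⟩ := σ.localExpr i Λ'
            refine ⟨s, hs.mono ?_, fun x hx _ => hs' x hx (Set.mem_range_self _)⟩
            rintro x ⟨h1, -⟩
            exact ⟨h1, Set.mem_range_self _⟩) :
          HatObj (trivialBundle (E.chart i).dom (E.fiber i))
            (OpenSub.top (E.chart i).dom.toSuperManifold.F) Λ)
      map_add' := fun σ τ => HatObj.ext fun {Λ'} η (x : (E.chart i).dom.pts Λ') _ =>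
        map_add (E.triv i Λ' _ (Set.mem_range_self x)) _ _
      map_smul' := fun a σ => HatObj.ext fun {Λ'} η (x : (E.chart i).dom.pts Λ') _ =>
        map_smul (E.triv i Λ' _ (Set.mem_range_self x)) _ _ }
  natural _ _ := rfl

/-- The diagram of the `ℝ̄`-modules of sections over the charts of an atlas and over their
overlaps. -/
noncomputable def gluingDiagram :
    Limits.MulticospanIndex (Limits.MulticospanShape.prod E.ι) RBarMod.{max u v} where
  left i := hatSections E (E.chart i).image
  right p := hatSections E ((E.chart p.1).image.inter (E.chart p.2).image)
  fst p := hatRestrict E (E.chart p.1).image _ fun _ _ h => h.1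
  snd p := hatRestrict E (E.chart p.2).image _ fun _ _ h => h.2

/-- The cone over the gluing diagram given by the restrictions of global sections. -/
noncomputable def gluingFork : Limits.Multifork (gluingDiagram E) :=
  Limits.Multifork.ofι _ (hatSections E (OpenSub.top M.F))
    (fun i => hatRestrict E (OpenSub.top M.F) (E.chart i).image fun _ _ _ => trivial)
    (fun _ => rfl)

end HatSections

/-! ### Locality of supersmoothness -/

section Locality

set_option linter.unusedSectionVars false

variable {E : Type u} {F : Type v} {G : Type w} {H : Type w'}
  [AddCommGroup E] [Module ℝ E] [TopologicalSpace E]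
  [AddCommGroup F] [Module ℝ F] [TopologicalSpace F]
  [AddCommGroup G] [Module ℝ G] [TopologicalSpace G]
  [AddCommGroup H] [Module ℝ H] [TopologicalSpace H]

/-! A bar-construction V̄ is recovered from two of its values. V̄(ℝ) is the even part of V, and for
the Grassmann algebra on one generator θ the kernel of the augmentation V̄ → V̄(ℝ) is θ ⊗ V_odd. For
an arbitrary ℝ̄-module X these two spaces form `X.super`. If the image of a kernel element t under θ
↦ a depends linearly on the odd element a (`RBarMod.OddLinear`), there is a natural comparison
morphism from the bar-construction of `X.super` to X. It sends a ⊗ s with a even to a times the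
image of s ∈ X(ℝ), and a ⊗ t with a odd to the image of t under θ ↦ a. Superrepresentability is
proved by showing that the comparison is bijective for X = Γ̂(M, E).

Trivial bundles. A section σ over P(k) × N is natural, hence determined by its values at the
universal point of P(k), which lives over the coproduct `Λ.ext k`, linearly Λ ⊗ k. The value σ(η, x)
is the image of the universal value under the morphism a ⊗ b ↦ a η(b) (`LocSec.val_eq`). Along a
homogeneous basis e_J of k this becomes an expansion of σ(η, x) as a sum of terms σ_J(x) η(e_J)
(`Gr.desc_eq_sum`). Reading off the coefficient of an even e_J preserves parity, that of an odd e_J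
reverses it. Thus σ_J is a supersmooth map to W̄ in the first case and to the bar-construction of ΠW
in the second. Maps of the first kind are the elements of X(ℝ); a map g of the second kind
corresponds to the section g·θ in the kernel of the augmentation. The existence of the expansion is
surjectivity of the comparison, and the uniqueness of its coefficients is injectivity. Over a whole
superdomain the coefficient spaces are those of SC^∞(U, W ⊕ ΠW), which gives the second assertion.

General bundles. Linearity in the odd parameter and injectivity of the comparison are inherited
along jointly injective families of morphisms. Restriction to the trivializations therefore yields
both over every open subfunctor, in particular over overlaps, which need not be superdomains. Over a
chart, pullback along the trivialization is bijective, so surjectivity holds there as well. For a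
global section, local preimages under the comparison agree on overlaps by injectivity. Their
coefficients along a finite basis of Λ are compatible families of sections, and the glued
coefficients assemble to a preimage (`RBarMod.JointlyInjective.comparison_surjective`).

The glueing of sections, which is also the limit property, rests on the locality of supersmoothness:
directional derivatives in a Hausdorff space are unique, so local derivatives fit together, and
changes of chart and transition maps carry a local expression from one trivialization to another
(`exists_isLocalExpr_of_cover`). -/

theorem HasDirDeriv.unique [T2Space F] {f : E → F} {x v : E} {a b : F} (h : HasDirDeriv f x v a)
    (h' : HasDirDeriv f x v b) : a = b :=
  tendsto_nhds_unique h h'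

theorem HasDirDeriv.congr_of_eqOn [IsTopologicalAddGroup E] [ContinuousSMul ℝ E] {f g : E → F}
    {x v : E} {a : F} {U : Set E} (hU : IsOpen U) (hx : x ∈ U) (h : HasDirDeriv g x v a)
    (hfg : Set.EqOn f g U) : HasDirDeriv f x v a := by
  refine Filter.Tendsto.congr' ?_ h
  have hc : Continuous fun t : ℝ => x + t • v := by fun_prop
  have h1 : (fun t : ℝ => x + t • v) ⁻¹' U ∈ 𝓝 (0 : ℝ) :=
    hc.continuousAt.preimage_mem_nhds (hU.mem_nhds (by simpa using hx))
  filter_upwards [nhdsWithin_le_nhds h1] with t ht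
  rw [hfg ht, hfg hx]

theorem continuousOn_of_local {X : Type*} {Y : Type*} [TopologicalSpace X] [TopologicalSpace Y]
    {f : X → Y} {S : Set X} (h : ∀ x ∈ S, ∃ U, IsOpen U ∧ x ∈ U ∧ ∃ g, ContinuousOn g U ∧
      Set.EqOn f g U) : ContinuousOn f S := by
  intro x hx
  obtain ⟨U, hU, hxU, g, hg, hfg⟩ := h x hx
  exact (((hg.congr hfg).continuousAt (hU.mem_nhds hxU))).continuousWithinAt

/-- The glueing of locally defined derivatives. -/
theorem exists_glued_deriv [IsTopologicalAddGroup E] [ContinuousSMul ℝ E] [T2Space F]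
    {f : E → F} {S : Set E} {P : Set E → (E × E → F) → Prop}
    (h : ∀ x ∈ S, ∃ U, IsOpen U ∧ U ⊆ S ∧ x ∈ U ∧ ∃ g dg, Set.EqOn f g U ∧
      (∀ y ∈ U, ∀ v, HasDirDeriv g y v (dg (y, v))) ∧ P U dg) :
    ∃ df : E × E → F, (∀ x ∈ S, ∀ v, HasDirDeriv f x v (df (x, v))) ∧
      ∀ x ∈ S, ∃ U, IsOpen U ∧ U ⊆ S ∧ x ∈ U ∧ ∃ dg, P U dg ∧
        Set.EqOn df dg (U ×ˢ Set.univ) := by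
  classical
  have h' : ∀ x : S, ∃ U, IsOpen U ∧ U ⊆ S ∧ x.1 ∈ U ∧ ∃ dg,
      (∀ y ∈ U, ∀ v, HasDirDeriv f y v (dg (y, v))) ∧ P U dg := by
    intro x
    obtain ⟨U, hU, hUS, hx, g, dg, hfg, hd, hP⟩ := h x x.2
    exact ⟨U, hU, hUS, hx, dg, fun y hy v => (hd y hy v).congr_of_eqOn hU hy hfg, hP⟩
  choose U hU hUS hx dg hd hP using h'
  -- At x the derivative chosen for the neighbourhood of x itself is used; off S the value 0 is a
  -- default. Uniqueness of directional derivatives then makes `df` agree with each chosen `dg` on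
  -- the whole of its neighbourhood.
  let df : E × E → F := fun p => if hp : p.1 ∈ S then dg ⟨p.1, hp⟩ p else 0
  have hdf : ∀ x ∈ S, ∀ v, HasDirDeriv f x v (df (x, v)) := by
    intro x hxS v
    simp only [df, hxS, dif_pos]
    exact hd ⟨x, hxS⟩ x (hx _) v
  refine ⟨df, hdf, fun x hxS => ⟨U ⟨x, hxS⟩, hU _, hUS _, hx ⟨x, hxS⟩, dg ⟨x, hxS⟩, hP _, ?_⟩⟩
  rintro ⟨y, v⟩ ⟨hy, -⟩
  exact (hdf y (hUS _ hy) v).unique (hd _ y hy v)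

/-- Being of class C^(k+1) requires a single derivative on all of S, so local derivatives must be
glued before the induction hypothesis can be applied. The predicate `P` records that each local
derivative is of class C^k, which makes the glued one locally C^k on S × E. -/
theorem CkOn.of_local [IsTopologicalAddGroup E] [ContinuousSMul ℝ E] [T2Space F] {k : ℕ}
    {f : E → F} {S : Set E} (h : ∀ x ∈ S, ∃ U, IsOpen U ∧ U ⊆ S ∧ x ∈ U ∧ ∃ g, CkOn k g U ∧
      Set.EqOn f g U) : CkOn k f S := by
  induction k generalizing E with
  | zero =>
    refine continuousOn_of_local fun x hx => ?_
    obtain ⟨U, hU, -, hxU, g, hg, hfg⟩ := h x hx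
    exact ⟨U, hU, hxU, g, hg, hfg⟩
  | succ k ih =>
    refine ⟨continuousOn_of_local fun x hx => ?_, ?_⟩
    · obtain ⟨U, hU, -, hxU, g, hg, hfg⟩ := h x hx
      exact ⟨U, hU, hxU, g, hg.1, hfg⟩
    · obtain ⟨df, hd, hdf⟩ := exists_glued_deriv (f := f) (S := S)
        (P := fun U dg => CkOn k dg (U ×ˢ Set.univ)) fun x hx => by
          obtain ⟨U, hU, hUS, hxU, g, ⟨-, dg, hdg, hk⟩, hfg⟩ := h x hx
          exact ⟨U, hU, hUS, hxU, g, dg, hfg, hdg, hk⟩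
      refine ⟨df, hd, ih ?_⟩
      rintro ⟨x, v⟩ ⟨hx, -⟩
      obtain ⟨U, hU, hUS, hxU, dg, hk, he⟩ := hdf x hx
      exact ⟨U ×ˢ Set.univ, hU.prod isOpen_univ, Set.prod_mono hUS subset_rfl, ⟨hxU, trivial⟩,
        dg, hk, he⟩

/-- The derivative in the second clause is glued separately, with `P` now carrying continuity and
`A`-linearity; both can be tested near each point. -/
theorem SupersmoothOn.of_local {A : Type*} [Semiring A] [Module A E] [Module A F]
    [IsTopologicalAddGroup E] [ContinuousSMul ℝ E] [T2Space F] {f : E → F} {S : Set E}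
    (h : ∀ x ∈ S, ∃ U, IsOpen U ∧ U ⊆ S ∧ x ∈ U ∧ ∃ g, SupersmoothOn A g U ∧ Set.EqOn f g U) :
    SupersmoothOn A f S := by
  refine ⟨fun k => CkOn.of_local fun x hx => ?_, ?_⟩
  · obtain ⟨U, hU, hUS, hxU, g, hg, hfg⟩ := h x hx
    exact ⟨U, hU, hUS, hxU, g, hg.1 k, hfg⟩
  · obtain ⟨df, hd, hdf⟩ := exists_glued_deriv (f := f) (S := S)
      (P := fun U dg => ContinuousOn dg (U ×ˢ Set.univ) ∧
        ∀ x ∈ U, ∀ (a : A) (v : E), dg (x, a • v) = a • dg (x, v)) fun x hx => by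
          obtain ⟨U, hU, hUS, hxU, g, ⟨-, dg, hc, hdg, hl⟩, hfg⟩ := h x hx
          exact ⟨U, hU, hUS, hxU, g, dg, hfg, hdg, hc, hl⟩
    refine ⟨df, continuousOn_of_local ?_, hd, fun x hx a v => ?_⟩
    · rintro ⟨x, v⟩ ⟨hx, -⟩
      obtain ⟨U, hU, hUS, hxU, dg, hk, he⟩ := hdf x hx
      exact ⟨U ×ˢ Set.univ, hU.prod isOpen_univ, ⟨hxU, trivial⟩, dg, hk.1, he⟩
    · obtain ⟨U, hU, hUS, hxU, dg, hk, he⟩ := hdf x hx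
      rw [he ⟨hxU, trivial⟩, he ⟨hxU, trivial⟩, hk.2 x hxU]

/-- Change of scalars: the composition of a supersmooth map with semilinear maps on both sides. -/
theorem SupersmoothOn.comp_semilinear {A : Type*} {B : Type*} [Ring A] [Ring B]
    [IsTopologicalAddGroup E] [ContinuousSMul ℝ E] [IsTopologicalAddGroup F] [ContinuousSMul ℝ F]
    [IsTopologicalAddGroup G] [ContinuousSMul ℝ G] [IsTopologicalAddGroup H] [ContinuousSMul ℝ H]
    [LocallyConvexSpace ℝ G] [Module A E] [Module A H] [Module B F] [Module B G] {f : F → G}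
    {T : Set F} (hT : IsOpen T) (hf : SupersmoothOn B f T) (ρ : A → B) (L : E →L[ℝ] F) (c : F)
    (P : G →L[ℝ] H) (hL : ∀ a x, L (a • x) = ρ a • L x) (hP : ∀ a y, P (ρ a • y) = a • P y)
    {S : Set E} (hST : ∀ x ∈ S, L x + c ∈ T) :
    SupersmoothOn A (fun x => P (f (L x + c))) S := by
  obtain ⟨hk, df, hc, hd, hl⟩ := hf
  refine ⟨fun k => (CkOn.comp hT (hk k) ((ckOn_clm L S).add (ckOn_const c S)) hST).clm_comp P,
    fun p => P (df (L p.1 + c, L p.2)), ?_, fun x hx v => ?_, fun x hx a v => ?_⟩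
  · refine P.continuous.comp_continuousOn (hc.comp (Continuous.continuousOn (by fun_prop)) ?_)
    exact fun p hp => ⟨hST _ hp.1, trivial⟩
  · refine HasDirDeriv.clm_comp P ?_
    refine Filter.Tendsto.congr (fun t => ?_) (hd _ (hST x hx) (L v))
    simp only [map_add, map_smul, add_right_comm]
  · simp only [hL, hl _ (hST x hx), hP]

end Locality

/-! ### Parity of elements and linear maps of Grassmann algebras -/

/-- The grading involution. -/
noncomputable def grassInv (Λ : Gr) : Grass Λ →ₐ[ℝ] Grass Λ := CliffordAlgebra.involute

theorem grassInv_even {Λ : Gr} (x : GrassPart Λ 0) : grassInv Λ x.1 = x.1 :=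
  CliffordAlgebra.involute_eq_of_mem_even x.2

theorem grassInv_odd {Λ : Gr} (x : GrassPart Λ 1) : grassInv Λ x.1 = -x.1 :=
  CliffordAlgebra.involute_eq_of_mem_odd x.2

theorem grassProj_add {Λ : Gr} (x : Grass Λ) : (grassProj Λ 0 x).1 + (grassProj Λ 1 x).1 = x := by
  obtain ⟨y, hy, z, hz, rfl⟩ := Submodule.mem_sup.1 (((CliffordAlgebra.evenOdd_isCompl
    (0 : QuadraticForm ℝ (Fin Λ.rank → ℝ))).sup_eq_top.symm ▸ Submodule.mem_top : x ∈ _))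
  have h1 : (grassProj Λ 1 y).1 = 0 := DirectSum.decompose_of_mem_ne
    (CliffordAlgebra.evenOdd (0 : QuadraticForm ℝ (Fin Λ.rank → ℝ))) hy zero_ne_one
  have h2 : (grassProj Λ 0 z).1 = 0 := DirectSum.decompose_of_mem_ne
    (CliffordAlgebra.evenOdd (0 : QuadraticForm ℝ (Fin Λ.rank → ℝ))) hz one_ne_zero
  have h3 : (grassProj Λ 0 y).1 = y := congrArg Subtype.val (grassProj_coe ⟨y, hy⟩)
  have h4 : (grassProj Λ 1 z).1 = z := congrArg Subtype.val (grassProj_coe ⟨z, hz⟩)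
  rw [map_add, map_add]
  change (grassProj Λ 0 y).1 + (grassProj Λ 0 z).1 +
    ((grassProj Λ 1 y).1 + (grassProj Λ 1 z).1) = y + z
  rw [h1, h2, h3, h4, add_zero, zero_add]

theorem grassProj_zero_eq {Λ : Gr} (x : Grass Λ) :
    (grassProj Λ 0 x).1 = (2⁻¹ : ℝ) • (x + grassInv Λ x) := by
  conv_rhs => rw [← grassProj_add x, map_add, grassInv_even, grassInv_odd]
  module

theorem grassProj_one_eq {Λ : Gr} (x : Grass Λ) :
    (grassProj Λ 1 x).1 = (2⁻¹ : ℝ) • (x - grassInv Λ x) := by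
  conv_rhs => rw [← grassProj_add x, map_add, grassInv_even, grassInv_odd]
  module

theorem grassProj_zero_odd {Λ : Gr} (x : GrassPart Λ 1) : grassProj Λ 0 x.1 = 0 :=
  Subtype.ext (by rw [grassProj_zero_eq, grassInv_odd, add_neg_cancel, smul_zero]; rfl)

theorem grassProj_one_even {Λ : Gr} (x : GrassPart Λ 0) : grassProj Λ 1 x.1 = 0 :=
  Subtype.ext (by rw [grassProj_one_eq, grassInv_even, sub_self, smul_zero]; rfl)

/-- Parity becomes an eigenvalue condition for the grading involution, an algebra morphism, so the
parity of products and of compositions can be computed by rewriting. -/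
theorem mem_even_iff {Λ : Gr} {x : Grass Λ} :
    x ∈ CliffordAlgebra.evenOdd (0 : QuadraticForm ℝ (Fin Λ.rank → ℝ)) 0 ↔ grassInv Λ x = x := by
  refine ⟨fun h => grassInv_even ⟨x, h⟩, fun h => ?_⟩
  have h1 : (grassProj Λ 0 x).1 = x := by rw [grassProj_zero_eq, h]; module
  exact h1 ▸ (grassProj Λ 0 x).2

theorem mem_odd_iff {Λ : Gr} {x : Grass Λ} :
    x ∈ CliffordAlgebra.evenOdd (0 : QuadraticForm ℝ (Fin Λ.rank → ℝ)) 1 ↔ grassInv Λ x = -x := by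
  refine ⟨fun h => grassInv_odd ⟨x, h⟩, fun h => ?_⟩
  have h1 : (grassProj Λ 1 x).1 = x := by rw [grassProj_one_eq, h]; module
  exact h1 ▸ (grassProj Λ 1 x).2

/-- Parity-preserving linear maps. -/
def IsEvenMap {Λ Λ' : Gr} (A : Grass Λ →ₗ[ℝ] Grass Λ') : Prop :=
  ∀ x, A (grassInv Λ x) = grassInv Λ' (A x)

/-- Parity-reversing linear maps. -/
def IsOddMap {Λ Λ' : Gr} (A : Grass Λ →ₗ[ℝ] Grass Λ') : Prop :=
  ∀ x, A (grassInv Λ x) = -grassInv Λ' (A x)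

theorem GrHom.map_inv {Λ Λ' : Gr} (φ : Λ ⟶ Λ') (x : Grass Λ) :
    φ.toAlgHom (grassInv Λ x) = grassInv Λ' (φ.toAlgHom x) := by
  have h0 := mem_even_iff.1 (φ.mem_part 0 _ (grassProj Λ 0 x).2)
  have h1 := mem_odd_iff.1 (φ.mem_part 1 _ (grassProj Λ 1 x).2)
  rw [← grassProj_add x]
  simp only [map_add, grassInv_even, grassInv_odd, map_neg, h0, h1]

theorem GrHom.isEvenMap {Λ Λ' : Gr} (φ : Λ ⟶ Λ') : IsEvenMap φ.toAlgHom.toLinearMap :=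
  GrHom.map_inv φ

/-! ### Morphisms given by the images of the generators, and coproducts -/

/-- The point of `ℝ^{0|k}` with given coordinates. -/
noncomputable def oddPoint {k : ℕ} {Λ : Gr} (a : Fin k → GrassPart Λ 1) :
    (TopSVect.oddSpace k).Bar Λ :=
  (0, ∑ i, a i ⊗ₜ[ℝ] (Pi.single i 1 : Fin k → ℝ))

theorem oddCoord_oddPoint {k : ℕ} {Λ : Gr} (a : Fin k → GrassPart Λ 1) (i : Fin k) :
    oddCoord k Λ i (oddPoint a) = a i := by
  have h : oddCoord k Λ i (oddPoint a) = TensorProduct.rid ℝ (GrassPart Λ 1)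
      ((LinearMap.proj i : (Fin k → ℝ) →ₗ[ℝ] ℝ).lTensor (GrassPart Λ 1)
        (∑ i, a i ⊗ₜ[ℝ] (Pi.single i 1 : Fin k → ℝ))) := rfl
  rw [h]
  simp [Pi.single_apply]

/-- The morphism with prescribed values on the generators. -/
noncomputable def Gr.ofGens {k Λ : Gr} (a : Fin k.rank → GrassPart Λ 1) : k ⟶ Λ :=
  pointHom k Λ (oddPoint a)

theorem Gr.ofGens_gen {k Λ : Gr} (a : Fin k.rank → GrassPart Λ 1) (i : Fin k.rank) :
    GrHom.part (Gr.ofGens a) 1 (k.gen i) = a i := by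
  rw [Gr.ofGens, pointHom_gen, oddCoord_oddPoint]

theorem GrHom.part_comp {Λ Λ' Λ'' : Gr} (φ : Λ ⟶ Λ') (ψ : Λ' ⟶ Λ'') (i : ZMod 2)
    (x : GrassPart Λ i) : GrHom.part (φ ≫ ψ) i x = GrHom.part ψ i (GrHom.part φ i x) := rfl

/-- The Grassmann algebra on the generators of `Λ` and of `k`. -/
def Gr.ext (Λ k : Gr) : Gr := ⟨Λ.rank + k.rank⟩

def Gr.extInl (Λ k : Gr) (i : Fin Λ.rank) : Fin (Λ.ext k).rank := Fin.castAdd k.rank i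

def Gr.extInr (Λ k : Gr) (i : Fin k.rank) : Fin (Λ.ext k).rank := Fin.natAdd Λ.rank i

def Gr.extCases {Λ k : Gr} {C : Fin (Λ.ext k).rank → Sort*} (l : ∀ i, C (Λ.extInl k i))
    (r : ∀ i, C (Λ.extInr k i)) (i : Fin (Λ.ext k).rank) : C i := Fin.addCases l r i

noncomputable def Gr.inl (Λ k : Gr) : Λ ⟶ Λ.ext k :=
  Gr.ofGens fun i => (Λ.ext k).gen (Λ.extInl k i)

noncomputable def Gr.inr (Λ k : Gr) : k ⟶ Λ.ext k :=
  Gr.ofGens fun i => (Λ.ext k).gen (Λ.extInr k i)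

/-- The copairing that makes `Λ.ext k` the coproduct of Λ and k: a morphism out of a Grassmann
algebra is an arbitrary tuple of odd elements, and the generators of `Λ.ext k` are those of Λ
together with those of k. -/
noncomputable def Gr.desc {Λ k Λ' : Gr} (f : Λ ⟶ Λ') (g : k ⟶ Λ') : Λ.ext k ⟶ Λ' :=
  Gr.ofGens (Gr.extCases (C := fun _ => GrassPart Λ' 1)
    (fun i => GrHom.part f 1 (Λ.gen i)) (fun i => GrHom.part g 1 (k.gen i)))

@[simp]
theorem Gr.inl_desc {Λ k Λ' : Gr} (f : Λ ⟶ Λ') (g : k ⟶ Λ') : Λ.inl k ≫ Gr.desc f g = f :=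
  grHom_ext_gen fun i => by
    rw [GrHom.part_comp, Gr.inl, Gr.ofGens_gen, Gr.desc, Gr.ofGens_gen]
    exact Fin.addCases_left i

@[simp]
theorem Gr.inr_desc {Λ k Λ' : Gr} (f : Λ ⟶ Λ') (g : k ⟶ Λ') : Λ.inr k ≫ Gr.desc f g = g :=
  grHom_ext_gen fun i => by
    rw [GrHom.part_comp, Gr.inr, Gr.ofGens_gen, Gr.desc, Gr.ofGens_gen]
    exact Fin.addCases_right i

theorem Gr.desc_inl {Λ k Λ' : Gr} (f : Λ ⟶ Λ') (g : k ⟶ Λ') (a : Grass Λ) :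
    (Gr.desc f g).toAlgHom ((Λ.inl k).toAlgHom a) = f.toAlgHom a := by
  conv_rhs => rw [← Gr.inl_desc f g]
  rfl

theorem Gr.desc_inr {Λ k Λ' : Gr} (f : Λ ⟶ Λ') (g : k ⟶ Λ') (b : Grass k) :
    (Gr.desc f g).toAlgHom ((Λ.inr k).toAlgHom b) = g.toAlgHom b := by
  conv_rhs => rw [← Gr.inr_desc f g]
  rfl

/-- The functoriality of the coproduct in the first variable. -/
noncomputable def Gr.extMap {Λ Λ' : Gr} (φ : Λ ⟶ Λ') (k : Gr) : Λ.ext k ⟶ Λ'.ext k :=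
  Gr.desc (φ ≫ Λ'.inl k) (Λ'.inr k)

/-- The multiplication map `Λ ⊗ k → Λ.ext k`. -/
noncomputable def Gr.mulMap (Λ k : Gr) : Grass Λ ⊗[ℝ] Grass k →ₗ[ℝ] Grass (Λ.ext k) :=
  TensorProduct.lift ((LinearMap.mul ℝ (Grass (Λ.ext k))).compl₁₂ (Λ.inl k).toAlgHom.toLinearMap
    (Λ.inr k).toAlgHom.toLinearMap)

theorem Gr.mulMap_tmul (Λ k : Gr) (a : Grass Λ) (b : Grass k) :
    Λ.mulMap k (a ⊗ₜ b) = (Λ.inl k).toAlgHom a * (Λ.inr k).toAlgHom b := rfl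

theorem Gr.inl_gen (Λ k : Gr) (i : Fin Λ.rank) :
    (Λ.inl k).toAlgHom (Λ.gen i).1 = ((Λ.ext k).gen (Λ.extInl k i)).1 :=
  congrArg Subtype.val (Gr.ofGens_gen _ i)

theorem Gr.inr_gen (Λ k : Gr) (i : Fin k.rank) :
    (Λ.inr k).toAlgHom (k.gen i).1 = ((Λ.ext k).gen (Λ.extInr k i)).1 :=
  congrArg Subtype.val (Gr.ofGens_gen _ i)

theorem Gr.gen_mul (Λ : Gr) (i : Fin Λ.rank) (x : Grass Λ) :
    (Λ.gen i).1 * x = grassInv Λ x * (Λ.gen i).1 :=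
  grass_ι_mul (Pi.single i 1) x

/-- Induction on elements of a Grassmann algebra by left multiplication with generators. -/
theorem Gr.gen_induction {Λ : Gr} {p : Submodule ℝ (Grass Λ)} (h1 : 1 ∈ p)
    (h : ∀ i, ∀ x ∈ p, (Λ.gen i).1 * x ∈ p) (x : Grass Λ) : x ∈ p := by
  refine CliffordAlgebra.left_induction (Q := (0 : QuadraticForm ℝ (Fin Λ.rank → ℝ)))
    (P := fun x => x ∈ p) (fun r => ?_) (fun x y hx hy => p.add_mem hx hy) (fun x m hx => ?_) x
  · rw [Algebra.algebraMap_eq_smul_one]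
    exact p.smul_mem r h1
  · rw [← (Pi.basisFun ℝ (Fin Λ.rank)).sum_repr m, map_sum, Finset.sum_mul]
    refine p.sum_mem fun i _ => ?_
    rw [map_smul, smul_mul_assoc, Pi.basisFun_apply]
    exact p.smul_mem _ (h i x hx)

/-- The range contains 1 and is stable under left multiplication by generators. A generator of Λ is
absorbed by the left factor; a generator of k moves past the left factor at the cost of the grading
involution. -/
theorem Gr.mulMap_surjective (Λ k : Gr) : Function.Surjective (Λ.mulMap k) := by
  have hm : ∀ z, z ∈ LinearMap.range (Λ.mulMap k) := by
    refine Gr.gen_induction ⟨1 ⊗ₜ 1, by rw [Gr.mulMap_tmul, map_one, map_one, mul_one]⟩ ?_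
    rintro i _ ⟨y, rfl⟩
    induction y with
    | zero => rw [map_zero, mul_zero]; exact Submodule.zero_mem _
    | add x y hx hy => rw [map_add, mul_add]; exact Submodule.add_mem _ hx hy
    | tmul a b =>
      refine Gr.extCases (C := fun i => ((Λ.ext k).gen i).1 * Λ.mulMap k (a ⊗ₜ b) ∈
        LinearMap.range (Λ.mulMap k)) (fun i => ?_) (fun i => ?_) i
      · refine ⟨((Λ.gen i).1 * a) ⊗ₜ b, ?_⟩
        rw [Gr.mulMap_tmul, Gr.mulMap_tmul, map_mul, Gr.inl_gen, mul_assoc]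
      · refine ⟨grassInv Λ a ⊗ₜ ((k.gen i).1 * b), ?_⟩
        rw [Gr.mulMap_tmul, Gr.mulMap_tmul, map_mul, Gr.inr_gen, ← mul_assoc, ← mul_assoc,
          GrHom.map_inv, Gr.gen_mul]
  exact hm

theorem Gr.finrank_grass (Λ : Gr) : Module.finrank ℝ (Grass Λ) = 2 ^ Λ.rank := by
  rw [Module.finrank_eq_card_basis (Module.Basis.ExteriorAlgebra (Pi.basisFun ℝ (Fin Λ.rank)))]
  simp

/-- The isomorphism `Λ ⊗ k ≅ Λ.ext k` of vector spaces. -/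
noncomputable def Gr.mulEquiv (Λ k : Gr) : Grass Λ ⊗[ℝ] Grass k ≃ₗ[ℝ] Grass (Λ.ext k) :=
  LinearEquiv.ofBijective (Λ.mulMap k) (by
    -- Both sides have dimension 2 to the sum of the ranks, so surjectivity already gives
    -- bijectivity.
    have h : Module.finrank ℝ (Grass Λ ⊗[ℝ] Grass k) = Module.finrank ℝ (Grass (Λ.ext k)) := by
      rw [Module.finrank_tensorProduct, Gr.finrank_grass, Gr.finrank_grass, Gr.finrank_grass,
        ← pow_add]
      rfl
    exact ⟨(LinearMap.injective_iff_surjective_of_finrank_eq_finrank h).2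
      (Λ.mulMap_surjective k), Λ.mulMap_surjective k⟩)

theorem Gr.ext_linearMap {Λ k : Gr} {X : Type*} [AddCommGroup X] [Module ℝ X]
    {f g : Grass (Λ.ext k) →ₗ[ℝ] X}
    (h : ∀ a b, f ((Λ.inl k).toAlgHom a * (Λ.inr k).toAlgHom b) =
      g ((Λ.inl k).toAlgHom a * (Λ.inr k).toAlgHom b)) : f = g := by
  have h1 : f ∘ₗ Λ.mulMap k = g ∘ₗ Λ.mulMap k := TensorProduct.ext' h
  refine LinearMap.ext fun z => ?_
  obtain ⟨y, rfl⟩ := Λ.mulMap_surjective k z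
  exact LinearMap.congr_fun h1 y

/-- The coefficient map `id ⊗ l : Λ.ext k = Λ ⊗ k → Λ`. -/
noncomputable def Gr.coef (Λ : Gr) {k : Gr} (l : Module.Dual ℝ (Grass k)) :
    Grass (Λ.ext k) →ₗ[ℝ] Grass Λ :=
  (TensorProduct.rid ℝ (Grass Λ)).toLinearMap ∘ₗ l.lTensor (Grass Λ) ∘ₗ
    (Λ.mulEquiv k).symm.toLinearMap

@[simp]
theorem Gr.coef_mul (Λ : Gr) {k : Gr} (l : Module.Dual ℝ (Grass k)) (a : Grass Λ) (b : Grass k) :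
    Λ.coef l ((Λ.inl k).toAlgHom a * (Λ.inr k).toAlgHom b) = l b • a := by
  have h : (Λ.mulEquiv k).symm ((Λ.inl k).toAlgHom a * (Λ.inr k).toAlgHom b) = a ⊗ₜ b :=
    (Λ.mulEquiv k).symm_apply_eq.2 rfl
  simp [Gr.coef, h]

/-- Elements of Λ stand on the left and those of k on the right, so reading off a coefficient in k
commutes with left multiplication by Λ. This is what makes the derivatives of coefficients linear
over the even part of Λ. -/
theorem Gr.coef_inl_mul (Λ : Gr) {k : Gr} (l : Module.Dual ℝ (Grass k)) (a : Grass Λ)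
    (z : Grass (Λ.ext k)) : Λ.coef l ((Λ.inl k).toAlgHom a * z) = a * Λ.coef l z := by
  have h : Λ.coef l ∘ₗ LinearMap.mulLeft ℝ ((Λ.inl k).toAlgHom a) =
      LinearMap.mulLeft ℝ a ∘ₗ Λ.coef l := by
    refine Gr.ext_linearMap fun b c => ?_
    simp only [LinearMap.comp_apply, LinearMap.mulLeft_apply]
    rw [← mul_assoc, ← map_mul, Gr.coef_mul, Gr.coef_mul, mul_smul_comm]
  exact LinearMap.congr_fun h z

/-- Under the linear identification with Λ ⊗ k the morphism `Gr.extMap φ k` is φ ⊗ id, which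
commutes with id ⊗ l. Naturality of the coefficients of a section comes from here. -/
theorem Gr.coef_extMap {Λ Λ' : Gr} (φ : Λ ⟶ Λ') {k : Gr} (l : Module.Dual ℝ (Grass k)) :
    Λ'.coef l ∘ₗ (Gr.extMap φ k).toAlgHom.toLinearMap = φ.toAlgHom.toLinearMap ∘ₗ Λ.coef l := by
  refine Gr.ext_linearMap fun a b => ?_
  simp only [LinearMap.comp_apply, AlgHom.toLinearMap_apply, map_mul, Gr.coef_mul, map_smul]
  rw [Gr.extMap, Gr.desc_inl, Gr.desc_inr]
  exact Gr.coef_mul _ _ _ _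

/-- A functional on a homogeneous part, extended by zero. -/
noncomputable def extendDual {k : Gr} {i : ZMod 2} (l : Module.Dual ℝ (GrassPart k i)) :
    Module.Dual ℝ (Grass k) := l ∘ₗ grassProj k i

theorem extendDual_coe {k : Gr} {i : ZMod 2} (l : Module.Dual ℝ (GrassPart k i))
    (x : GrassPart k i) : extendDual l x.1 = l x :=
  congrArg l (grassProj_coe x)

theorem extendDual_odd {k : Gr} (l : Module.Dual ℝ (GrassPart k 0)) (x : GrassPart k 1) :
    extendDual l x.1 = 0 :=
  (congrArg l (grassProj_zero_odd x)).trans (map_zero l)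

theorem extendDual_even {k : Gr} (l : Module.Dual ℝ (GrassPart k 1)) (x : GrassPart k 0) :
    extendDual l x.1 = 0 :=
  (congrArg l (grassProj_one_even x)).trans (map_zero l)

theorem Gr.inv_mul (Λ k : Gr) (a : Grass Λ) (b : Grass k) :
    grassInv (Λ.ext k) ((Λ.inl k).toAlgHom a * (Λ.inr k).toAlgHom b) =
      (Λ.inl k).toAlgHom (grassInv Λ a) * (Λ.inr k).toAlgHom (grassInv k b) := by
  rw [map_mul, GrHom.map_inv, GrHom.map_inv]

/-- The extended functional kills the odd part of k, so in a product ab only the even part of b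
contributes, and removing it does not change parity. -/
theorem Gr.coef_isEvenMap (Λ : Gr) {k : Gr} (l : Module.Dual ℝ (GrassPart k 0)) :
    IsEvenMap (Λ.coef (extendDual l)) := by
  have h : Λ.coef (extendDual l) ∘ₗ (grassInv (Λ.ext k)).toLinearMap =
      (grassInv Λ).toLinearMap ∘ₗ Λ.coef (extendDual l) := by
    refine Gr.ext_linearMap fun a b => ?_
    simp only [LinearMap.comp_apply, AlgHom.toLinearMap_apply, Gr.inv_mul, Gr.coef_mul, map_smul]
    congr 1
    rw [← grassProj_add b, map_add, map_add, map_add, grassInv_even, grassInv_odd, map_neg,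
      extendDual_odd, neg_zero]
  exact LinearMap.congr_fun h

/-- Only the odd part of b contributes, and removing it changes parity. This is the origin of ΠW in
the result. -/
theorem Gr.coef_isOddMap (Λ : Gr) {k : Gr} (l : Module.Dual ℝ (GrassPart k 1)) :
    IsOddMap (Λ.coef (extendDual l)) := by
  have h : Λ.coef (extendDual l) ∘ₗ (grassInv (Λ.ext k)).toLinearMap =
      -(grassInv Λ).toLinearMap ∘ₗ Λ.coef (extendDual l) := by
    refine Gr.ext_linearMap fun a b => ?_
    simp only [LinearMap.comp_apply, AlgHom.toLinearMap_apply, Gr.inv_mul, Gr.coef_mul, map_smul,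
      LinearMap.neg_apply]
    rw [← neg_smul]
    congr 1
    rw [← grassProj_add b, map_add, map_add, map_add, grassInv_even, grassInv_odd, map_neg,
      extendDual_even, zero_add, zero_add]
  exact LinearMap.congr_fun h

/-- Right multiplication. -/
noncomputable def Gr.rmul (Λ : Gr) : Grass Λ →ₗ[ℝ] Grass Λ →ₗ[ℝ] Grass Λ :=
  (LinearMap.mul ℝ (Grass Λ)).flip

@[simp]
theorem Gr.rmul_apply (Λ : Gr) (a x : Grass Λ) : Λ.rmul a x = x * a := rfl

theorem Gr.rmul_isEvenMap {Λ : Gr} (a : GrassPart Λ 0) : IsEvenMap (Λ.rmul a.1) := fun x => by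
  rw [Gr.rmul_apply, Gr.rmul_apply, map_mul, grassInv_even]

theorem Gr.rmul_isOddMap {Λ : Gr} (a : GrassPart Λ 1) : IsOddMap (Λ.rmul a.1) := fun x => by
  rw [Gr.rmul_apply, Gr.rmul_apply, map_mul, grassInv_odd, mul_neg, neg_neg]

instance (Λ : Gr) (i : ZMod 2) : Module.Finite ℝ (GrassPart Λ i) :=
  inferInstanceAs (Module.Finite ℝ ↥(CliffordAlgebra.evenOdd _ i))

/-- A basis of a homogeneous part. -/
noncomputable def partBasis (Λ : Gr) (i : ZMod 2) :
    Module.Basis (Fin (Module.finrank ℝ (GrassPart Λ i))) ℝ (GrassPart Λ i) :=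
  Module.finBasis ℝ _

theorem partBasis_sum {Λ : Gr} {i : ZMod 2} (x : GrassPart Λ i) :
    ∑ J, (partBasis Λ i).coord J x • (partBasis Λ i J) = x :=
  (partBasis Λ i).sum_repr x

theorem partBasis_sum_val {Λ : Gr} {i : ZMod 2} (x : Grass Λ) :
    ∑ J, extendDual ((partBasis Λ i).coord J) x • (partBasis Λ i J).1 = (grassProj Λ i x).1 := by
  conv_rhs => rw [← partBasis_sum (grassProj Λ i x), ← GrassPart.val_apply, map_sum]
  rfl

/-- The expansion of the evaluation at a point of a superpoint. -/
theorem Gr.desc_eq_sum {Λ k : Gr} (η : k ⟶ Λ) : (Gr.desc (𝟙 Λ) η).toAlgHom.toLinearMap =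
    ∑ J, Λ.rmul (η.toAlgHom (partBasis k 0 J).1) ∘ₗ
        Λ.coef (extendDual ((partBasis k 0).coord J)) +
      ∑ J, Λ.rmul (η.toAlgHom (partBasis k 1 J).1) ∘ₗ
        Λ.coef (extendDual ((partBasis k 1).coord J)) := by
  refine Gr.ext_linearMap fun a b => ?_
  simp only [LinearMap.add_apply, LinearMap.sum_apply, LinearMap.comp_apply,
    AlgHom.toLinearMap_apply, Gr.coef_mul, Gr.rmul_apply, map_mul, Gr.desc_inl, Gr.desc_inr]
  simp only [smul_mul_assoc, ← mul_smul_comm, ← Finset.mul_sum, ← map_smul, ← map_sum,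
    partBasis_sum_val]
  -- The two sums have become a times η of the even part of b and a times η of the odd part of b.
  rw [← mul_add, ← map_add, grassProj_add]
  rfl

/-! ### Maps between `Λ`-points of a model space given by linear maps of Grassmann algebras -/

/-- The map of homogeneous parts induced by a linear map of Grassmann algebras. -/
noncomputable def partMap {Λ Λ' : Gr} (i j : ZMod 2) (A : Grass Λ →ₗ[ℝ] Grass Λ') :
    GrassPart Λ i →ₗ[ℝ] GrassPart Λ' j :=
  grassProj Λ' j ∘ₗ A ∘ₗ GrassPart.val Λ i

/-- The projection to parity `j` in the middle changes nothing, because A already takes values of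
that parity. -/
theorem partMap_partMap {Λ Λ' Λ'' : Gr} {i j k : ZMod 2} (B : Grass Λ' →ₗ[ℝ] Grass Λ'')
    {A : Grass Λ →ₗ[ℝ] Grass Λ'} (hA : ∀ x : GrassPart Λ i, A x.1 ∈
      CliffordAlgebra.evenOdd (0 : QuadraticForm ℝ (Fin Λ'.rank → ℝ)) j) :
    partMap j k B ∘ₗ partMap i j A = partMap i k (B ∘ₗ A) := by
  refine LinearMap.ext fun x => ?_
  have h : (grassProj Λ' j (A x.1)).1 = A x.1 := congrArg Subtype.val (grassProj_coe ⟨_, hA x⟩)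
  change grassProj Λ'' k (B (grassProj Λ' j (A x.1)).1) = grassProj Λ'' k (B (A x.1))
  rw [h]

theorem partMap_toAlgHom {Λ Λ' : Gr} (φ : Λ ⟶ Λ') (i : ZMod 2) :
    partMap i i φ.toAlgHom.toLinearMap = GrHom.part φ i :=
  LinearMap.ext fun x => grassProj_coe (GrHom.part φ i x)

theorem IsEvenMap.mem_zero {Λ Λ' : Gr} {A : Grass Λ →ₗ[ℝ] Grass Λ'} (hA : IsEvenMap A)
    (x : GrassPart Λ 0) :
    A x.1 ∈ CliffordAlgebra.evenOdd (0 : QuadraticForm ℝ (Fin Λ'.rank → ℝ)) 0 :=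
  mem_even_iff.2 (by rw [← hA, grassInv_even])

theorem IsEvenMap.mem_one {Λ Λ' : Gr} {A : Grass Λ →ₗ[ℝ] Grass Λ'} (hA : IsEvenMap A)
    (x : GrassPart Λ 1) :
    A x.1 ∈ CliffordAlgebra.evenOdd (0 : QuadraticForm ℝ (Fin Λ'.rank → ℝ)) 1 :=
  mem_odd_iff.2 (by rw [← hA, grassInv_odd, map_neg])

theorem IsOddMap.mem_one {Λ Λ' : Gr} {A : Grass Λ →ₗ[ℝ] Grass Λ'} (hA : IsOddMap A)
    (x : GrassPart Λ 0) :
    A x.1 ∈ CliffordAlgebra.evenOdd (0 : QuadraticForm ℝ (Fin Λ'.rank → ℝ)) 1 :=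
  mem_odd_iff.2 (by rw [← neg_eq_iff_eq_neg, ← hA, grassInv_even])

theorem IsOddMap.mem_zero {Λ Λ' : Gr} {A : Grass Λ →ₗ[ℝ] Grass Λ'} (hA : IsOddMap A)
    (x : GrassPart Λ 1) :
    A x.1 ∈ CliffordAlgebra.evenOdd (0 : QuadraticForm ℝ (Fin Λ'.rank → ℝ)) 0 :=
  mem_even_iff.2 (by rw [← neg_inj, ← hA, grassInv_odd, map_neg])

theorem partMap_add {Λ Λ' : Gr} (i j : ZMod 2) (A B : Grass Λ →ₗ[ℝ] Grass Λ') :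
    partMap i j (A + B) = partMap i j A + partMap i j B :=
  LinearMap.ext fun x => map_add (grassProj Λ' j) (A x.1) (B x.1)

theorem partMap_smul {Λ Λ' : Gr} (i j : ZMod 2) (r : ℝ) (A : Grass Λ →ₗ[ℝ] Grass Λ') :
    partMap i j (r • A) = r • partMap i j A :=
  LinearMap.ext fun x => map_smul (grassProj Λ' j) r (A x.1)

section

variable (W : TopSVect.{v}) {Λ Λ' Λ'' : Gr}

/-- The map `A ⊗ id` on `W̄`, for a parity-preserving map `A`. -/
noncomputable def barLin :
    (Grass Λ →ₗ[ℝ] Grass Λ') →ₗ[ℝ] W.Bar Λ →ₗ[ℝ] W.Bar Λ' :=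
  LinearMap.mk₂ ℝ (fun A x => (((partMap 0 0 A).rTensor W.even x.1,
    (partMap 1 1 A).rTensor W.odd x.2) : W.Bar Λ'))
    (fun A B x => SVect.bar_ext
      (by simp only [partMap_add, LinearMap.rTensor_add]; rfl)
      (by simp only [partMap_add, LinearMap.rTensor_add]; rfl))
    (fun r A x => SVect.bar_ext
      (by simp only [partMap_smul, LinearMap.rTensor_smul]; rfl)
      (by simp only [partMap_smul, LinearMap.rTensor_smul]; rfl))
    (fun A x y => SVect.bar_ext (map_add _ x.1 y.1) (map_add _ x.2 y.2))
    (fun r A x => SVect.bar_ext (map_smul _ r x.1) (map_smul _ r x.2))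

/-- The map `A ⊗ id` from `W̄` to the bar-construction of `ΠW`, for a parity-reversing map `A`. -/
noncomputable def barFlip :
    (Grass Λ →ₗ[ℝ] Grass Λ') →ₗ[ℝ] W.Bar Λ →ₗ[ℝ] W.parity.Bar Λ' :=
  LinearMap.mk₂ ℝ (fun A x => (((partMap 1 0 A).rTensor W.odd x.2,
    (partMap 0 1 A).rTensor W.even x.1) : W.parity.Bar Λ'))
    (fun A B x => SVect.bar_ext
      (by simp only [partMap_add, LinearMap.rTensor_add]; rfl)
      (by simp only [partMap_add, LinearMap.rTensor_add]; rfl))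
    (fun r A x => SVect.bar_ext
      (by simp only [partMap_smul, LinearMap.rTensor_smul]; rfl)
      (by simp only [partMap_smul, LinearMap.rTensor_smul]; rfl))
    (fun A x y => SVect.bar_ext (map_add _ x.2 y.2) (map_add _ x.1 y.1))
    (fun r A x => SVect.bar_ext (map_smul _ r x.2) (map_smul _ r x.1))

/-- The map `A ⊗ id` from the bar-construction of `ΠW` to `W̄`, for a parity-reversing map `A`. -/
noncomputable def barUnflip :
    (Grass Λ →ₗ[ℝ] Grass Λ') →ₗ[ℝ] W.parity.Bar Λ →ₗ[ℝ] W.Bar Λ' :=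
  LinearMap.mk₂ ℝ (fun A x => (((partMap 1 0 A).rTensor W.even x.2,
    (partMap 0 1 A).rTensor W.odd x.1) : W.Bar Λ'))
    (fun A B x => SVect.bar_ext
      (by simp only [partMap_add, LinearMap.rTensor_add]; rfl)
      (by simp only [partMap_add, LinearMap.rTensor_add]; rfl))
    (fun r A x => SVect.bar_ext
      (by simp only [partMap_smul, LinearMap.rTensor_smul]; rfl)
      (by simp only [partMap_smul, LinearMap.rTensor_smul]; rfl))
    (fun A x y => SVect.bar_ext (map_add _ x.2 y.2) (map_add _ x.1 y.1))
    (fun r A x => SVect.bar_ext (map_smul _ r x.2) (map_smul _ r x.1))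

/-- The common source of the composition rules that follow. Only the inner map needs a definite
parity; the components of the outer map of the wrong parity are projected away on both sides. -/
theorem rTensor_partMap {i j k : ZMod 2} {X : Type v} [AddCommGroup X] [Module ℝ X]
    (B : Grass Λ' →ₗ[ℝ] Grass Λ'') {A : Grass Λ →ₗ[ℝ] Grass Λ'} (hA : ∀ x : GrassPart Λ i,
      A x.1 ∈ CliffordAlgebra.evenOdd (0 : QuadraticForm ℝ (Fin Λ'.rank → ℝ)) j)
    (x : GrassPart Λ i ⊗[ℝ] X) : (partMap j k B).rTensor X ((partMap i j A).rTensor X x) =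
      (partMap i k (B ∘ₗ A)).rTensor X x := by
  rw [← partMap_partMap B hA, LinearMap.rTensor_comp]
  rfl

theorem barLin_barLin (B : Grass Λ' →ₗ[ℝ] Grass Λ'') {A : Grass Λ →ₗ[ℝ] Grass Λ'}
    (hA : IsEvenMap A) (x : W.Bar Λ) : barLin W B (barLin W A x) = barLin W (B ∘ₗ A) x :=
  SVect.bar_ext (rTensor_partMap B hA.mem_zero x.1) (rTensor_partMap B hA.mem_one x.2)

theorem barFlip_barLin (B : Grass Λ' →ₗ[ℝ] Grass Λ'') {A : Grass Λ →ₗ[ℝ] Grass Λ'}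
    (hA : IsEvenMap A) (x : W.Bar Λ) : barFlip W B (barLin W A x) = barFlip W (B ∘ₗ A) x :=
  SVect.bar_ext (rTensor_partMap B hA.mem_one x.2) (rTensor_partMap B hA.mem_zero x.1)

theorem barUnflip_barLin (B : Grass Λ' →ₗ[ℝ] Grass Λ'') {A : Grass Λ →ₗ[ℝ] Grass Λ'}
    (hA : IsEvenMap A) (x : W.parity.Bar Λ) :
    barUnflip W B (barLin W.parity A x) = barUnflip W (B ∘ₗ A) x :=
  SVect.bar_ext (rTensor_partMap B hA.mem_one x.2) (rTensor_partMap B hA.mem_zero x.1)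

theorem barLin_barFlip (B : Grass Λ' →ₗ[ℝ] Grass Λ'') {A : Grass Λ →ₗ[ℝ] Grass Λ'}
    (hA : IsOddMap A) (x : W.Bar Λ) :
    barLin W.parity B (barFlip W A x) = barFlip W (B ∘ₗ A) x :=
  SVect.bar_ext (rTensor_partMap B hA.mem_zero x.2) (rTensor_partMap B hA.mem_one x.1)

theorem barLin_barUnflip (B : Grass Λ' →ₗ[ℝ] Grass Λ'') {A : Grass Λ →ₗ[ℝ] Grass Λ'}
    (hA : IsOddMap A) (x : W.parity.Bar Λ) :
    barLin W B (barUnflip W A x) = barUnflip W (B ∘ₗ A) x :=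
  SVect.bar_ext (rTensor_partMap B hA.mem_zero x.2) (rTensor_partMap B hA.mem_one x.1)

theorem barUnflip_barFlip (B : Grass Λ' →ₗ[ℝ] Grass Λ'') {A : Grass Λ →ₗ[ℝ] Grass Λ'}
    (hA : IsOddMap A) (x : W.Bar Λ) :
    barUnflip W B (barFlip W A x) = barLin W (B ∘ₗ A) x :=
  SVect.bar_ext (rTensor_partMap B hA.mem_one x.1) (rTensor_partMap B hA.mem_zero x.2)

theorem barFlip_barUnflip (B : Grass Λ' →ₗ[ℝ] Grass Λ'') {A : Grass Λ →ₗ[ℝ] Grass Λ'}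
    (hA : IsOddMap A) (x : W.parity.Bar Λ) :
    barFlip W B (barUnflip W A x) = barLin W.parity (B ∘ₗ A) x :=
  SVect.bar_ext (rTensor_partMap B hA.mem_one x.1) (rTensor_partMap B hA.mem_zero x.2)

theorem barLin_toAlgHom (φ : Λ ⟶ Λ') (x : W.Bar Λ) :
    barLin W φ.toAlgHom.toLinearMap x = W.barMap φ x :=
  SVect.bar_ext
    (congrArg (fun f => LinearMap.rTensor W.even f x.1) (partMap_toAlgHom φ 0))
    (congrArg (fun f => LinearMap.rTensor W.odd f x.2) (partMap_toAlgHom φ 1))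

theorem barLin_id (x : W.Bar Λ) : barLin W LinearMap.id x = x :=
  (barLin_toAlgHom W (𝟙 Λ) x).trans (W.barMap_id Λ x)

theorem smul_eq_rTensor {i : ZMod 2} {X : Type v} [AddCommGroup X] [Module ℝ X]
    (a : GrassEven Λ) (x : GrassPart Λ i ⊗[ℝ] X) :
    (partMap i i (LinearMap.mulLeft ℝ a.1)).rTensor X x = a • x := by
  induction x with
  | zero => simp
  | add x y hx hy => rw [map_add, hx, hy, smul_add]
  | tmul x y =>
    rw [LinearMap.rTensor_tmul, TensorProduct.smul_tmul']
    congr 1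
    exact grassProj_coe (a • x)

/-- Scalar multiplication is itself of the form A ⊗ id, so semilinearity statements about W̄ reduce
to identities between linear maps of Grassmann algebras. -/
theorem barLin_mulLeft (a : GrassEven Λ) (x : W.Bar Λ) :
    barLin W (LinearMap.mulLeft ℝ a.1) x = a • x :=
  SVect.bar_ext (smul_eq_rTensor a x.1) (smul_eq_rTensor a x.2)

theorem mulLeft_eq_rmul (a : GrassEven Λ) : LinearMap.mulLeft ℝ a.1 = Λ.rmul a.1 :=
  LinearMap.ext fun x => grass_even_comm a x

theorem mulLeft_isEvenMap (a : GrassEven Λ) :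
    IsEvenMap (LinearMap.mulLeft ℝ a.1 : Grass Λ →ₗ[ℝ] Grass Λ) := by
  rw [mulLeft_eq_rmul]
  exact Gr.rmul_isEvenMap (⟨a.1, a.2⟩ : GrassPart Λ 0)

/-- Semilinearity of `A ⊗ id`. -/
theorem barLin_smul {A : Grass Λ →ₗ[ℝ] Grass Λ'} (hA : IsEvenMap A) {a : GrassEven Λ}
    {a' : GrassEven Λ'} (h : ∀ x, A (a.1 * x) = a'.1 * A x) (x : W.Bar Λ) :
    barLin W A (a • x) = a' • barLin W A x := by
  rw [← barLin_mulLeft, ← barLin_mulLeft, barLin_barLin W _ (mulLeft_isEvenMap a),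
    barLin_barLin W _ hA]
  congr 2
  exact LinearMap.ext h

theorem barFlip_smul {A : Grass Λ →ₗ[ℝ] Grass Λ'} (hA : IsOddMap A) {a : GrassEven Λ}
    {a' : GrassEven Λ'} (h : ∀ x, A (a.1 * x) = a'.1 * A x) (x : W.Bar Λ) :
    barFlip W A (a • x) = a' • barFlip W A x := by
  rw [← barLin_mulLeft, ← barLin_mulLeft, barFlip_barLin W _ (mulLeft_isEvenMap a),
    barLin_barFlip W _ hA]
  congr 2
  exact LinearMap.ext h

theorem barUnflip_smul {A : Grass Λ →ₗ[ℝ] Grass Λ'} (hA : IsOddMap A) {a : GrassEven Λ}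
    {a' : GrassEven Λ'} (h : ∀ x, A (a.1 * x) = a'.1 * A x) (x : W.parity.Bar Λ) :
    barUnflip W A (a • x) = a' • barUnflip W A x := by
  rw [← barLin_mulLeft, ← barLin_mulLeft, barUnflip_barLin W _ (mulLeft_isEvenMap a),
    barLin_barUnflip W _ hA]
  congr 2
  exact LinearMap.ext h

theorem continuous_rTensor {i j : ZMod 2} {X : Type v} [AddCommGroup X] [Module ℝ X]
    [TopologicalSpace X] (f : GrassPart Λ i →ₗ[ℝ] GrassPart Λ' j) : Continuous (f.rTensor X) := by
  refine continuous_to_tensor fun l => ?_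
  have h : ∀ x, slice X l (f.rTensor X x) = slice X (l ∘ₗ f) x := by
    intro x
    induction x with
    | zero => simp
    | add x y hx hy => simp only [map_add, hx, hy]
    | tmul x y => simp
  simp only [h]
  exact continuous_slice _

theorem continuous_barLin (A : Grass Λ →ₗ[ℝ] Grass Λ') : Continuous (barLin W A) :=
  Continuous.prodMap (continuous_rTensor (partMap 0 0 A)) (continuous_rTensor (partMap 1 1 A))

theorem continuous_barFlip (A : Grass Λ →ₗ[ℝ] Grass Λ') : Continuous (barFlip W A) :=
  Continuous.prodMk ((continuous_rTensor (partMap 1 0 A)).comp continuous_snd)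
    ((continuous_rTensor (partMap 0 1 A)).comp continuous_fst)

theorem continuous_barUnflip (A : Grass Λ →ₗ[ℝ] Grass Λ') : Continuous (barUnflip W A) :=
  Continuous.prodMk ((continuous_rTensor (partMap 1 0 A)).comp continuous_snd)
    ((continuous_rTensor (partMap 0 1 A)).comp continuous_fst)

/-- `barLin` as a continuous linear map. -/
noncomputable def barLinL (A : Grass Λ →ₗ[ℝ] Grass Λ') : W.Bar Λ →L[ℝ] W.Bar Λ' :=
  ⟨barLin W A, continuous_barLin W A⟩

/-- `barFlip` as a continuous linear map. -/
noncomputable def barFlipL (A : Grass Λ →ₗ[ℝ] Grass Λ') : W.Bar Λ →L[ℝ] W.parity.Bar Λ' :=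
  ⟨barFlip W A, continuous_barFlip W A⟩

end

/-! ### Slices -/

/-- Finite-dimensionality of Λ enters here: a tensor is rebuilt from finitely many of its slices.
Sections will be glued slice by slice. -/
theorem tensor_eq_sum_slice {Λ : Gr} {i : ZMod 2} {X : Type v} [AddCommGroup X] [Module ℝ X]
    (z : GrassPart Λ i ⊗[ℝ] X) :
    ∑ J, partBasis Λ i J ⊗ₜ[ℝ] slice X ((partBasis Λ i).coord J) z = z := by
  induction z with
  | zero => simp
  | add x y hx hy =>
    conv_rhs => rw [← hx, ← hy]
    simp only [map_add, TensorProduct.tmul_add, Finset.sum_add_distrib]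
  | tmul a v =>
    simp only [slice_tmul, ← TensorProduct.smul_tmul, ← TensorProduct.sum_tmul, partBasis_sum]

theorem tensor_eq_zero_of_slice {Λ : Gr} {i : ZMod 2} {X : Type v} [AddCommGroup X] [Module ℝ X]
    {z : GrassPart Λ i ⊗[ℝ] X} (h : ∀ l, slice X l z = 0) : z = 0 := by
  rw [← tensor_eq_sum_slice z]
  simp [h]

/-- The slices are continuous with values in a Hausdorff space, and together they separate points.
-/
instance {Λ : Gr} {i : ZMod 2} {X : Type v} [AddCommGroup X] [Module ℝ X] [TopologicalSpace X]
    [T2Space X] : T2Space (GrassPart Λ i ⊗[ℝ] X) := by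
  refine T2Space.of_injective_continuous (f := fun z => fun l => slice X l z) (fun x y h => ?_)
    (continuous_pi fun l => continuous_slice l)
  refine sub_eq_zero.1 (tensor_eq_zero_of_slice fun l => ?_)
  rw [map_sub, sub_eq_zero]
  exact congrFun h l

instance (W : TopSVect.{v}) (Λ : Gr) : T2Space (W.Bar Λ) :=
  inferInstanceAs (T2Space ((GrassPart Λ 0 ⊗[ℝ] W.even) × (GrassPart Λ 1 ⊗[ℝ] W.odd)))

/-! ### Points with values in Grassmann algebras of rank at most one -/

abbrev Gr.zero : Gr := ⟨0⟩

abbrev Gr.one : Gr := ⟨1⟩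

/-- The unit `ℝ → Λ`. -/
noncomputable def Gr.unit (Λ : Gr) : Gr.zero ⟶ Λ := Gr.ofGens fun i => i.elim0

theorem Gr.unit_unique {Λ : Gr} (η η' : Gr.zero ⟶ Λ) : η = η' := grHom_ext_gen fun i => i.elim0

/-- The generator of the Grassmann algebra of rank one. -/
noncomputable def Gr.theta : GrassPart Gr.one 1 := Gr.one.gen 0

/-- The morphism that sends the generator to `a`. -/
noncomputable def Gr.pt {Λ : Gr} (a : GrassPart Λ 1) : Gr.one ⟶ Λ := Gr.ofGens fun _ => a

@[simp]
theorem Gr.pt_theta {Λ : Gr} (a : GrassPart Λ 1) : GrHom.part (Gr.pt a) 1 Gr.theta = a :=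
  Gr.ofGens_gen _ _

theorem Gr.one_hom_ext {Λ : Gr} {η η' : Gr.one ⟶ Λ}
    (h : GrHom.part η 1 Gr.theta = GrHom.part η' 1 Gr.theta) : η = η' :=
  grHom_ext_gen fun i => by
    obtain rfl : i = 0 := Subsingleton.elim _ _
    exact h

theorem Gr.pt_comp {Λ Λ' : Gr} (a : GrassPart Λ 1) (φ : Λ ⟶ Λ') :
    Gr.pt a ≫ φ = Gr.pt (GrHom.part φ 1 a) :=
  Gr.one_hom_ext (by rw [GrHom.part_comp, Gr.pt_theta, Gr.pt_theta])

/-! ### The comparison with a bar-construction -/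

/-- The real scalars. -/
noncomputable def realToEven (Λ : Gr) : ℝ →+* GrassEven Λ :=
  algebraMap ℝ ↥(CliffordAlgebra.even (0 : QuadraticForm ℝ (Fin Λ.rank → ℝ)))

theorem realToEven_val {Λ : Gr} (r : ℝ) : (realToEven Λ r).1 = algebraMap ℝ (Grass Λ) r := rfl

theorem even_realToEven {Λ Λ' : Gr} (φ : Λ ⟶ Λ') (r : ℝ) :
    GrHom.even φ (realToEven Λ r) = realToEven Λ' r :=
  Subtype.ext (φ.toAlgHom.commutes r)

/-- The given structure is over the even part of Λ only; real scalars act through it, so that tensor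
products over ℝ can be formed. -/
noncomputable instance RBarMod.realModule (X : RBarMod.{u}) (Λ : Gr) : Module ℝ (X.obj Λ) :=
  Module.compHom _ (realToEven Λ)

theorem RBarMod.real_smul_def (X : RBarMod.{u}) {Λ : Gr} (r : ℝ) (x : X.obj Λ) :
    r • x = realToEven Λ r • x := rfl

/-- `X(φ)` as a linear map of real vector spaces. -/
noncomputable def RBarMod.mapR (X : RBarMod.{u}) {Λ Λ' : Gr} (φ : Λ ⟶ Λ') :
    X.obj Λ →ₗ[ℝ] X.obj Λ' where
  toFun := X.map φ
  map_add' := map_add _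
  map_smul' r x := by
    rw [RBarMod.real_smul_def, LinearMap.map_smulₛₗ, even_realToEven]
    rfl

/-- A component of a morphism as a linear map of real vector spaces. -/
noncomputable def RBarMod.Hom.appR {X : RBarMod.{u}} {Y : RBarMod.{v}} (f : RBarMod.Hom X Y)
    (Λ : Gr) : X.obj Λ →ₗ[ℝ] Y.obj Λ where
  toFun := f.app Λ
  map_add' := map_add _
  map_smul' r x := map_smul (f.app Λ) (realToEven Λ r) x

/-- The elements of `X(Λ_1)` that are killed by the augmentation. -/
noncomputable def RBarMod.oddPart (X : RBarMod.{u}) : Submodule ℝ (X.obj Gr.one) :=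
  LinearMap.ker (X.mapR (Gr.pt (0 : GrassPart Gr.zero 1)))

theorem RBarMod.mem_oddPart {X : RBarMod.{u}} {x : X.obj Gr.one} :
    x ∈ X.oddPart ↔ X.map (Gr.pt (0 : GrassPart Gr.zero 1)) x = 0 := Iff.rfl

/-- The super vector space that represents `X`, if `X` is superrepresentable. -/
noncomputable def RBarMod.super (X : RBarMod.{u}) : SVect.{u} where
  even := X.obj Gr.zero
  odd := X.oddPart

/-- Linearity of `X(Λ_1) → X(Λ)` in the odd parameter. -/
def RBarMod.OddLinear (X : RBarMod.{u}) : Prop :=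
  ∀ (Λ : Gr) (x : X.obj Gr.one), x ∈ X.oddPart →
    (∀ a b : GrassPart Λ 1, X.map (Gr.pt (a + b)) x = X.map (Gr.pt a) x + X.map (Gr.pt b) x) ∧
    ∀ (c : GrassEven Λ) (a : GrassPart Λ 1), X.map (Gr.pt (c • a)) x = c • X.map (Gr.pt a) x

/-- An even element as an element of the ring `GrassEven`. -/
def GrassPart.toEven {Λ : Gr} (a : GrassPart Λ 0) : GrassEven Λ := a

section Comparison

variable {X : RBarMod.{u}}

/-- The action of `Λ_0` on the image of `X(ℝ)`. -/
noncomputable def RBarMod.evenAct (X : RBarMod.{u}) (Λ : Gr) :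
    GrassPart Λ 0 ⊗[ℝ] X.obj Gr.zero →ₗ[ℝ] X.obj Λ :=
  TensorProduct.lift (LinearMap.mk₂ ℝ (fun a s => a.toEven • X.mapR Λ.unit s)
    (fun a b s => add_smul a.toEven b.toEven _)
    (fun r a s => by
      have h : (r • a).toEven = realToEven Λ r * a.toEven := Subtype.ext (Algebra.smul_def r a.1)
      rw [h, mul_smul]
      rfl)
    (fun a s t => by rw [map_add, smul_add])
    (fun r a s => by
      rw [map_smul, RBarMod.real_smul_def, RBarMod.real_smul_def, ← mul_smul, ← mul_smul,
        grassEven_comm]))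

theorem RBarMod.evenAct_tmul {Λ : Gr} (a : GrassPart Λ 0) (s : X.obj Gr.zero) :
    X.evenAct Λ (a ⊗ₜ s) = a.toEven • X.map Λ.unit s := rfl

/-- The action of `Λ_1` on the odd part of `X(Λ_1)`. -/
noncomputable def RBarMod.OddLinear.oddAct (hX : X.OddLinear) (Λ : Gr) :
    GrassPart Λ 1 ⊗[ℝ] X.oddPart →ₗ[ℝ] X.obj Λ :=
  TensorProduct.lift (LinearMap.mk₂ ℝ (fun a s => X.mapR (Gr.pt a) s.1)
    (fun a b s => (hX Λ s.1 s.2).1 a b)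
    (fun r a s => by
      have h : r • a = realToEven Λ r • a := Subtype.ext (Algebra.smul_def r a.1)
      rw [h]
      exact (hX Λ s.1 s.2).2 _ a)
    (fun a s t => map_add _ _ _)
    (fun r a s => map_smul _ _ _))

theorem RBarMod.OddLinear.oddAct_tmul (hX : X.OddLinear) {Λ : Gr} (a : GrassPart Λ 1)
    (s : X.oddPart) : hX.oddAct Λ (a ⊗ₜ s) = X.map (Gr.pt a) s.1 := rfl

theorem RBarMod.evenAct_smul {Λ : Gr} (c : GrassEven Λ) (z : GrassPart Λ 0 ⊗[ℝ] X.obj Gr.zero) :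
    X.evenAct Λ (c • z) = c • X.evenAct Λ z := by
  induction z with
  | zero => simp
  | add x y hx hy => rw [smul_add, map_add, hx, hy, map_add, smul_add]
  | tmul a s =>
    rw [TensorProduct.smul_tmul', RBarMod.evenAct_tmul, RBarMod.evenAct_tmul, ← mul_smul]
    rfl

theorem RBarMod.OddLinear.oddAct_smul (hX : X.OddLinear) {Λ : Gr} (c : GrassEven Λ)
    (z : GrassPart Λ 1 ⊗[ℝ] X.oddPart) : hX.oddAct Λ (c • z) = c • hX.oddAct Λ z := by
  induction z with
  | zero => simp
  | add x y hx hy => rw [smul_add, map_add, hx, hy, map_add, smul_add]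
  | tmul a s => exact (hX Λ s.1 s.2).2 c a

theorem RBarMod.evenAct_natural {Λ Λ' : Gr} (φ : Λ ⟶ Λ') (z : GrassPart Λ 0 ⊗[ℝ] X.obj Gr.zero) :
    X.evenAct Λ' ((GrHom.part φ 0).rTensor _ z) = X.map φ (X.evenAct Λ z) := by
  induction z with
  | zero => simp
  | add x y hx hy => rw [map_add, map_add, hx, hy, map_add, map_add]
  | tmul a s =>
    rw [LinearMap.rTensor_tmul, RBarMod.evenAct_tmul, RBarMod.evenAct_tmul, LinearMap.map_smulₛₗ,
      ← X.map_comp, Gr.unit_unique (Λ.unit ≫ φ) Λ'.unit]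
    rfl

theorem RBarMod.OddLinear.oddAct_natural (hX : X.OddLinear) {Λ Λ' : Gr} (φ : Λ ⟶ Λ')
    (z : GrassPart Λ 1 ⊗[ℝ] X.oddPart) :
    hX.oddAct Λ' ((GrHom.part φ 1).rTensor _ z) = X.map φ (hX.oddAct Λ z) := by
  induction z with
  | zero => simp
  | add x y hx hy => rw [map_add, map_add, hx, hy, map_add, map_add]
  | tmul a s =>
    rw [LinearMap.rTensor_tmul, oddAct_tmul, oddAct_tmul, ← X.map_comp, Gr.pt_comp]

/-- The comparison morphism from a bar-construction to `X`. -/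
noncomputable def RBarMod.OddLinear.comparison (hX : X.OddLinear) : X.super.bar ⟶ X where
  app Λ :=
    { toFun := fun z => X.evenAct Λ z.1 + hX.oddAct Λ z.2
      map_add' := fun x y => by
        have h1 : X.evenAct Λ (x.1 + y.1) = X.evenAct Λ x.1 + X.evenAct Λ y.1 := map_add _ _ _
        have h2 : hX.oddAct Λ (x.2 + y.2) = hX.oddAct Λ x.2 + hX.oddAct Λ y.2 := map_add _ _ _
        exact (congrArg₂ (· + ·) h1 h2).trans (add_add_add_comm _ _ _ _)
      map_smul' := fun c x => (congrArg₂ (· + ·) (RBarMod.evenAct_smul c x.1)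
        (hX.oddAct_smul c x.2)).trans (smul_add c _ _).symm }
  natural φ x := (congrArg₂ (· + ·) (RBarMod.evenAct_natural φ x.1)
    (hX.oddAct_natural φ x.2)).trans (map_add (X.map φ) _ _).symm

end Comparison

/-! ### Naturality of the comparison and its descent along coverings -/

section Morphisms

variable {X Y : RBarMod.{u}}

theorem RBarMod.map_mem_oddPart (f : X ⟶ Y) {x : X.obj Gr.one} (hx : x ∈ X.oddPart) :
    f.app Gr.one x ∈ Y.oddPart := by
  rw [RBarMod.mem_oddPart] at hx ⊢
  rw [← f.natural, hx, map_zero]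

/-- The map induced on odd parts. -/
noncomputable def RBarMod.oddMap (f : X ⟶ Y) : X.oddPart →ₗ[ℝ] Y.oddPart :=
  (f.appR Gr.one).restrict fun _ hx => RBarMod.map_mem_oddPart f hx

/-- The map induced on the bar-constructions. -/
noncomputable def RBarMod.superMap (f : X ⟶ Y) (Λ : Gr) (z : X.super.bar.obj Λ) :
    Y.super.bar.obj Λ :=
  (((f.appR Gr.zero).lTensor (GrassPart Λ 0) z.1,
    (RBarMod.oddMap f).lTensor (GrassPart Λ 1) z.2) : Y.super.Bar Λ)

theorem RBarMod.evenAct_lTensor (f : X ⟶ Y) {Λ : Gr} (z : GrassPart Λ 0 ⊗[ℝ] X.obj Gr.zero) :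
    Y.evenAct Λ ((f.appR Gr.zero).lTensor (GrassPart Λ 0) z) = f.app Λ (X.evenAct Λ z) := by
  induction z with
  | zero => simp
  | add a b ha hb => simp only [map_add, ha, hb]
  | tmul a s =>
    rw [LinearMap.lTensor_tmul, RBarMod.evenAct_tmul, RBarMod.evenAct_tmul, map_smul, f.natural]
    rfl

theorem RBarMod.OddLinear.oddAct_lTensor (hX : X.OddLinear) (hY : Y.OddLinear) (f : X ⟶ Y)
    {Λ : Gr} (z : GrassPart Λ 1 ⊗[ℝ] X.oddPart) :
    hY.oddAct Λ ((RBarMod.oddMap f).lTensor (GrassPart Λ 1) z) = f.app Λ (hX.oddAct Λ z) := by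
  induction z with
  | zero => simp
  | add a b ha hb => simp only [map_add, ha, hb]
  | tmul a s =>
    rw [LinearMap.lTensor_tmul, hX.oddAct_tmul, hY.oddAct_tmul, f.natural]
    rfl

/-- The comparison is natural in X: both of its halves are built from scalar multiplication and from
the maps X(φ), which every morphism respects. -/
theorem RBarMod.comparison_superMap (hX : X.OddLinear) (hY : Y.OddLinear) (f : X ⟶ Y) {Λ : Gr}
    (z : X.super.bar.obj Λ) : RBarMod.Hom.app hY.comparison Λ (RBarMod.superMap f Λ z) =
      f.app Λ (RBarMod.Hom.app hX.comparison Λ z) :=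
  (congrArg₂ (· + ·) (RBarMod.evenAct_lTensor f _) (hX.oddAct_lTensor hY f _)).trans
    (map_add _ _ _).symm

theorem slice_lTensor {A : Type w} [AddCommGroup A] [Module ℝ A] {V : Type u} [AddCommGroup V]
    [Module ℝ V] {V' : Type v} [AddCommGroup V'] [Module ℝ V'] (f : V →ₗ[ℝ] V')
    (l : Module.Dual ℝ A) (z : A ⊗[ℝ] V) : slice V' l (f.lTensor A z) = f (slice V l z) := by
  induction z with
  | zero => simp
  | add a b ha hb => simp only [map_add, ha, hb]
  | tmul a s => simp

/-- A family of morphisms is jointly injective. -/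
def RBarMod.JointlyInjective {I : Type w} {Z : I → RBarMod.{u}} (f : ∀ i, X ⟶ Z i) : Prop :=
  ∀ (Λ : Gr) (x : X.obj Λ), (∀ i, (f i).app Λ x = 0) → x = 0

variable {I : Type w} {Z : I → RBarMod.{u}} {f : ∀ i, X ⟶ Z i}

theorem RBarMod.JointlyInjective.ext (hf : RBarMod.JointlyInjective f) {Λ : Gr} {x y : X.obj Λ}
    (h : ∀ i, (f i).app Λ x = (f i).app Λ y) : x = y :=
  sub_eq_zero.1 (hf Λ _ fun i => by rw [map_sub, h, sub_self])

/-- Linearity in the odd parameter consists of equations in X(Λ) that are preserved by morphisms, so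
it may be tested after a jointly injective family. -/
theorem RBarMod.JointlyInjective.oddLinear (hf : RBarMod.JointlyInjective f)
    (hZ : ∀ i, (Z i).OddLinear) : X.OddLinear := by
  refine fun Λ x hx => ⟨fun a b => hf.ext fun i => ?_, fun c a => hf.ext fun i => ?_⟩
  · simp only [map_add, (f i).natural]
    exact (hZ i Λ _ (RBarMod.map_mem_oddPart (f i) hx)).1 a b
  · simp only [map_smul, (f i).natural]
    exact (hZ i Λ _ (RBarMod.map_mem_oddPart (f i) hx)).2 c a

/-- Joint injectivity survives tensoring with the parts of Λ, for an index set of any size: a tensor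
vanishes if all its slices do, and slicing commutes with the maps induced by `f i`. -/
theorem RBarMod.JointlyInjective.superMap_ext (hf : RBarMod.JointlyInjective f) {Λ : Gr}
    {z : X.super.bar.obj Λ} (h : ∀ i, RBarMod.superMap (f i) Λ z = 0) : z = 0 := by
  refine SVect.bar_ext (tensor_eq_zero_of_slice fun l => hf _ _ fun i => ?_)
    (tensor_eq_zero_of_slice fun l => Subtype.ext (hf _ _ fun i => ?_))
  · have h1 := congrArg (fun y => slice _ l (Prod.fst y)) (h i)
    exact (slice_lTensor _ _ _).symm.trans (h1.trans (map_zero _))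
  · have h1 := congrArg (fun y => slice _ l (Prod.snd y)) (h i)
    exact congrArg Subtype.val ((slice_lTensor (RBarMod.oddMap (f i)) _ _).symm.trans
      (h1.trans (map_zero _)))

/-- By naturality an element of the kernel is mapped into the kernel of the comparison of every `Z
i`, hence to zero. -/
theorem RBarMod.JointlyInjective.comparison_injective (hf : RBarMod.JointlyInjective f)
    (hX : X.OddLinear) (hZ : ∀ i, (Z i).OddLinear)
    (h : ∀ i Λ, Function.Injective (RBarMod.Hom.app (hZ i).comparison Λ)) (Λ : Gr) :
    Function.Injective (RBarMod.Hom.app hX.comparison Λ) := by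
  refine (injective_iff_map_eq_zero _).2 fun z hz => hf.superMap_ext fun i => h i Λ ?_
  rw [RBarMod.comparison_superMap hX (hZ i), hz, map_zero, map_zero]

/-- The comparison morphism is surjective if it is so locally. -/
theorem RBarMod.JointlyInjective.comparison_surjective (hf : RBarMod.JointlyInjective f)
    {Z' : I → I → RBarMod.{u}} {p : ∀ i j, Z i ⟶ Z' i j} {q : ∀ i j, Z j ⟶ Z' i j}
    (hpq : ∀ i j Λ (x : X.obj Λ),
      (p i j).app Λ ((f i).app Λ x) = (q i j).app Λ ((f j).app Λ x))
    (hglue : ∀ Λ (x : ∀ i, (Z i).obj Λ), (∀ i j, (p i j).app Λ (x i) = (q i j).app Λ (x j)) →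
      ∃ y : X.obj Λ, ∀ i, (f i).app Λ y = x i)
    (hX : X.OddLinear) (hZ : ∀ i, (Z i).OddLinear) (hZ' : ∀ i j, (Z' i j).OddLinear)
    (h : ∀ i Λ, Function.Surjective (RBarMod.Hom.app (hZ i).comparison Λ))
    (h' : ∀ i j Λ, Function.Injective (RBarMod.Hom.app (hZ' i j).comparison Λ)) (Λ : Gr) :
    Function.Surjective (RBarMod.Hom.app hX.comparison Λ) := by
  intro x
  choose z hz using fun i => h i Λ ((f i).app Λ x)
  -- The two restrictions of x to an overlap coincide, so the restrictions of the preimages `z i`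
  -- and `z j` coincide after the injective comparison of `Z' i j`, hence already before it.
  have hc : ∀ i j, RBarMod.superMap (p i j) Λ (z i) = RBarMod.superMap (q i j) Λ (z j) :=
    fun i j => h' i j Λ (by
      rw [RBarMod.comparison_superMap (hZ i) (hZ' i j),
        RBarMod.comparison_superMap (hZ j) (hZ' i j), hz, hz, hpq])
  -- Slices of the compatible family z form a compatible family in the modules over ℝ, where the
  -- glueing hypothesis applies; odd slices are glued over the algebra of rank one.
  have h0 : ∀ l : Module.Dual ℝ (GrassPart Λ 0), ∃ y : X.obj Gr.zero,
      ∀ i, (f i).app _ y = slice _ l (z i).1 := fun l => hglue _ _ fun i j => by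
    have h1 := congrArg (fun y => slice _ l (Prod.fst y)) (hc i j)
    exact (slice_lTensor ((p i j).appR Gr.zero) _ _).symm.trans (h1.trans (slice_lTensor _ _ _))
  have h1 : ∀ l : Module.Dual ℝ (GrassPart Λ 1), ∃ y : X.oddPart,
      ∀ i, RBarMod.oddMap (f i) y = slice _ l (z i).2 := by
    intro l
    obtain ⟨y, hy⟩ := hglue Gr.one (fun i => (slice _ l (z i).2).1) fun i j => by
      have h1 := congrArg (fun y => slice _ l (Prod.snd y)) (hc i j)
      exact congrArg Subtype.val ((slice_lTensor (RBarMod.oddMap (p i j)) _ _).symm.trans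
        (h1.trans (slice_lTensor (RBarMod.oddMap (q i j)) _ _)))
    -- Vanishing of the glued element under the augmentation is again tested in every `Z i`.
    refine ⟨⟨y, RBarMod.mem_oddPart.2 (hf _ _ fun i => ?_)⟩, fun i => Subtype.ext (hy i)⟩
    rw [(f i).natural, hy]
    exact (slice _ l (z i).2).2
  choose s hs using h0
  choose t ht using h1
  -- Only the finitely many slices along a basis of Λ are needed, so the glued slices assemble to a
  -- finite sum of tensors although there may be infinitely many `i`.
  let y₀ : GrassPart Λ 0 ⊗[ℝ] X.obj Gr.zero := ∑ J, partBasis Λ 0 J ⊗ₜ s ((partBasis Λ 0).coord J)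
  let y₁ : GrassPart Λ 1 ⊗[ℝ] X.oddPart := ∑ J, partBasis Λ 1 J ⊗ₜ t ((partBasis Λ 1).coord J)
  let y : X.super.bar.obj Λ := ((y₀, y₁) : X.super.Bar Λ)
  refine ⟨y, hf.ext fun i => ?_⟩
  rw [← RBarMod.comparison_superMap hX (hZ i), ← hz i]
  congr 1
  refine SVect.bar_ext ?_ ?_
  · refine Eq.trans ?_ (tensor_eq_sum_slice (z i).1)
    change (RBarMod.Hom.appR (f i) Gr.zero).lTensor (GrassPart Λ 0) y₀ = _
    rw [map_sum]
    exact Fintype.sum_congr _ _ fun J => congrArg (partBasis Λ 0 J ⊗ₜ[ℝ] ·) (hs _ i)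
  · refine Eq.trans ?_ (tensor_eq_sum_slice (z i).2)
    change (RBarMod.oddMap (f i)).lTensor (GrassPart Λ 1) y₁ = _
    rw [map_sum]
    exact Fintype.sum_congr _ _ fun J => congrArg (partBasis Λ 1 J ⊗ₜ[ℝ] ·) (ht _ i)

/-- A morphism with bijective components is an isomorphism. -/
theorem RBarMod.isIso_of_bijective (f : X ⟶ Y) (hf : ∀ Λ, Function.Bijective (f.app Λ)) :
    IsIso f := by
  let e : ∀ Λ, X.obj Λ ≃ₗ[GrassEven Λ] Y.obj Λ := fun Λ => LinearEquiv.ofBijective _ (hf Λ)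
  let g : Y ⟶ X :=
    { app := fun Λ => (e Λ).symm.toLinearMap
      natural := fun {Λ Λ'} φ y => (e Λ').symm_apply_eq.2 (by
        change _ = f.app Λ' _
        rw [f.natural]
        exact congrArg _ ((e Λ).apply_symm_apply y).symm) }
  exact ⟨g, RBarMod.Hom.ext (funext fun Λ => LinearMap.ext fun x => (e Λ).symm_apply_apply x),
    RBarMod.Hom.ext (funext fun Λ => LinearMap.ext fun x => (e Λ).apply_symm_apply x)⟩

end Morphisms

theorem RBarMod.isSuperrepresentable_of_comparison {X : RBarMod.{u}} (hX : X.OddLinear)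
    (h : ∀ Λ, Function.Bijective (RBarMod.Hom.app hX.comparison Λ)) :
    X.IsSuperrepresentable :=
  have := RBarMod.isIso_of_bijective hX.comparison h
  ⟨X.super, ⟨asIso hX.comparison⟩⟩

/-- The bar-construction of linear isomorphisms. -/
theorem SVect.nonempty_bar_iso {V V' : SVect.{u}} (f : V.even ≃ₗ[ℝ] V'.even)
    (g : V.odd ≃ₗ[ℝ] V'.odd) : Nonempty (V.bar ≅ V'.bar) := by
  let F : V.bar ⟶ V'.bar :=
    { app := fun Λ =>
        { toFun := fun z => (f.toLinearMap.lTensor (GrassPart Λ 0) z.1,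
            g.toLinearMap.lTensor (GrassPart Λ 1) z.2)
          map_add' := fun x y => SVect.bar_ext (map_add (f.toLinearMap.lTensor _) x.1 y.1)
            (map_add (g.toLinearMap.lTensor _) x.2 y.2)
          map_smul' := fun a x => SVect.bar_ext (lTensor_part_smul f.toLinearMap a x.1)
            (lTensor_part_smul g.toLinearMap a x.2) }
      natural := fun φ x => SVect.bar_ext
        ((DFunLike.congr_fun (LinearMap.lTensor_comp_rTensor _ (GrHom.part φ 0) f.toLinearMap)
          x.1).trans (DFunLike.congr_fun (LinearMap.rTensor_comp_lTensor _ (GrHom.part φ 0)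
            f.toLinearMap) x.1).symm)
        ((DFunLike.congr_fun (LinearMap.lTensor_comp_rTensor _ (GrHom.part φ 1) g.toLinearMap)
          x.2).trans (DFunLike.congr_fun (LinearMap.rTensor_comp_lTensor _ (GrHom.part φ 1)
            g.toLinearMap) x.2).symm) }
  have h : ∀ Λ, Function.Bijective (RBarMod.Hom.app F Λ) := fun Λ =>
    Function.Bijective.prodMap (f.lTensor (GrassPart Λ 0)).bijective
      (g.lTensor (GrassPart Λ 1)).bijective
  have := RBarMod.isIso_of_bijective F h
  exact ⟨asIso F⟩

/-! ### Glueing of sections -/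

section Glueing

variable {M : SuperManifold.{u}} {E : SuperVectorBundle.{u, v, w} M} {N : OpenSub M.F}

/-- Fibres depend on the base point, so equal points and equal parameters are exchanged by
substitution instead of rewriting. -/
theorem triv_eval_congr (i : E.ι) {Λ Λ' : Gr}
    (σ : ∀ (_ : Λ ⟶ Λ') (m : M.F.obj Λ'), m ∈ N.carrier Λ' → E.fib Λ' m) {η η' : Λ ⟶ Λ'}
    (hη : η = η') {m m' : M.F.obj Λ'} (e : m = m') (h : m ∈ Set.range ((E.chart i).emb Λ'))
    (h' : m' ∈ Set.range ((E.chart i).emb Λ')) (hm : m ∈ N.carrier Λ') (hm' : m' ∈ N.carrier Λ') :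
    E.triv i Λ' m h (σ η m hm) = E.triv i Λ' m' h' (σ η' m' hm') := by
  subst hη e
  rfl

/-- It is enough to check supersmoothness of a family of vectors locally, in one trivialization
near each point. -/
theorem exists_isLocalExpr_of_cover {Λ Λ' : Gr}
    (σ : ∀ (_ : Λ ⟶ Λ') (m : M.F.obj Λ'), m ∈ N.carrier Λ' → E.fib Λ' m)
    (h : ∀ m ∈ N.carrier Λ', ∃ (i : E.ι) (O : Set (M.F.obj Λ')), IsOpen O ∧ m ∈ O ∧
      O ⊆ N.carrier Λ' ∧ O ⊆ Set.range ((E.chart i).emb Λ') ∧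
      ∃ s : ((pointDomain Λ).V.prod (E.chart i).dom.V).Bar Λ' → (E.fiber i).Bar Λ',
        SupersmoothOn (GrassEven Λ') s
          {x | barSnd (pointDomain Λ).V (E.chart i).dom.V Λ' x ∈ (E.chart i).preimage O} ∧
        ∀ (x : ((pointDomain Λ).V.prod (E.chart i).dom.V).Bar Λ')
          (hx : barSnd (pointDomain Λ).V (E.chart i).dom.V Λ' x ∈ (E.chart i).dom.pts Λ')
          (_ : (E.chart i).emb Λ' ⟨_, hx⟩ ∈ O) (hm : (E.chart i).emb Λ' ⟨_, hx⟩ ∈ N.carrier Λ'),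
          s x = E.triv i Λ' _ (Set.mem_range_self _)
            (σ (pointHom Λ Λ' (barFst (pointDomain Λ).V (E.chart i).dom.V Λ' x)) _ hm))
    (j : E.ι) : ∃ s, IsLocalExpr E N j σ s := by
  classical
  let P := (pointDomain Λ).V
  let V := (E.chart j).dom.V
  -- On the relevant domain the expression in the chart `j` is forced; elsewhere 0 is a default
  -- value.
  let s : (P.prod V).Bar Λ' → (E.fiber j).Bar Λ' := fun x =>
    if hx : ∃ hx : barSnd P V Λ' x ∈ (E.chart j).dom.pts Λ',
      (E.chart j).emb Λ' ⟨_, hx⟩ ∈ N.carrier Λ' then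
      E.triv j Λ' _ (Set.mem_range_self _) (σ (pointHom Λ Λ' (barFst P V Λ' x)) _ hx.snd) else 0
  have hs : ∀ (x : (P.prod V).Bar Λ') (hx : barSnd P V Λ' x ∈ (E.chart j).dom.pts Λ')
      (hm : (E.chart j).emb Λ' ⟨_, hx⟩ ∈ N.carrier Λ'), s x =
      E.triv j Λ' _ (Set.mem_range_self _) (σ (pointHom Λ Λ' (barFst P V Λ' x)) _ hm) :=
    fun x hx hm => dif_pos ⟨hx, hm⟩
  refine ⟨s, SupersmoothOn.of_local ?_, hs⟩
  rintro x₀ ⟨hx₀, hm₀⟩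
  obtain ⟨i, O, hO, hmO, hON, hOi, si, hsi, hsi'⟩ := h _ hm₀
  obtain ⟨t, ht, ht'⟩ := E.chart_compat (E.chart j) (Or.inr ⟨j, rfl⟩) (E.chart i)
    (Or.inr ⟨i, rfl⟩) Λ'
  obtain ⟨g, hg, hg'⟩ := E.transition i j Λ'
  let V' := (E.chart i).dom.V
  let U : Set ((P.prod V).Bar Λ') := {x | barSnd P V Λ' x ∈ (E.chart j).preimage O}
  have hU : IsOpen U := ((E.chart j).isOpen_preimage hO).preimage (barSnd P V Λ').continuous
  have key : ∀ x ∈ U, ∃ (hx : barSnd P V Λ' x ∈ (E.chart j).dom.pts Λ')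
      (y : (E.chart i).dom.pts Λ'), (E.chart j).emb Λ' ⟨_, hx⟩ = (E.chart i).emb Λ' y ∧
      t (barSnd P V Λ' x) = y.1 ∧ (E.chart i).emb Λ' y ∈ O := by
    rintro x ⟨hx, hm⟩
    obtain ⟨y, hy⟩ := hOi hm
    exact ⟨hx, y, hy.symm, ht' ⟨_, hx⟩ y hy.symm, hy ▸ hm⟩
  have hsm : SupersmoothOn (GrassEven Λ') (fun x => t (barSnd P V Λ' x)) U :=
    ht.comp_clm (barSnd P V Λ') (barHom_smul _ _ _) fun x hx => ⟨hx.1, hOi hx.2⟩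
  have hpair : SupersmoothOn (GrassEven Λ')
      (fun x => barPair P V' Λ' (barFst P V Λ' x, t (barSnd P V Λ' x))) U :=
    ((supersmoothOn_clm (barFst P V Λ') (barHom_smul _ _ _) U).prodMk hsm).clm_comp
      (barPair P V' Λ') (barPair_smul _ _ _)
  -- Over U the section is computed by passing to the chart `i` with the change of charts t,
  -- applying the known expression `si` there, and returning to the fibre of `j` with the transition
  -- map g. The parameter in the superpoint is carried along unchanged.
  refine ⟨U, hU, fun x hx => ⟨hx.1, hON hx.2⟩, ⟨hx₀, hmO⟩, fun x => g (t (barSnd P V Λ' x),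
    si (barPair P V' Λ' (barFst P V Λ' x, t (barSnd P V Λ' x)))), ?_, ?_⟩
  · refine SupersmoothOn.comp (((E.chart i).isOpen_preimage
      ((E.chart j).isOpenEmbedding Λ').isOpen_range).prod isOpen_univ) hg
      (hsm.prodMk (SupersmoothOn.comp (((E.chart i).isOpen_preimage hO).preimage
        (barSnd P V' Λ').continuous) hsi hpair ?_)) ?_
    · intro x hx
      obtain ⟨hx, y, hy, hty, hyO⟩ := key x hx
      change barSnd P V' Λ' (barPair P V' Λ' (barFst P V Λ' x, t (barSnd P V Λ' x))) ∈
        (E.chart i).preimage O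
      rw [barSnd_pair, hty]
      exact ⟨y.2, hyO⟩
    · intro x hx
      obtain ⟨hx, y, hy, hty, hyO⟩ := key x hx
      refine ⟨?_, trivial⟩
      change t (barSnd P V Λ' x) ∈ (E.chart i).preimage (Set.range ((E.chart j).emb Λ'))
      rw [hty]
      exact ⟨y.2, _, hy⟩
  · intro x hxU
    obtain ⟨hx, y, hy, hty, hyO⟩ := key x hxU
    have hyr : (E.chart i).emb Λ' y ∈ Set.range ((E.chart j).emb Λ') := ⟨_, hy⟩
    have h1 : si (barPair P V' Λ' (barFst P V Λ' x, y.1)) =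
        E.triv i Λ' _ (Set.mem_range_self y)
          (σ (pointHom Λ Λ' (barFst P V Λ' x)) _ (hON hyO)) := by
      have e : barSnd P V' Λ' (barPair P V' Λ' (barFst P V Λ' x, y.1)) = y.1 := barSnd_pair _ _ _ _
      have e' : (⟨_, e.symm ▸ y.2⟩ : (E.chart i).dom.pts Λ') = y := Subtype.ext e
      refine (hsi' _ (e.symm ▸ y.2) (by rw [e']; exact hyO) (by rw [e']; exact hON hyO)).trans ?_
      exact triv_eval_congr i σ (congrArg (pointHom Λ Λ') (barFst_pair _ _ _ _))
        (congrArg _ e') _ _ _ _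
    change s x = g (t (barSnd P V Λ' x), si (barPair P V' Λ' (barFst P V Λ' x, t (barSnd P V Λ' x))))
    rw [hs x hx (hON hxU.2), hty, h1, hg' y hyr, LinearEquiv.symm_apply_apply]
    exact triv_eval_congr j σ rfl hy _ _ _ _

/-- The value at a point is taken from a chart chosen for that point; agreement on overlaps makes
the choice immaterial, so that over the whole image of a chart the family coincides with the given
section. -/
theorem exists_glued_section {Λ : Gr} (x : ∀ i, HatObj E (E.chart i).image Λ)
    (hx : ∀ i j {Λ' : Gr} (η : Λ ⟶ Λ') (m : M.F.obj Λ') (hi : m ∈ (E.chart i).image.carrier Λ')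
      (hj : m ∈ (E.chart j).image.carrier Λ'), (x i).eval η m hi = (x j).eval η m hj) :
    ∃ y : HatObj E (OpenSub.top M.F) Λ, ∀ i {Λ' : Gr} (η : Λ ⟶ Λ') (m : M.F.obj Λ')
      (hi : m ∈ (E.chart i).image.carrier Λ'), y.eval η m trivial = (x i).eval η m hi := by
  choose c hc using E.cover
  refine ⟨HatObj.mk (fun {Λ'} η m _ => (x (c Λ' m)).eval η m (hc Λ' m)) ?_ ?_,
    fun i Λ' η m hi => hx _ _ _ _ _ _⟩
  · intro Λ₁ Λ₂ φ η m _
    -- The chart chosen for the image of m under φ may differ from the one chosen for m; agreement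
    -- on the overlap bridges the two.
    exact ((x (c Λ₁ m)).natural φ η m (hc Λ₁ m)).trans (hx _ _ _ _ _ _)
  · intro j Λ'
    refine exists_isLocalExpr_of_cover _ (fun m _ => ?_) j
    obtain ⟨s, hs, hs'⟩ := (x (c Λ' m)).localExpr (c Λ' m) Λ'
    refine ⟨c Λ' m, _, ((E.chart (c Λ' m)).isOpenEmbedding Λ').isOpen_range, hc Λ' m,
      fun _ _ => trivial, subset_rfl, s, hs, fun y hy hm _ => ?_⟩
    exact (hs' y hy hm).trans (congrArg _ (hx _ _ _ _ _ _))

/-- The sections over the whole base are the limit of the sections over the charts. -/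
theorem nonempty_isLimit_gluingFork (E : SuperVectorBundle.{u, v, w} M) :
    Nonempty (Limits.IsLimit (gluingFork E)) := by
  have hglue : ∀ (K : Limits.Multifork (gluingDiagram E)) (Λ : Gr) (z : K.pt.obj Λ),
      ∃ y : HatObj E (OpenSub.top M.F) Λ, ∀ (i : E.ι) {Λ' : Gr} (η : Λ ⟶ Λ') (m : M.F.obj Λ')
        (hi : m ∈ (E.chart i).image.carrier Λ'), y.eval η m trivial =
          HatObj.eval (E := E) (N := (E.chart i).image) (RBarMod.Hom.app (K.ι i) Λ z) η m hi := by
    intro K Λ z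
    refine exists_glued_section _ fun i j Λ' η m hi hj => ?_
    -- The condition of the cone at the pair (i, j) is the agreement on the overlap of the two
    -- charts.
    have h := congrArg (fun f => RBarMod.Hom.app f Λ z) (K.condition (i, j))
    exact congrArg (fun (f : HatObj E ((E.chart i).image.inter (E.chart j).image) Λ) =>
      f.eval η m ⟨hi, hj⟩) h
  choose G hG using hglue
  -- A global section is determined by its restrictions to the charts, so additivity, linearity and
  -- naturality of the glued morphism, and its uniqueness, follow from those properties of the
  -- components of the cone.
  have hext : ∀ {Λ : Gr} {y y' : HatObj E (OpenSub.top M.F) Λ}, (∀ (i : E.ι) {Λ' : Gr} (η : Λ ⟶ Λ')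
      (m : M.F.obj Λ') (_ : m ∈ (E.chart i).image.carrier Λ'),
      y.eval η m trivial = y'.eval η m trivial) → y = y' := fun h =>
    HatObj.ext fun η m _ => by
      obtain ⟨i, hi⟩ := E.cover _ m
      exact h i η m hi
  let L : ∀ K : Limits.Multifork (gluingDiagram E), K.pt ⟶ hatSections E (OpenSub.top M.F) :=
    fun K =>
    { app := fun Λ =>
        { toFun := G K Λ
          map_add' := fun a b => hext fun i Λ' η m hi => by
            refine (hG K Λ _ i η m hi).trans ?_
            rw [map_add]
            exact (congrArg₂ (· + ·) (hG K Λ a i η m hi) (hG K Λ b i η m hi)).symm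
          map_smul' := fun r a => hext fun i Λ' η m hi => by
            refine (hG K Λ _ i η m hi).trans ?_
            rw [map_smul]
            exact congrArg (GrHom.even η r • ·) (hG K Λ a i η m hi).symm }
      natural := fun {Λ Λ'} φ z => hext fun i Λ'' η m hi => by
        refine (hG K Λ' _ i η m hi).trans ?_
        rw [(K.ι i).natural]
        exact (hG K Λ z i (φ ≫ η) m hi).symm }
  refine ⟨Limits.Multifork.IsLimit.mk _ L (fun K i => ?_) (fun K f hf => ?_)⟩
  · refine RBarMod.Hom.ext (funext fun Λ => LinearMap.ext fun z => HatObj.ext fun η m hm => ?_)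
    exact hG K Λ z i η m hm
  · refine RBarMod.Hom.ext (funext fun Λ => LinearMap.ext fun z => hext fun i Λ' η m hi => ?_)
    refine Eq.trans ?_ (hG K Λ z i η m hi).symm
    have h := congrArg (fun f => RBarMod.Hom.app f Λ z) (hf i)
    exact congrArg (fun (f : HatObj E (E.chart i).image Λ) => f.eval η m hi) h

end Glueing

/-! ### Sections in a trivialization -/

section Charts

variable {M : SuperManifold.{u}} (E : SuperVectorBundle.{u, v, w} M)

/-- The preimage of an open subfunctor under a chart. -/
noncomputable def SuperChart.comap {F : Gr ⥤ TopCat.{u}} (c : SuperChart F) (N : OpenSub F) :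
    OpenSub c.dom.toSuperManifold.F where
  carrier Λ := {x : c.dom.pts Λ | c.emb Λ x ∈ N.carrier Λ}
  isOpen Λ := (N.isOpen Λ).preimage (c.isOpenEmbedding Λ).continuous
  map_mem {Λ Λ'} φ (x : c.dom.pts Λ) hx := by
    have h : F.map φ (c.emb Λ x) ∈ N.carrier Λ' := N.map_mem φ _ hx
    rw [c.natural] at h
    exact h

/-- The sections over `N` in the trivialization over the chart `i`. -/
noncomputable def chartRestrict (N : OpenSub M.F) (i : E.ι) : hatSections E N ⟶
    hatSections (trivialBundle (E.chart i).dom (E.fiber i)) ((E.chart i).comap N) where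
  app Λ :=
    { toFun := fun σ : HatObj E N Λ =>
        (HatObj.mk (fun {Λ'} η (x : (E.chart i).dom.pts Λ') hx =>
            E.triv i Λ' _ (Set.mem_range_self x) (σ.eval η ((E.chart i).emb Λ' x) hx))
          (fun {Λ₁ Λ₂} φ η (x : (E.chart i).dom.pts Λ₁) hx => by
            have hr := Set.mem_range_self (f := (E.chart i).emb Λ₁) x
            have h1 := E.triv_natural i φ ((E.chart i).emb Λ₁ x) hr
              ((E.chart i).image.map_mem φ _ hr) (σ.eval η _ hx)
            refine h1.symm.trans ?_
            rw [σ.natural φ η _ hx]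
            exact triv_eval_congr i (fun η m hm => σ.eval η m hm) rfl
              ((E.chart i).natural φ x) _ _ _ _)
          (fun _ Λ' => by
            obtain ⟨s, hs, hs'⟩ := σ.localExpr i Λ'
            refine ⟨s, hs.mono ?_, fun x hx hm => hs' x hx hm⟩
            rintro x ⟨h1, h2⟩
            exact ⟨h1, h2⟩) :
          HatObj (trivialBundle (E.chart i).dom (E.fiber i)) ((E.chart i).comap N) Λ)
      map_add' := fun σ τ => HatObj.ext fun {Λ'} η (x : (E.chart i).dom.pts Λ') _ =>
        map_add (E.triv i Λ' _ (Set.mem_range_self x)) _ _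
      map_smul' := fun a σ => HatObj.ext fun {Λ'} η (x : (E.chart i).dom.pts Λ') _ =>
        map_smul (E.triv i Λ' _ (Set.mem_range_self x)) _ _ }
  natural _ _ := rfl

/-- The charts cover the base and the trivializations are injective on fibres. Since N is arbitrary,
this also covers overlaps of charts. -/
theorem chartRestrict_jointlyInjective (N : OpenSub M.F) :
    ∀ (Λ : Gr) (σ : HatObj E N Λ),
      (∀ i, (RBarMod.Hom.app (chartRestrict E N i) Λ σ) = 0) → σ = 0 := by
  refine fun Λ σ h => HatObj.ext fun {Λ'} η m hm => ?_
  obtain ⟨i, x, rfl⟩ := E.cover Λ' m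
  have h1 := congrArg (fun (f : HatObj (trivialBundle (E.chart i).dom (E.fiber i))
    ((E.chart i).comap N) Λ) => f.eval (Λ' := Λ') η x hm) (h i)
  have h2 : E.triv i Λ' _ (Set.mem_range_self x) (σ.eval η _ hm) = 0 := h1
  exact (E.triv i Λ' _ _).injective (h2.trans (map_zero _).symm)

/-- The inverse applies the inverse trivialization fibrewise. The family obtained is supersmooth in
the trivialization `i` by construction, and hence in all trivializations because these are
compatible. -/
theorem chartPullback_bijective (i : E.ι) (Λ : Gr) :
    Function.Bijective (RBarMod.Hom.app (chartPullback E i) Λ) := by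
  constructor
  · intro σ τ h
    refine HatObj.ext fun {Λ'} η m hm => ?_
    obtain ⟨x, rfl⟩ := hm
    have h1 := congrArg (fun (f : HatObj (trivialBundle (E.chart i).dom (E.fiber i))
      (OpenSub.top _) Λ) => f.eval (Λ' := Λ') η x trivial) h
    exact (E.triv i Λ' _ _).injective h1
  · intro (τ : HatObj (trivialBundle (E.chart i).dom (E.fiber i)) (OpenSub.top _) Λ)
    -- `hm.choose` is the point of the superdomain over m; it is unique because the chart is
    -- injective.
    let σ : ∀ {Λ' : Gr} (_ : Λ ⟶ Λ') (m : M.F.obj Λ'), m ∈ (E.chart i).image.carrier Λ' →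
      E.fib Λ' m := fun {Λ'} η m hm => (E.triv i Λ' m hm).symm
        (τ.eval (Λ' := Λ') η hm.choose trivial)
    have hσ : ∀ {Λ' : Gr} (η : Λ ⟶ Λ') (x : (E.chart i).dom.pts Λ')
        (hm : (E.chart i).emb Λ' x ∈ (E.chart i).image.carrier Λ')
        (hm' : (E.chart i).emb Λ' x ∈ Set.range ((E.chart i).emb Λ')),
        E.triv i Λ' _ hm' (σ η _ hm) = τ.eval (Λ' := Λ') η x trivial := by
      intro Λ' η x hm hm'
      have h : hm.choose = x := ((E.chart i).isOpenEmbedding Λ').injective hm.choose_spec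
      exact (LinearEquiv.apply_symm_apply _ _).trans
        (congrArg (fun x => τ.eval (Λ' := Λ') η x trivial) h)
    refine ⟨(HatObj.mk σ ?_ fun j Λ' => exists_isLocalExpr_of_cover σ (fun m hm => ?_) j :
      HatObj E (E.chart i).image Λ), HatObj.ext fun η x _ => hσ η x _ _⟩
    · rintro Λ₁ Λ₂ φ η _ ⟨x, rfl⟩
      have hr := Set.mem_range_self (f := (E.chart i).emb Λ₁) x
      have hr' := (E.chart i).image.map_mem φ _ hr
      refine (E.triv i Λ₂ _ hr').injective ?_
      refine (E.triv_natural i φ _ hr hr' _).trans ((congrArg ((E.fiber i).barMap φ)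
        (hσ η x hr hr)).trans ?_)
      refine (τ.natural φ η x trivial).trans ((hσ (η ≫ φ) ((E.chart i).dom.map φ x)
        (Set.mem_range_self _) (Set.mem_range_self _)).symm.trans ?_)
      exact triv_eval_congr i (fun η m hm => σ η m hm) rfl ((E.chart i).natural φ x).symm _ _ _ _
    · obtain ⟨s, hs, hs'⟩ := τ.localExpr () Λ'
      refine ⟨i, _, ((E.chart i).isOpenEmbedding Λ').isOpen_range, hm, subset_rfl, subset_rfl,
        s, hs.mono ?_, fun x hx _ hm => (hs' x hx trivial).trans (hσ _ _ _ _).symm⟩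
      rintro x ⟨hx, -⟩
      exact ⟨hx, trivial⟩

end Charts

/-! ### The Grassmann algebra of rank one -/

theorem Gr.theta_ne_zero : Gr.theta ≠ 0 := by
  intro h
  have h1 : ExteriorAlgebra.ι ℝ (Pi.single 0 1 : Fin 1 → ℝ) = 0 := congrArg Subtype.val h
  rw [ExteriorAlgebra.ι_eq_zero_iff] at h1
  exact one_ne_zero ((Pi.single_eq_same (M := fun _ : Fin 1 => ℝ) 0 1).symm.trans (congrFun h1 0))

theorem Gr.exists_thetaDual : ∃ l : Module.Dual ℝ (GrassPart Gr.one 1), l Gr.theta = 1 := by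
  obtain ⟨l, hl⟩ : ∃ l : Module.Dual ℝ (GrassPart Gr.one 1), l Gr.theta ≠ 0 := by
    by_contra! h
    exact Gr.theta_ne_zero ((Module.forall_dual_apply_eq_zero_iff ℝ _).1 h)
  exact ⟨(l Gr.theta)⁻¹ • l, inv_mul_cancel₀ hl⟩

/-- The functional dual to the generator. -/
noncomputable def Gr.thetaDual : Module.Dual ℝ (GrassPart Gr.one 1) := Gr.exists_thetaDual.choose

theorem Gr.thetaDual_theta : Gr.thetaDual Gr.theta = 1 := Gr.exists_thetaDual.choose_spec

/-- The span of 1 and θ is stable under multiplication by θ, since θ² = 0. -/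
theorem Gr.exists_eq_one_add_theta (b : Grass Gr.one) :
    ∃ r s : ℝ, b = algebraMap ℝ _ r + s • Gr.theta.1 := by
  have h : b ∈ Submodule.span ℝ {(1 : Grass Gr.one), Gr.theta.1} := by
    refine Gr.gen_induction (Submodule.subset_span (by simp)) (fun i x hx => ?_) b
    obtain rfl : i = 0 := Subsingleton.elim _ _
    obtain ⟨r, s, rfl⟩ := Submodule.mem_span_pair.1 hx
    have h2 : (Gr.one.gen 0).1 * Gr.theta.1 = 0 := grass_odd_sq Gr.theta
    rw [mul_add, mul_smul_comm, mul_smul_comm, mul_one, h2, smul_zero, add_zero]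
    exact Submodule.smul_mem _ _ (Submodule.subset_span (Or.inr rfl))
  obtain ⟨r, s, rfl⟩ := Submodule.mem_span_pair.1 h
  exact ⟨r, s, by rw [Algebra.algebraMap_eq_smul_one]⟩

/-- The Taylor expansion in a single odd variable: with b = r + sθ, the product ab goes to ra + s a
η(θ). The first term is the value for θ ↦ 0, the second is the θ-coefficient multiplied by η(θ) on
the right. -/
theorem Gr.desc_one_eq {Λ : Gr} (η : Gr.one ⟶ Λ) : (Gr.desc (𝟙 Λ) η).toAlgHom.toLinearMap =
    (Gr.desc (𝟙 Λ) (Gr.pt 0)).toAlgHom.toLinearMap +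
      Λ.rmul (GrHom.part η 1 Gr.theta).1 ∘ₗ Λ.coef (extendDual Gr.thetaDual) := by
  refine Gr.ext_linearMap fun a b => ?_
  obtain ⟨r, s, rfl⟩ := Gr.exists_eq_one_add_theta b
  have h0 : (Gr.pt (0 : GrassPart Λ 1)).toAlgHom Gr.theta.1 = 0 :=
    congrArg Subtype.val (Gr.pt_theta (0 : GrassPart Λ 1))
  have h1 : extendDual Gr.thetaDual (algebraMap ℝ (Grass Gr.one) r) = 0 :=
    extendDual_even _ (⟨algebraMap ℝ (Grass Gr.one) r,
      mem_even_iff.2 (AlgHom.commutes _ r)⟩ : GrassPart Gr.one 0)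
  have h2 : extendDual Gr.thetaDual (algebraMap ℝ (Grass Gr.one) r + s • Gr.theta.1) = s := by
    rw [map_add, map_smul, h1, extendDual_coe, Gr.thetaDual_theta, zero_add, smul_eq_mul, mul_one]
  simp only [LinearMap.add_apply, LinearMap.comp_apply, AlgHom.toLinearMap_apply, Gr.coef_mul,
    Gr.rmul_apply, map_mul, Gr.desc_inl, Gr.desc_inr, h2]
  simp only [map_add, map_smul, AlgHom.commutes, h0, smul_zero, add_zero, mul_add,
    smul_mul_assoc, mul_smul_comm]
  rfl

/-! ### Supersmooth families and sections of a trivial bundle -/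

section Local

variable {D : SuperDomain.{u}} {W : TopSVect.{v}} {N : OpenSub D.toSuperManifold.F}

/-- The points of an open subfunctor of a superdomain. -/
def OpenSub.pts (N : OpenSub D.toSuperManifold.F) (Λ : Gr) : Set (D.pts Λ) := N.carrier Λ

theorem OpenSub.pts_map_mem (N : OpenSub D.toSuperManifold.F) {Λ Λ' : Gr} (φ : Λ ⟶ Λ')
    (x : D.pts Λ) (hx : x ∈ N.pts Λ) : D.map φ x ∈ N.pts Λ' :=
  N.map_mem φ x hx

/-- Supersmooth maps from an open subfunctor of a superdomain to `W̄`. -/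
def IsSupersmoothFamily (N : OpenSub D.toSuperManifold.F) (W : TopSVect.{v})
    (g : ∀ (Λ : Gr) (x : D.pts Λ), x ∈ N.pts Λ → W.Bar Λ) : Prop :=
  (∀ {Λ Λ' : Gr} (φ : Λ ⟶ Λ') (x : D.pts Λ) (hx : x ∈ N.pts Λ),
    W.barMap φ (g Λ x hx) = g Λ' (D.map φ x) (N.pts_map_mem φ x hx)) ∧
  ∀ Λ, ∃ s : D.V.Bar Λ → W.Bar Λ, SupersmoothOn (GrassEven Λ) s (D.chart.preimage (N.pts Λ)) ∧
    ∀ (x : D.pts Λ) (hx : x ∈ N.pts Λ), s x = g Λ x hx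

variable (D W N) in
/-- The sections of a trivial bundle over an open subfunctor of a superdomain. -/
noncomputable abbrev LocSec : RBarMod.{max u v} := hatSections (trivialBundle D W) N

theorem bar_realToEven_smul {Λ : Gr} (r : ℝ) (y : W.Bar Λ) : realToEven Λ r • y = r • y := by
  refine (bar_smul_real (a := 1) r ?_ y).trans (by rw [one_smul])
  rw [realToEven_val, Algebra.algebraMap_eq_smul_one]
  rfl

/-- The value of a section at a point. -/
noncomputable def LocSec.val {k Λ : Gr} (η : k ⟶ Λ) (x : D.pts Λ) (hx : x ∈ N.pts Λ) :
    (LocSec D W N).obj k →ₗ[ℝ] W.Bar Λ where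
  toFun σ := HatObj.eval (E := trivialBundle D W) (N := N) σ η x hx
  map_add' _ _ := rfl
  map_smul' r σ := by
    let y : W.Bar Λ := HatObj.eval (E := trivialBundle D W) (N := N) σ η x hx
    change GrHom.even η (realToEven k r) • y = r • y
    rw [even_realToEven, bar_realToEven_smul]

theorem LocSec.ext {k : Gr} {σ τ : (LocSec D W N).obj k}
    (h : ∀ {Λ : Gr} (η : k ⟶ Λ) (x : D.pts Λ) (hx : x ∈ N.pts Λ),
      LocSec.val η x hx σ = LocSec.val η x hx τ) : σ = τ :=
  HatObj.ext (E := trivialBundle D W) (N := N) fun η x hx => h η x hx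

theorem LocSec.val_congr {k Λ : Gr} (σ : (LocSec D W N).obj k) {η η' : k ⟶ Λ} (hη : η = η')
    {x x' : D.pts Λ} (e : x = x') (hx : x ∈ N.pts Λ) (hx' : x' ∈ N.pts Λ) :
    LocSec.val η x hx σ = LocSec.val η' x' hx' σ := by
  subst hη e
  rfl

theorem LocSec.barMap_val {k Λ Λ' : Gr} (σ : (LocSec D W N).obj k) (φ : Λ ⟶ Λ') (η : k ⟶ Λ)
    (x : D.pts Λ) (hx : x ∈ N.pts Λ) : W.barMap φ (LocSec.val η x hx σ) =
      LocSec.val (η ≫ φ) (D.map φ x) (N.pts_map_mem φ x hx) σ :=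
  HatObj.natural (E := trivialBundle D W) (N := N) σ φ η x hx

theorem LocSec.val_map {k k' Λ : Gr} (σ : (LocSec D W N).obj k) (φ : k ⟶ k') (η : k' ⟶ Λ)
    (x : D.pts Λ) (hx : x ∈ N.pts Λ) :
    LocSec.val η x hx ((LocSec D W N).map φ σ) = LocSec.val (φ ≫ η) x hx σ := rfl

theorem LocSec.val_smul {k Λ : Gr} (a : GrassEven k) (σ : (LocSec D W N).obj k) (η : k ⟶ Λ)
    (x : D.pts Λ) (hx : x ∈ N.pts Λ) :
    LocSec.val η x hx (a • σ) = GrHom.even η a • LocSec.val η x hx σ := rfl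

/-- A section with values `g`. -/
theorem LocSec.exists_of_val {k : Gr}
    (g : ∀ {Λ : Gr} (_ : k ⟶ Λ) (x : D.pts Λ), x ∈ N.pts Λ → W.Bar Λ)
    (hn : ∀ {Λ Λ' : Gr} (φ : Λ ⟶ Λ') (η : k ⟶ Λ) (x : D.pts Λ) (hx : x ∈ N.pts Λ),
      W.barMap φ (g η x hx) = g (η ≫ φ) (D.map φ x) (N.pts_map_mem φ x hx))
    (hs : ∀ Λ : Gr, ∃ s : ((pointDomain k).V.prod D.V).Bar Λ → W.Bar Λ,
      SupersmoothOn (GrassEven Λ) s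
        {y | barSnd (pointDomain k).V D.V Λ y ∈ D.chart.preimage (N.pts Λ)} ∧
      ∀ (y : ((pointDomain k).V.prod D.V).Bar Λ)
        (hy : barSnd (pointDomain k).V D.V Λ y ∈ D.pts Λ) (hm : ⟨_, hy⟩ ∈ N.pts Λ),
        s y = g (pointHom k Λ (barFst (pointDomain k).V D.V Λ y)) ⟨_, hy⟩ hm) :
    ∃ σ : (LocSec D W N).obj k, ∀ {Λ : Gr} (η : k ⟶ Λ) (x : D.pts Λ) (hx : x ∈ N.pts Λ),
      LocSec.val η x hx σ = g η x hx :=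
  ⟨HatObj.mk (E := trivialBundle D W) (N := N) (fun η x hx => g η x hx) hn (fun _ Λ => hs Λ),
    fun _ _ _ => rfl⟩

/-! ### The universal point of a superpoint and the coefficients of a section -/

theorem SuperDomain.map_id (D : SuperDomain.{u}) {Λ : Gr} (x : D.pts Λ) : D.map (𝟙 Λ) x = x :=
  Subtype.ext (D.V.barMap_id Λ x.1)

theorem SuperDomain.map_comp (D : SuperDomain.{u}) {Λ Λ' Λ'' : Gr} (φ : Λ ⟶ Λ') (ψ : Λ' ⟶ Λ'')
    (x : D.pts Λ) : D.map (φ ≫ ψ) x = D.map ψ (D.map φ x) :=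
  Subtype.ext (D.V.barMap_comp φ ψ x.1)

/-- The value of a section at the universal point of the superpoint. -/
noncomputable def LocSec.univ {k : Gr} (Λ : Gr) (x : D.pts Λ) (hx : x ∈ N.pts Λ) :
    (LocSec D W N).obj k →ₗ[ℝ] W.Bar (Λ.ext k) :=
  LocSec.val (Λ.inr k) (D.map (Λ.inl k) x) (N.pts_map_mem (Λ.inl k) x hx)

/-- A Yoneda argument: `Gr.desc (𝟙 Λ) η` carries the parameter `Λ.inr k` to η and the image of x in
`Λ.ext k` back to x, and σ is natural. -/
theorem LocSec.val_eq {k Λ : Gr} (σ : (LocSec D W N).obj k) (η : k ⟶ Λ) (x : D.pts Λ)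
    (hx : x ∈ N.pts Λ) :
    LocSec.val η x hx σ = W.barMap (Gr.desc (𝟙 Λ) η) (LocSec.univ Λ x hx σ) := by
  rw [LocSec.univ, LocSec.barMap_val]
  exact LocSec.val_congr σ (Gr.inr_desc _ _).symm
    (by rw [← D.map_comp, Gr.inl_desc, D.map_id]) _ _

/-- The morphism `Gr.extMap φ k` fixes the parameter of the superpoint and moves only x. -/
theorem LocSec.univ_natural {k Λ Λ' : Gr} (σ : (LocSec D W N).obj k) (φ : Λ ⟶ Λ') (x : D.pts Λ)
    (hx : x ∈ N.pts Λ) : W.barMap (Gr.extMap φ k) (LocSec.univ Λ x hx σ) =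
      LocSec.univ Λ' (D.map φ x) (N.pts_map_mem φ x hx) σ := by
  rw [LocSec.univ, LocSec.barMap_val]
  exact LocSec.val_congr σ (Gr.inr_desc _ _)
    (by rw [← D.map_comp, ← D.map_comp, Gr.extMap, Gr.inl_desc]) _ _

/-- The coefficients of even monomials. -/
noncomputable def LocSec.coefEven {k : Gr} (l : Module.Dual ℝ (GrassPart k 0)) (Λ : Gr)
    (x : D.pts Λ) (hx : x ∈ N.pts Λ) : (LocSec D W N).obj k →ₗ[ℝ] W.Bar Λ :=
  barLin W (Λ.coef (extendDual l)) ∘ₗ LocSec.univ Λ x hx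

/-- The coefficients of odd monomials. -/
noncomputable def LocSec.coefOdd {k : Gr} (l : Module.Dual ℝ (GrassPart k 1)) (Λ : Gr)
    (x : D.pts Λ) (hx : x ∈ N.pts Λ) : (LocSec D W N).obj k →ₗ[ℝ] W.parity.Bar Λ :=
  barFlip W (Λ.coef (extendDual l)) ∘ₗ LocSec.univ Λ x hx

/-- The universal value depends on x through an affine map into the coordinates over `Λ.ext k`,
followed by a local expression of σ. The linear part of that map is only semilinear along the
inclusion of even parts; P returns to the scalars of Λ. -/
theorem LocSec.exists_smooth_univ {k : Gr} (σ : (LocSec D W N).obj k) {W' : TopSVect.{v}} (Λ : Gr)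
    (P : W.Bar (Λ.ext k) →L[ℝ] W'.Bar Λ)
    (hP : ∀ (a : GrassEven Λ) y, P (GrHom.even (Λ.inl k) a • y) = a • P y) :
    ∃ s : D.V.Bar Λ → W'.Bar Λ,
      SupersmoothOn (GrassEven Λ) s (D.chart.preimage (N.pts Λ)) ∧
      ∀ (x : D.pts Λ) (hx : x ∈ N.pts Λ), s x = P (LocSec.univ Λ x hx σ) := by
  obtain ⟨s, hs, hs'⟩ := HatObj.localExpr (E := trivialBundle D W) (N := N) σ () (Λ.ext k)
  let Q := (pointDomain k).V
  -- c holds the coordinates of the universal parameter, which do not vary with x; L is the linear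
  -- part.
  let c : (Q.prod D.V).Bar (Λ.ext k) := barPair Q D.V (Λ.ext k) (pointCoord k (Λ.ext k) (Λ.inr k), 0)
  let L : D.V.Bar Λ →L[ℝ] (Q.prod D.V).Bar (Λ.ext k) := (barPair Q D.V (Λ.ext k)).comp
    ((ContinuousLinearMap.inr ℝ _ _).comp (barLinL D.V (Λ.inl k).toAlgHom.toLinearMap))
  have hL : ∀ x, L x + c = barPair Q D.V (Λ.ext k)
      (pointCoord k (Λ.ext k) (Λ.inr k), D.V.barMap (Λ.inl k) x) := by
    intro x
    refine (map_add (barPair Q D.V (Λ.ext k)) _ _).symm.trans (congrArg _ (Prod.ext ?_ ?_))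
    · exact zero_add _
    · exact (add_zero _).trans (barLin_toAlgHom D.V (Λ.inl k) x)
  have hL1 : ∀ x, barFst Q D.V (Λ.ext k) (L x + c) = pointCoord k (Λ.ext k) (Λ.inr k) := fun x => by
    rw [hL, barFst_pair]
  have hL2 : ∀ x, barSnd Q D.V (Λ.ext k) (L x + c) = D.V.barMap (Λ.inl k) x := fun x => by
    rw [hL, barSnd_pair]
  have hLs : ∀ (a : GrassEven Λ) x, L (a • x) = GrHom.even (Λ.inl k) a • L x := by
    intro a x
    refine Eq.trans ?_ (barPair_smul Q D.V (Λ.ext k) _ _)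
    refine congrArg (barPair Q D.V (Λ.ext k)) (Prod.ext (smul_zero _).symm ?_)
    exact barLin_smul D.V (GrHom.isEvenMap _) (fun y => map_mul (Λ.inl k).toAlgHom _ _) x
  refine ⟨fun x => P (s (L x + c)), SupersmoothOn.comp_semilinear ?_ hs (GrHom.even (Λ.inl k)) L c
    P hLs hP ?_, fun x hx => congrArg P ?_⟩
  · exact (D.chart.isOpen_preimage (N.isOpen _)).preimage (barSnd Q D.V (Λ.ext k)).continuous
  · rintro x ⟨hx, hm⟩
    change barSnd Q D.V (Λ.ext k) (L x + c) ∈ D.chart.preimage (N.pts (Λ.ext k))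
    rw [hL2]
    exact ⟨(D.map (Λ.inl k) ⟨x, hx⟩).2, N.pts_map_mem (Λ.inl k) _ hm⟩
  · have e : (⟨barSnd Q D.V (Λ.ext k) (L x + c), (hL2 x).symm ▸ (D.map (Λ.inl k) x).2⟩ :
        D.pts (Λ.ext k)) = D.map (Λ.inl k) x := Subtype.ext (hL2 x)
    have hm : (⟨barSnd Q D.V (Λ.ext k) (L x + c), (hL2 x).symm ▸ (D.map (Λ.inl k) x).2⟩ :
        D.pts (Λ.ext k)) ∈ N.pts (Λ.ext k) := by
      rw [e]
      exact N.pts_map_mem (Λ.inl k) x hx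
    refine (hs' (L x + c) _ hm).trans (LocSec.val_congr σ ?_ e hm _)
    refine (congrArg (pointHom k (Λ.ext k)) (hL1 x)).trans ?_
    exact (pointEquiv k (Λ.ext k)).symm_apply_apply _

/-- Naturality holds because the coefficient map commutes with φ ⊗ id, and supersmoothness because
it is linear for left multiplication by Λ. -/
theorem LocSec.isSupersmoothFamily_coefEven {k : Gr} (l : Module.Dual ℝ (GrassPart k 0))
    (σ : (LocSec D W N).obj k) :
    IsSupersmoothFamily N W fun Λ x hx => LocSec.coefEven l Λ x hx σ := by
  refine ⟨fun {Λ Λ'} φ x hx => ?_, fun Λ => LocSec.exists_smooth_univ σ Λ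
    (barLinL W (Λ.coef (extendDual l))) fun a y => ?_⟩
  · simp only [LocSec.coefEven, LinearMap.comp_apply, ← LocSec.univ_natural σ φ x hx,
      ← barLin_toAlgHom]
    rw [barLin_barLin W _ (Gr.coef_isEvenMap Λ l), barLin_barLin W _ (GrHom.isEvenMap _),
      Gr.coef_extMap]
  · exact barLin_smul W (a := GrHom.even (Λ.inl k) a) (a' := a) (Gr.coef_isEvenMap Λ l)
      (fun z => Gr.coef_inl_mul Λ (extendDual l) a.1 z) y

theorem LocSec.isSupersmoothFamily_coefOdd {k : Gr} (l : Module.Dual ℝ (GrassPart k 1))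
    (σ : (LocSec D W N).obj k) :
    IsSupersmoothFamily N W.parity fun Λ x hx => LocSec.coefOdd l Λ x hx σ := by
  refine ⟨fun {Λ Λ'} φ x hx => ?_, fun Λ => LocSec.exists_smooth_univ σ Λ
    (barFlipL W (Λ.coef (extendDual l))) fun a y => ?_⟩
  · simp only [LocSec.coefOdd, LinearMap.comp_apply, ← LocSec.univ_natural σ φ x hx,
      ← barLin_toAlgHom]
    rw [barLin_barFlip W _ (Gr.coef_isOddMap Λ l), barFlip_barLin W _ (GrHom.isEvenMap _),
      Gr.coef_extMap]
  · exact barFlip_smul W (a := GrHom.even (Λ.inl k) a) (a' := a) (Gr.coef_isOddMap Λ l)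
      (fun z => Gr.coef_inl_mul Λ (extendDual l) a.1 z) y

/-- The superpoint of the algebra of rank zero is a point, so a supersmooth family is itself a
section, with no dependence on η. -/
theorem IsSupersmoothFamily.exists_even
    {g : ∀ (Λ : Gr) (x : D.pts Λ), x ∈ N.pts Λ → W.Bar Λ} (hg : IsSupersmoothFamily N W g) :
    ∃ σ : (LocSec D W N).obj Gr.zero, ∀ {Λ : Gr} (η : Gr.zero ⟶ Λ) (x : D.pts Λ)
      (hx : x ∈ N.pts Λ), LocSec.val η x hx σ = g Λ x hx := by
  refine LocSec.exists_of_val (fun {Λ} _ x hx => g Λ x hx) (fun φ _ x hx => hg.1 φ x hx) fun Λ => ?_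
  obtain ⟨s, hs, hs'⟩ := hg.2 Λ
  exact ⟨fun y => s (barSnd (pointDomain Gr.zero).V D.V Λ y),
    hs.comp_clm _ (barHom_smul _ _ _) fun y hy => hy, fun y hy hm => hs' ⟨_, hy⟩ hm⟩

/-- Multiplication with the odd part of an element of the Grassmann algebra. -/
noncomputable def oddMul (W : TopSVect.{v}) (Λ : Gr) :
    Grass Λ →ₗ[ℝ] W.parity.Bar Λ →ₗ[ℝ] W.Bar Λ :=
  barUnflip W ∘ₗ Λ.rmul ∘ₗ GrassPart.val Λ 1 ∘ₗ grassProj Λ 1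

theorem oddMul_coe {Λ : Gr} (a : GrassPart Λ 1) (y : W.parity.Bar Λ) :
    oddMul W Λ a.1 y = barUnflip W (Λ.rmul a.1) y :=
  congrArg (fun b : GrassPart Λ 1 => barUnflip W (Λ.rmul b.1) y) (grassProj_coe a)

theorem rmul_smul {Λ : Gr} (c : GrassEven Λ) (a : GrassPart Λ 1) :
    Λ.rmul (c • a).1 = LinearMap.mulLeft ℝ c.1 ∘ₗ Λ.rmul a.1 :=
  LinearMap.ext fun x => by
    simp only [Gr.rmul_apply, GrassPart.coe_smul, LinearMap.comp_apply, LinearMap.mulLeft_apply]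
    rw [← mul_assoc, ← grass_even_comm, mul_assoc]

theorem barUnflip_rmul_smul {Λ : Gr} (c : GrassEven Λ) (a : GrassPart Λ 1) (y : W.parity.Bar Λ) :
    barUnflip W (Λ.rmul (c • a).1) y = c • barUnflip W (Λ.rmul a.1) y := by
  rw [rmul_smul, ← barLin_barUnflip W _ (Gr.rmul_isOddMap a), barLin_mulLeft]

theorem SupersmoothOn.oddMul {E : Type u} [AddCommGroup E] [Module ℝ E] [TopologicalSpace E]
    [IsTopologicalAddGroup E] [ContinuousSMul ℝ E] {Λ : Gr} [Module (GrassEven Λ) E]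
    {f : E → Grass Λ} {g : E → W.parity.Bar Λ} {S : Set E}
    (hf : SupersmoothOn (GrassEven Λ) f S) (hg : SupersmoothOn (GrassEven Λ) g S) :
    SupersmoothOn (GrassEven Λ) (fun x => _root_.oddMul W Λ (f x) (g x)) S := by
  refine SupersmoothOn.bilin (_root_.oddMul W Λ)
    (continuous_grass_bilin _ fun a => continuous_barUnflip W _) (fun a z y => ?_) (fun a z y => ?_)
    hf hg
  · change barUnflip W (Λ.rmul (grassProj Λ 1 (a • z)).1) y = _
    rw [grassProj_smul]
    exact barUnflip_rmul_smul a _ y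
  · exact barUnflip_smul W (Gr.rmul_isOddMap (grassProj Λ 1 z)) (fun x => mul_assoc _ _ _) y

theorem barMap_barUnflip_rmul {Λ Λ' : Gr} (φ : Λ ⟶ Λ') (a : GrassPart Λ 1) (y : W.parity.Bar Λ) :
    W.barMap φ (barUnflip W (Λ.rmul a.1) y) =
      barUnflip W (Λ'.rmul (GrHom.part φ 1 a).1) (W.parity.barMap φ y) := by
  rw [← barLin_toAlgHom, ← barLin_toAlgHom, barLin_barUnflip W _ (Gr.rmul_isOddMap a),
    barUnflip_barLin W _ (GrHom.isEvenMap φ)]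
  congr 2
  exact LinearMap.ext fun x => map_mul φ.toAlgHom _ _

/-- The section is g·θ. Right multiplication by the odd element η(θ) turns values for ΠW into values
for W, and the result is supersmooth in x and in the odd coordinate as a product of supersmooth
maps. -/
theorem IsSupersmoothFamily.exists_odd
    {g : ∀ (Λ : Gr) (x : D.pts Λ), x ∈ N.pts Λ → W.parity.Bar Λ}
    (hg : IsSupersmoothFamily N W.parity g) :
    ∃ σ : (LocSec D W N).obj Gr.one, ∀ {Λ : Gr} (η : Gr.one ⟶ Λ) (x : D.pts Λ)
      (hx : x ∈ N.pts Λ), LocSec.val η x hx σ =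
        barUnflip W (Λ.rmul (GrHom.part η 1 Gr.theta).1) (g Λ x hx) := by
  refine LocSec.exists_of_val (fun {Λ} η x hx =>
    barUnflip W (Λ.rmul (GrHom.part η 1 Gr.theta).1) (g Λ x hx)) (fun φ η x hx => ?_) fun Λ => ?_
  · rw [barMap_barUnflip_rmul, hg.1]
    rfl
  · obtain ⟨s, hs, hs'⟩ := hg.2 Λ
    refine ⟨fun y => oddMul W Λ ((pointHom Gr.one Λ (barFst (pointDomain Gr.one).V D.V Λ y)).toAlgHom
      Gr.theta.1) (s (barSnd (pointDomain Gr.one).V D.V Λ y)), ?_, fun y hy hm => ?_⟩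
    · exact SupersmoothOn.oddMul ((supersmoothOn_pointHom Gr.one Λ Gr.theta.1 Set.univ).comp_clm _
        (barHom_smul _ _ _) fun _ _ => trivial) (hs.comp_clm _ (barHom_smul _ _ _) fun y hy => hy)
    · rw [← hs' ⟨_, hy⟩ hm]
      exact oddMul_coe (GrHom.part (pointHom Gr.one Λ _) 1 Gr.theta) _

/-! ### The expansion of a section in the coordinates of a superpoint -/

/-- The morphism θ ↦ 0 factors through ℝ, where a section of the odd part becomes zero. -/
theorem LocSec.val_pt_zero {σ : (LocSec D W N).obj Gr.one} (hσ : σ ∈ (LocSec D W N).oddPart)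
    {Λ : Gr} (x : D.pts Λ) (hx : x ∈ N.pts Λ) : LocSec.val (Gr.pt 0) x hx σ = 0 := by
  have h := congrArg (LocSec.val Λ.unit x hx) (RBarMod.mem_oddPart.1 hσ)
  rw [LocSec.val_map, Gr.pt_comp, map_zero, map_zero] at h
  exact h

/-- In the expansion in one odd variable the constant term vanishes, so only the θ-coefficient
remains. -/
theorem LocSec.val_odd {σ : (LocSec D W N).obj Gr.one} (hσ : σ ∈ (LocSec D W N).oddPart)
    {Λ : Gr} (η : Gr.one ⟶ Λ) (x : D.pts Λ) (hx : x ∈ N.pts Λ) : LocSec.val η x hx σ =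
      barUnflip W (Λ.rmul (GrHom.part η 1 Gr.theta).1) (LocSec.coefOdd Gr.thetaDual Λ x hx σ) := by
  have h := LocSec.val_pt_zero hσ x hx
  rw [LocSec.val_eq, ← barLin_toAlgHom] at h
  rw [LocSec.val_eq, ← barLin_toAlgHom, Gr.desc_one_eq, map_add, LinearMap.add_apply, h, zero_add,
    ← barUnflip_barFlip W _ (Gr.coef_isOddMap Λ Gr.thetaDual)]
  rfl

variable (D W N) in
-- By `LocSec.val_odd` the parameter enters only through right multiplication by the image of θ, and
-- that is linear over the even part.
theorem LocSec.oddLinear : (LocSec D W N).OddLinear := by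
  refine fun Λ σ hσ => ⟨fun a b => LocSec.ext fun η x hx => ?_, fun c a => LocSec.ext fun η x hx => ?_⟩
  · simp only [map_add, LocSec.val_map, Gr.pt_comp, LocSec.val_odd hσ, Gr.pt_theta]
    have h : (GrHom.part η 1 a + GrHom.part η 1 b).1 =
      (GrHom.part η 1 a).1 + (GrHom.part η 1 b).1 := rfl
    rw [h, map_add, map_add, LinearMap.add_apply]
  · simp only [LocSec.val_smul, LocSec.val_map, Gr.pt_comp, LocSec.val_odd hσ, Gr.pt_theta]
    have h : GrHom.part η 1 (c • a) = GrHom.even η c • GrHom.part η 1 a :=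
      Subtype.ext (map_mul η.toAlgHom c.1 a.1)
    rw [h, barUnflip_rmul_smul]

/-- Inserting a on the right and then reading off a coefficient leaves the scalar l(a). Hence taking
coefficients inverts the comparison. -/
theorem coef_rmul_inl {Λ k : Gr} (l : Module.Dual ℝ (Grass k)) (a : Grass k) :
    Λ.coef l ∘ₗ (Λ.ext k).rmul ((Λ.inr k).toAlgHom a) ∘ₗ (Λ.inl k).toAlgHom.toLinearMap =
      l a • LinearMap.id :=
  LinearMap.ext fun x => Gr.coef_mul Λ l x a

theorem rmul_inl_isEvenMap {Λ k : Gr} (a : GrassPart k 0) :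
    IsEvenMap ((Λ.ext k).rmul ((Λ.inr k).toAlgHom a.1) ∘ₗ (Λ.inl k).toAlgHom.toLinearMap) :=
  fun x => (congrArg _ (GrHom.map_inv (Λ.inl k) x)).trans
    (Gr.rmul_isEvenMap (GrHom.part (Λ.inr k) 0 a) _)

theorem rmul_inl_isOddMap {Λ k : Gr} (a : GrassPart k 1) :
    IsOddMap ((Λ.ext k).rmul ((Λ.inr k).toAlgHom a.1) ∘ₗ (Λ.inl k).toAlgHom.toLinearMap) :=
  fun x => (congrArg _ (GrHom.map_inv (Λ.inl k) x)).trans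
    (Gr.rmul_isOddMap (GrHom.part (Λ.inr k) 1 a) _)

/-- At the universal point a acts through its image in `Λ.ext k`. Being even it may be moved to the
right, the form from which coefficients are read. -/
theorem LocSec.univ_evenAct {k Λ : Gr} (a : GrassPart k 0) (s : (LocSec D W N).obj Gr.zero)
    (x : D.pts Λ) (hx : x ∈ N.pts Λ) :
    LocSec.univ Λ x hx ((LocSec D W N).evenAct k (a ⊗ₜ s)) =
      barLin W ((Λ.ext k).rmul ((Λ.inr k).toAlgHom a.1) ∘ₗ (Λ.inl k).toAlgHom.toLinearMap)
        (LocSec.val Λ.unit x hx s) := by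
  have h := LocSec.barMap_val s (Λ.inl k) Λ.unit x hx
  rw [RBarMod.evenAct_tmul, LocSec.univ, LocSec.val_smul, LocSec.val_map,
    Gr.unit_unique (k.unit ≫ Λ.inr k) (Λ.unit ≫ Λ.inl k), ← h,
    ← barLin_barLin W _ (GrHom.isEvenMap (Λ.inl k)), barLin_toAlgHom, ← barLin_mulLeft,
    mulLeft_eq_rmul]
  rfl

theorem LocSec.univ_oddAct {k Λ : Gr} (a : GrassPart k 1) (s : (LocSec D W N).oddPart)
    (x : D.pts Λ) (hx : x ∈ N.pts Λ) :
    LocSec.univ Λ x hx ((LocSec.oddLinear D W N).oddAct k (a ⊗ₜ s)) =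
      barUnflip W ((Λ.ext k).rmul ((Λ.inr k).toAlgHom a.1) ∘ₗ (Λ.inl k).toAlgHom.toLinearMap)
        (LocSec.coefOdd Gr.thetaDual Λ x hx s.1) := by
  have h : W.parity.barMap (Λ.inl k) (LocSec.coefOdd Gr.thetaDual Λ x hx s.1) =
      LocSec.coefOdd Gr.thetaDual _ (D.map (Λ.inl k) x) (N.pts_map_mem _ x hx) s.1 :=
    (LocSec.isSupersmoothFamily_coefOdd Gr.thetaDual s.1).1 (Λ.inl k) x hx
  rw [RBarMod.OddLinear.oddAct_tmul, LocSec.univ, LocSec.val_map, LocSec.val_odd s.2, ← h,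
    ← barUnflip_barLin W _ (GrHom.isEvenMap (Λ.inl k)), barLin_toAlgHom, Gr.pt_comp, Gr.pt_theta]
  rfl

theorem LocSec.coefEven_evenAct {k Λ : Gr} (l : Module.Dual ℝ (GrassPart k 0))
    (z : GrassPart k 0 ⊗[ℝ] (LocSec D W N).obj Gr.zero) (x : D.pts Λ) (hx : x ∈ N.pts Λ) :
    LocSec.coefEven l Λ x hx ((LocSec D W N).evenAct k z) =
      LocSec.val Λ.unit x hx (slice _ l z) := by
  induction z with
  | zero => simp
  | add y z hy hz => simp only [map_add, hy, hz]
  | tmul a s =>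
    rw [LocSec.coefEven, LinearMap.comp_apply, LocSec.univ_evenAct,
      barLin_barLin W _ (rmul_inl_isEvenMap a), coef_rmul_inl, extendDual_coe, map_smul,
      LinearMap.smul_apply, barLin_id, slice_tmul, map_smul]

/-- A functional on the even part, extended by zero, vanishes on the odd elements a inserted here.
-/
theorem LocSec.coefEven_oddAct {k Λ : Gr} (l : Module.Dual ℝ (GrassPart k 0))
    (z : GrassPart k 1 ⊗[ℝ] (LocSec D W N).oddPart) (x : D.pts Λ) (hx : x ∈ N.pts Λ) :
    LocSec.coefEven l Λ x hx ((LocSec.oddLinear D W N).oddAct k z) = 0 := by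
  induction z with
  | zero => simp
  | add y z hy hz => rw [map_add, map_add, hy, hz, add_zero]
  | tmul a s =>
    rw [LocSec.coefEven, LinearMap.comp_apply, LocSec.univ_oddAct,
      barLin_barUnflip W _ (rmul_inl_isOddMap a), coef_rmul_inl, extendDual_odd, zero_smul,
      map_zero, LinearMap.zero_apply]

theorem LocSec.coefOdd_evenAct {k Λ : Gr} (l : Module.Dual ℝ (GrassPart k 1))
    (z : GrassPart k 0 ⊗[ℝ] (LocSec D W N).obj Gr.zero) (x : D.pts Λ) (hx : x ∈ N.pts Λ) :
    LocSec.coefOdd l Λ x hx ((LocSec D W N).evenAct k z) = 0 := by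
  induction z with
  | zero => simp
  | add y z hy hz => rw [map_add, map_add, hy, hz, add_zero]
  | tmul a s =>
    rw [LocSec.coefOdd, LinearMap.comp_apply, LocSec.univ_evenAct,
      barFlip_barLin W _ (rmul_inl_isEvenMap a), coef_rmul_inl, extendDual_even, zero_smul,
      map_zero, LinearMap.zero_apply]

theorem LocSec.coefOdd_oddAct {k Λ : Gr} (l : Module.Dual ℝ (GrassPart k 1))
    (z : GrassPart k 1 ⊗[ℝ] (LocSec D W N).oddPart) (x : D.pts Λ) (hx : x ∈ N.pts Λ) :
    LocSec.coefOdd l Λ x hx ((LocSec.oddLinear D W N).oddAct k z) =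
      LocSec.coefOdd Gr.thetaDual Λ x hx (slice _ l z).1 := by
  induction z with
  | zero => simp
  | add y z hy hz => simp only [map_add, hy, hz, Submodule.coe_add]
  | tmul a s =>
    conv_lhs => rw [LocSec.coefOdd, LinearMap.comp_apply, LocSec.univ_oddAct,
      barFlip_barUnflip W _ (rmul_inl_isOddMap a), coef_rmul_inl, extendDual_coe, map_smul,
      LinearMap.smul_apply, barLin_id]
    rw [slice_tmul, Submodule.coe_smul, map_smul]

/-- If the image of z is zero, so are all its coefficients. The even ones are the values of the
slices of the even component of z; the odd ones are the θ-coefficients of the slices of the odd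
component. -/
theorem LocSec.comparison_injective (k : Gr) :
    Function.Injective (RBarMod.Hom.app (LocSec.oddLinear D W N).comparison k) := by
  refine (injective_iff_map_eq_zero _).2 fun z hz => ?_
  let y₀ : GrassPart k 0 ⊗[ℝ] (LocSec D W N).obj Gr.zero := z.1
  let y₁ : GrassPart k 1 ⊗[ℝ] (LocSec D W N).oddPart := z.2
  have hz' : (LocSec D W N).evenAct k y₀ + (LocSec.oddLinear D W N).oddAct k y₁ = 0 := hz
  refine SVect.bar_ext (tensor_eq_zero_of_slice fun l => LocSec.ext fun {Λ} η x hx => ?_)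
    (tensor_eq_zero_of_slice fun l => Subtype.ext (LocSec.ext fun {Λ} η x hx => ?_))
  · have h := congrArg (LocSec.coefEven l Λ x hx) hz'
    rw [map_add, LocSec.coefEven_oddAct, LocSec.coefEven_evenAct, add_zero, map_zero] at h
    rw [Gr.unit_unique η Λ.unit]
    exact h.trans (map_zero _).symm
  · have h := congrArg (LocSec.coefOdd l Λ x hx) hz'
    rw [map_add, LocSec.coefOdd_oddAct, LocSec.coefOdd_evenAct, zero_add, map_zero] at h
    -- A section in the odd part is its θ-coefficient multiplied by η(θ), so it vanishes together
    -- with that coefficient.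
    refine (LocSec.val_odd (slice _ l y₁).2 η x hx).trans ?_
    refine (congrArg _ h).trans ?_
    rw [map_zero]
    exact (map_zero _).symm

theorem LocSec.mem_oddPart_of_val {σ : (LocSec D W N).obj Gr.one}
    {g : ∀ (Λ : Gr) (x : D.pts Λ), x ∈ N.pts Λ → W.parity.Bar Λ}
    (hσ : ∀ {Λ : Gr} (η : Gr.one ⟶ Λ) (x : D.pts Λ) (hx : x ∈ N.pts Λ),
      LocSec.val η x hx σ = barUnflip W (Λ.rmul (GrHom.part η 1 Gr.theta).1) (g Λ x hx)) :
    σ ∈ (LocSec D W N).oddPart := by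
  refine RBarMod.mem_oddPart.2 (LocSec.ext fun {Λ} η x hx => ?_)
  have h : (0 : GrassPart Λ 1).1 = 0 := rfl
  rw [LocSec.val_map, Gr.pt_comp, map_zero, hσ, Gr.pt_theta, h]
  simp only [map_zero, LinearMap.zero_apply]

/-- The coefficients of σ along bases of the two parts of k are supersmooth families, hence come
from sections `s J` over ℝ and `t J` in the odd part. Their tensors with the basis elements form the
preimage. -/
theorem LocSec.comparison_surjective (k : Gr) :
    Function.Surjective (RBarMod.Hom.app (LocSec.oddLinear D W N).comparison k) := by
  intro σ
  choose s hs using fun J => (LocSec.isSupersmoothFamily_coefEven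
    ((partBasis k 0).coord J) (σ : (LocSec D W N).obj k)).exists_even
  choose t ht using fun J => (LocSec.isSupersmoothFamily_coefOdd
    ((partBasis k 1).coord J) (σ : (LocSec D W N).obj k)).exists_odd
  let y₀ : GrassPart k 0 ⊗[ℝ] (LocSec D W N).obj Gr.zero := ∑ J, partBasis k 0 J ⊗ₜ s J
  let y₁ : GrassPart k 1 ⊗[ℝ] (LocSec D W N).oddPart :=
    ∑ J, partBasis k 1 J ⊗ₜ ⟨t J, LocSec.mem_oddPart_of_val (ht J)⟩
  refine ⟨((y₀, y₁) : (LocSec D W N).super.Bar k), ?_⟩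
  change (LocSec D W N).evenAct k y₀ + (LocSec.oddLinear D W N).oddAct k y₁ = σ
  refine LocSec.ext fun {Λ} η x hx => ?_
  -- Expanding the evaluation at η along the bases turns the value of σ into two sums, which match
  -- the two halves of the comparison term by term.
  rw [LocSec.val_eq σ, ← barLin_toAlgHom, Gr.desc_eq_sum]
  simp only [map_add, map_sum, y₀, y₁, LinearMap.add_apply, LinearMap.sum_apply]
  congr 1
  · refine Finset.sum_congr rfl fun J _ => ?_
    rw [RBarMod.evenAct_tmul, LocSec.val_smul, LocSec.val_map, hs,
      ← barLin_barLin W _ (Gr.coef_isEvenMap Λ _), ← barLin_mulLeft, mulLeft_eq_rmul]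
    rfl
  · refine Finset.sum_congr rfl fun J _ => ?_
    rw [RBarMod.OddLinear.oddAct_tmul, LocSec.val_map, ht, Gr.pt_comp, Gr.pt_theta,
      ← barUnflip_barFlip W _ (Gr.coef_isOddMap Λ _)]
    rfl

end Local

/-! ### Sections of a trivial bundle over a superdomain -/

section Trivial

variable {D : SuperDomain.{u}} {W : TopSVect.{v}}

theorem OpenSub.mem_pts_top {Λ : Gr} (x : D.pts Λ) :
    x ∈ (OpenSub.top D.toSuperManifold.F).pts Λ := trivial

theorem mem_SCinf_iff {f : ∀ Λ, D.pts Λ → W.Bar Λ} : f ∈ SCinf D W ↔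
    IsSupersmoothFamily (OpenSub.top D.toSuperManifold.F) W fun Λ x _ => f Λ x := by
  have h : ∀ Λ, D.chart.preimage ((OpenSub.top D.toSuperManifold.F).pts Λ) = D.pts Λ := fun Λ =>
    Set.ext fun x => ⟨fun hx => hx.1, fun hx => ⟨hx, trivial⟩⟩
  refine ⟨fun hf => ⟨fun φ x _ => hf.1 φ x, fun Λ => ?_⟩,
    fun hf => ⟨fun φ x => hf.1 φ x trivial, fun Λ => ?_⟩⟩
  · obtain ⟨s, hs, hs'⟩ := hf.2 Λ
    exact ⟨s, (h Λ).symm ▸ hs, fun x _ => hs' x⟩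
  · obtain ⟨s, hs, hs'⟩ := hf.2 Λ
    exact ⟨s, h Λ ▸ hs, fun x => hs' x trivial⟩

/-- The general smoothness statement for universal values is used with the projection of `Λ.ext
Gr.zero` to Λ as return map. -/
theorem LocSec.isSupersmoothFamily_val {N : OpenSub D.toSuperManifold.F}
    (σ : (LocSec D W N).obj Gr.zero) :
    IsSupersmoothFamily N W fun Λ x hx => LocSec.val Λ.unit x hx σ := by
  refine ⟨fun {Λ Λ'} φ x hx => ?_, fun Λ => ?_⟩
  · rw [LocSec.barMap_val, Gr.unit_unique (Λ.unit ≫ φ) Λ'.unit]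
  · obtain ⟨s, hs, hs'⟩ := LocSec.exists_smooth_univ σ Λ
      (barLinL W (Gr.desc (𝟙 Λ) Λ.unit).toAlgHom.toLinearMap) fun a y => by
        refine barLin_smul W (a := GrHom.even (Λ.inl Gr.zero) a) (a' := a) (GrHom.isEvenMap _)
          (fun z => ?_) y
        refine (map_mul (Gr.desc (𝟙 Λ) Λ.unit).toAlgHom _ _).trans ?_
        exact congrArg (· * _) (Gr.desc_inl _ _ _)
    refine ⟨s, hs, fun x hx => (hs' x hx).trans ?_⟩
    exact (barLin_toAlgHom W _ _).trans (LocSec.val_eq σ Λ.unit x hx).symm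

/-- Reading off the θ-coefficient undoes multiplication by θ. -/
theorem LocSec.coefOdd_thetaDual {N : OpenSub D.toSuperManifold.F} {σ : (LocSec D W N).obj Gr.one}
    {g : ∀ (Λ : Gr) (x : D.pts Λ), x ∈ N.pts Λ → W.parity.Bar Λ}
    (hg : IsSupersmoothFamily N W.parity g)
    (hσ : ∀ {Λ : Gr} (η : Gr.one ⟶ Λ) (x : D.pts Λ) (hx : x ∈ N.pts Λ),
      LocSec.val η x hx σ = barUnflip W (Λ.rmul (GrHom.part η 1 Gr.theta).1) (g Λ x hx))
    {Λ : Gr} (x : D.pts Λ) (hx : x ∈ N.pts Λ) :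
    LocSec.coefOdd Gr.thetaDual Λ x hx σ = g Λ x hx := by
  rw [LocSec.coefOdd, LinearMap.comp_apply, LocSec.univ, hσ, ← hg.1 (Λ.inl Gr.one) x hx,
    ← barLin_toAlgHom, barUnflip_barLin W _ (GrHom.isEvenMap (Λ.inl Gr.one))]
  refine (barFlip_barUnflip W _ (rmul_inl_isOddMap Gr.theta) _).trans ?_
  rw [coef_rmul_inl, extendDual_coe, Gr.thetaDual_theta, one_smul, barLin_id]

variable (D W)

theorem LocSec.nonempty_evenEquiv : Nonempty
    ((LocSec D W (OpenSub.top D.toSuperManifold.F)).super.even ≃ₗ[ℝ] SCinf D W) := by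
  let f : (LocSec D W (OpenSub.top D.toSuperManifold.F)).obj Gr.zero →ₗ[ℝ] SCinf D W :=
    { toFun := fun σ => ⟨fun Λ x => LocSec.val Λ.unit x (OpenSub.mem_pts_top x) σ,
        mem_SCinf_iff.2 (LocSec.isSupersmoothFamily_val σ)⟩
      map_add' := fun σ τ => Subtype.ext (funext fun Λ => funext fun x => map_add _ σ τ)
      map_smul' := fun r σ => Subtype.ext (funext fun Λ => funext fun x => map_smul _ r σ) }
  refine ⟨LinearEquiv.ofBijective f ⟨fun σ τ h => LocSec.ext fun {Λ} η x hx => ?_, fun g => ?_⟩⟩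
  · rw [Gr.unit_unique η Λ.unit]
    exact congrFun (congrFun (congrArg Subtype.val h) Λ) x
  · obtain ⟨σ, hσ⟩ := (mem_SCinf_iff.1 g.2).exists_even
    exact ⟨σ, Subtype.ext (funext fun Λ => funext fun x => hσ _ x trivial)⟩

/-- The isomorphism takes the θ-coefficient. It is injective because a section in the odd part is
determined by that coefficient, and surjective because g·θ has coefficient g. -/
theorem LocSec.nonempty_oddEquiv : Nonempty
    ((LocSec D W (OpenSub.top D.toSuperManifold.F)).super.odd ≃ₗ[ℝ] SCinf D W.parity) := by
  let f : (LocSec D W (OpenSub.top D.toSuperManifold.F)).oddPart →ₗ[ℝ] SCinf D W.parity :=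
    { toFun := fun σ => ⟨fun Λ x => LocSec.coefOdd Gr.thetaDual Λ x (OpenSub.mem_pts_top x) σ.1,
        mem_SCinf_iff.2 (LocSec.isSupersmoothFamily_coefOdd Gr.thetaDual σ.1)⟩
      map_add' := fun σ τ => Subtype.ext (funext fun Λ => funext fun x => map_add _ σ.1 τ.1)
      map_smul' := fun r σ => Subtype.ext (funext fun Λ => funext fun x => map_smul _ r σ.1) }
  refine ⟨LinearEquiv.ofBijective f
    ⟨fun σ τ h => Subtype.ext (LocSec.ext fun {Λ} η x hx => ?_), fun g => ?_⟩⟩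
  · rw [LocSec.val_odd σ.2, LocSec.val_odd τ.2]
    exact congrArg _ (congrFun (congrFun (congrArg Subtype.val h) Λ) x)
  · have hg := mem_SCinf_iff.1 g.2
    obtain ⟨σ, hσ⟩ := hg.exists_odd
    exact ⟨⟨σ, LocSec.mem_oddPart_of_val hσ⟩,
      Subtype.ext (funext fun Λ => funext fun x => LocSec.coefOdd_thetaDual hg hσ x trivial)⟩

theorem LocSec.nonempty_iso_SCinf : Nonempty (LocSec D W (OpenSub.top D.toSuperManifold.F) ≅
    (SCinf.super D W).bar) := by
  have := RBarMod.isIso_of_bijective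
    (LocSec.oddLinear D W (OpenSub.top D.toSuperManifold.F)).comparison fun k =>
      ⟨LocSec.comparison_injective k, LocSec.comparison_surjective k⟩
  obtain ⟨f⟩ := LocSec.nonempty_evenEquiv D W
  obtain ⟨g⟩ := LocSec.nonempty_oddEquiv D W
  obtain ⟨e⟩ := SVect.nonempty_bar_iso (V' := SCinf.super D W) f g
  exact ⟨(asIso (LocSec.oddLinear D W (OpenSub.top D.toSuperManifold.F)).comparison).symm ≪≫ e⟩

end Trivial

/-! ### Sections of a super vector bundle -/

section Bundle

variable {M : SuperManifold.{u}} (E : SuperVectorBundle.{u, v, w} M)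

theorem hatSections_oddLinear (N : OpenSub M.F) : (hatSections E N).OddLinear :=
  RBarMod.JointlyInjective.oddLinear (f := chartRestrict E N) (chartRestrict_jointlyInjective E N)
    fun _ => LocSec.oddLinear _ _ _

/-- No chart over N is required. This generality is needed for intersections of two charts in the
glueing argument. -/
theorem hatSections_comparison_injective (N : OpenSub M.F) (Λ : Gr) :
    Function.Injective (RBarMod.Hom.app (hatSections_oddLinear E N).comparison Λ) :=
  RBarMod.JointlyInjective.comparison_injective (f := chartRestrict E N)
    (chartRestrict_jointlyInjective E N) _ (fun _ => LocSec.oddLinear _ _ _)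
    (fun _ k => LocSec.comparison_injective k) Λ

/-- The descent criterion with a one-element covering: the pullback along the trivialization is
bijective, so glueing is just the choice of a preimage, and surjectivity is transported from the
trivial bundle. -/
theorem hatSections_comparison_surjective (i : E.ι) (Λ : Gr) : Function.Surjective
    (RBarMod.Hom.app (hatSections_oddLinear E (E.chart i).image).comparison Λ) :=
  RBarMod.JointlyInjective.comparison_surjective (I := Unit) (f := fun _ => chartPullback E i)
    (p := fun _ _ => 𝟙 _) (q := fun _ _ => 𝟙 _)
    (fun Λ _ h => (chartPullback_bijective E i Λ).1 ((h ()).trans (map_zero _).symm))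
    (fun _ _ _ _ => rfl)
    (fun Λ x _ => ((chartPullback_bijective E i Λ).2 (x ())).imp fun _ h _ => h) _
    (fun _ => LocSec.oddLinear _ _ _) (fun _ _ => LocSec.oddLinear _ _ _)
    (fun _ k => LocSec.comparison_surjective k) (fun _ _ k => LocSec.comparison_injective k) Λ

/-- The descent criterion for the covering by all charts: surjectivity over each chart, injectivity
over each overlap, and the glueing of sections. -/
theorem hatSections_isSuperrepresentable :
    (hatSections E (OpenSub.top M.F)).IsSuperrepresentable := by
  refine RBarMod.isSuperrepresentable_of_comparison (hatSections_oddLinear E _) fun Λ =>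
    ⟨hatSections_comparison_injective E _ Λ, ?_⟩
  refine RBarMod.JointlyInjective.comparison_surjective
    (f := fun i => hatRestrict E (OpenSub.top M.F) (E.chart i).image fun _ _ _ => trivial)
    (p := fun i j => hatRestrict E (E.chart i).image
      ((E.chart i).image.inter (E.chart j).image) fun _ _ h => h.1)
    (q := fun i j => hatRestrict E (E.chart j).image
      ((E.chart i).image.inter (E.chart j).image) fun _ _ h => h.2)
    (fun Λ (σ : HatObj E (OpenSub.top M.F) Λ) h => HatObj.ext fun {Λ'} η m _ => ?_)
    (fun _ _ _ _ => rfl) (fun Λ x hx => ?_) _ (fun i => hatSections_oddLinear E _)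
    (fun i j => hatSections_oddLinear E _) (fun i => hatSections_comparison_surjective E i)
    (fun i j => hatSections_comparison_injective E _) Λ
  · obtain ⟨i, hi⟩ := E.cover Λ' m
    exact congrArg (fun τ : HatObj E (E.chart i).image Λ => τ.eval η m hi) (h i)
  · obtain ⟨y, hy⟩ := exists_glued_section x fun i j Λ' η m hi hj =>
      congrArg (fun τ : HatObj E ((E.chart i).image.inter (E.chart j).image) Λ =>
        τ.eval η m ⟨hi, hj⟩) (hx i j)
    exact ⟨y, fun i => HatObj.ext (N := (E.chart i).image) fun η m hi => hy i η m hi⟩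

end Bundle

theorem mainTheorem5 (M : SuperManifold.{u}) (E : SuperVectorBundle.{u, v, w} M) :
    (hatSections E (OpenSub.top M.F)).IsSuperrepresentable ∧
    (∀ i : E.ι,
      IsIso (chartPullback E i) ∧
      Nonempty (hatSections (trivialBundle (E.chart i).dom (E.fiber i))
          (OpenSub.top (E.chart i).dom.toSuperManifold.F) ≅
        (SCinf.super (E.chart i).dom (E.fiber i)).bar)) ∧
    Nonempty (Limits.IsLimit (gluingFork E)) :=
  ⟨hatSections_isSuperrepresentable E, fun i =>
    ⟨RBarMod.isIso_of_bijective (chartPullback E i) (chartPullback_bijective E i),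
      LocSec.nonempty_iso_SCinf _ _⟩, nonempty_isLimit_gluingFork E⟩
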